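/- Let $\mathbb F$ be an algebraically closed field of characteristic zero, $\mathbb V$ a finite-dimensional $\mathbb F$-vector space, $\mathfrak g=\mathfrak{gl}(\mathbb V)$, and let $\zeta\in\mathbb F$ be a primitive cube root of unity. For a Lie algebra $\mathfrak q$ and a finite-dimensional $\mathfrak q$-module $V$, put $\mathrm{ind}(\mathfrak q,V)=\dim V-\max_{\xi\in V^*}\dim(\mathfrak q\cdot\xi)$; for $v\in V$ let $\mathfrak q_v=\{x\in\mathfrak q: x\cdot v=0\}$, which acts on $V/\mathfrak q\cdot v$. One says that $(\mathfrak q,V)$ (or $(Q,V)$, if $\mathfrak q$ is the Lie algebra of an algebraic group $Q$ acting on $V$) has good index behaviour (GIB) if $\mathrm{ind}(\mathfrak q,V^*)=\mathrm{ind}(\mathfrak q_v,(V/\mathfrak q\cdot v)^*)$ for every $v\in V$. Let $\theta$ be an inner automorphism of $\mathfrak g$ of order $3$, i.e. an automorphism of order $3$ of the form $x\mapsto gxg^{-1}$ with $g\in\mathrm{GL}(\mathbb V)$. Let $\mathfrak g_0=\{x\in\mathfrak g:\theta(x)=x\}$, and let $G_0\subset \mathrm{GL}(\mathbb V)$ be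 the connected subgroup with Lie algebra $\mathfrak g_0$, acting by the adjoint representation on $\mathfrak g_1=\{x\in\mathfrak g:\theta(x)=\zeta x\}$. **Theorem.** There is $g\in\mathrm{GL}(\mathbb V)$ with $g^3=1$ such that $\theta$ is conjugation by $g$. For every such $g$, writing $r_t=\dim\ker(g-\zeta^t)$ for $t=0,1,2$ and $\hat r=(r_0,r_1,r_2)$, the $\theta$-representation $(G_0,\mathfrak g_1)$ has GIB if and only if, up to a cyclic permutation of its entries, $\hat r$ is equal to $(a,b,0)$, $(a,b,1)$ or $(2,2,a)$ for some non-negative integers $a,b$. -/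

import Mathlib

/-! ### Index and good index behaviour of a module over a Lie algebra

For an algebraic group `Q` with Lie algebra `𝔮` acting on `V`, the good index behaviour of `(Q, V)`
only involves the infinitesimal action of `𝔮` on `V`. -/

section GoodIndexBehaviour

variable (F : Type*) {𝔮 V : Type*} [Field F] [LieRing 𝔮] [LieAlgebra F 𝔮]
  [AddCommGroup V] [Module F V] [LieRingModule 𝔮 V] [LieModule F 𝔮 V]

/-- The tangent space `𝔮·v = {x·v | x ∈ 𝔮}` to the orbit of `v`. -/
def orbitTangent (𝔮 : Type*) [LieRing 𝔮] [LieAlgebra F 𝔮] [LieRingModule 𝔮 V] [LieModule F 𝔮 V]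
    (v : V) : Submodule F V where
  carrier := {w | ∃ x : 𝔮, ⁅x, v⁆ = w}
  zero_mem' := ⟨0, by simp⟩
  add_mem' := by
    rintro _ _ ⟨x, rfl⟩ ⟨y, rfl⟩
    exact ⟨x + y, by simp⟩
  smul_mem' := by
    rintro c _ ⟨x, rfl⟩
    exact ⟨c • x, by simp⟩

/-- The stabiliser `𝔮_v = {x ∈ 𝔮 | x·v = 0}`. -/
def lieStabilizer (𝔮 : Type*) [LieRing 𝔮] [LieAlgebra F 𝔮] [LieRingModule 𝔮 V] [LieModule F 𝔮 V]
    (v : V) : LieSubalgebra F 𝔮 where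
  carrier := {x | ⁅x, v⁆ = 0}
  zero_mem' := by simp
  add_mem' := by
    intro x y hx hy
    simp only [Set.mem_ofPred_eq] at hx hy ⊢
    rw [add_lie, hx, hy, add_zero]
  smul_mem' := by
    intro c x hx
    simp only [Set.mem_ofPred_eq] at hx ⊢
    rw [smul_lie, hx, smul_zero]
  lie_mem' := by
    intro x y hx hy
    change ⁅x, v⁆ = 0 at hx
    change ⁅y, v⁆ = 0 at hy
    change ⁅⁅x, y⁆, v⁆ = 0
    rw [lie_lie, hx, hy, lie_zero, lie_zero, sub_zero]

/-- `𝔮·v` as a `𝔮_v`-submodule of `V`, so that `V / 𝔮·v` is a `𝔮_v`-module. -/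
def orbitTangentLie (𝔮 : Type*) [LieRing 𝔮] [LieAlgebra F 𝔮] [LieRingModule 𝔮 V]
    [LieModule F 𝔮 V] (v : V) : LieSubmodule F (lieStabilizer F 𝔮 v) V where
  toSubmodule := orbitTangent F 𝔮 v
  lie_mem := by
    rintro ⟨x, hx⟩ _ ⟨y, rfl⟩
    refine ⟨⁅x, y⁆, ?_⟩
    change ⁅x, v⁆ = 0 at hx
    change ⁅⁅x, y⁆, v⁆ = ⁅x, ⁅y, v⁆⁆
    rw [lie_lie, hx, lie_zero, sub_zero]

/-- The index `ind(𝔮, V) = dim V - max_{ξ ∈ V*} dim 𝔮·ξ` of a finite-dimensional module `V`. -/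
noncomputable def lieIndex (𝔮 V : Type*) [LieRing 𝔮] [LieAlgebra F 𝔮]
    [AddCommGroup V] [Module F V] [LieRingModule 𝔮 V] [LieModule F 𝔮 V] : ℕ :=
  Module.finrank F V - ⨆ ξ : Module.Dual F V, Module.finrank F (orbitTangent F 𝔮 ξ)

/-- Good index behaviour: `ind(𝔮, V*) = ind(𝔮_v, (V / 𝔮·v)*)` for every `v ∈ V`. -/
def HasGIB (𝔮 V : Type*) [LieRing 𝔮] [LieAlgebra F 𝔮]
    [AddCommGroup V] [Module F V] [LieRingModule 𝔮 V] [LieModule F 𝔮 V] : Prop :=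
  ∀ v : V, lieIndex F 𝔮 (Module.Dual F V) =
    lieIndex F (lieStabilizer F 𝔮 v) (Module.Dual F (V ⧸ orbitTangentLie F 𝔮 v))

end GoodIndexBehaviour

/-! ### The `θ`-representation -/

section ThetaRepresentation

variable {F L : Type*} [Field F] [LieRing L] [LieAlgebra F L]

/-- `𝔤₀`, the subalgebra of fixed points of the automorphism `θ`. -/
def fixedSubalgebra (θ : L ≃ₗ⁅F⁆ L) : LieSubalgebra F L where
  carrier := {x | θ x = x}
  zero_mem' := by simp
  add_mem' := by
    intro x y hx hy
    simp only [Set.mem_ofPred_eq] at hx hy ⊢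
    rw [map_add, hx, hy]
  smul_mem' := by
    intro c x hx
    simp only [Set.mem_ofPred_eq] at hx ⊢
    rw [map_smul, hx]
  lie_mem' := by
    intro x y hx hy
    change θ x = x at hx
    change θ y = y at hy
    change θ ⁅x, y⁆ = ⁅x, y⁆
    rw [LieEquiv.map_lie, hx, hy]

/-- The eigenspace `{x | θ x = c • x}`, with the adjoint action of `𝔤₀`. For `θ` of order `m` and
`c = ζ` a primitive `m`-th root of unity this is `𝔤₁`. -/
def gradedPiece (θ : L ≃ₗ⁅F⁆ L) (c : F) : LieSubmodule F (fixedSubalgebra θ) L where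
  carrier := {x | θ x = c • x}
  zero_mem' := by simp
  add_mem' := by
    intro x y hx hy
    simp only [Set.mem_ofPred_eq] at hx hy ⊢
    rw [map_add, hx, hy, smul_add]
  smul_mem' := by
    intro a x hx
    simp only [Set.mem_ofPred_eq] at hx ⊢
    rw [map_smul, hx, smul_comm]
  lie_mem := by
    rintro ⟨x, hx⟩ y hy
    change θ x = x at hx
    change θ y = c • y at hy
    change θ ⁅x, y⁆ = c • ⁅x, y⁆
    rw [LieEquiv.map_lie, hx, hy, lie_smul]

/-- The `θ`-representation (of `𝔤₀`, the Lie algebra of `G₀`, on `𝔤₁`) has good index behaviour. -/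
def ThetaRepHasGIB (θ : L ≃ₗ⁅F⁆ L) (ζ : F) : Prop :=
  HasGIB F (fixedSubalgebra θ) (gradedPiece θ ζ)

end ThetaRepresentation

attribute [local instance 100] LieRing.ofAssociativeRing LieAlgebra.ofAssociativeAlgebra

/-! ### Inner automorphisms of `𝔤𝔩(𝕍)` -/

section InnerAutomorphisms

variable {F 𝕍 : Type*} [Field F] [AddCommGroup 𝕍] [Module F 𝕍]

/-- `θ` is conjugation by `g ∈ GL(𝕍)`. -/
def IsConjBy (θ : Module.End F 𝕍 ≃ₗ⁅F⁆ Module.End F 𝕍) (g : (Module.End F 𝕍)ˣ) : Prop :=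
  ∀ x : Module.End F 𝕍, θ x = ↑g * x * ↑g⁻¹

/-- `r̂ = (r₀, …, r_{m-1})`, where `r_t` is the dimension of the `ζ ^ t`-eigenspace of `g` in `𝕍`. -/
noncomputable def eigenDimVector (m : ℕ) (ζ : F) (g : (Module.End F 𝕍)ˣ) : Fin m → ℕ :=
  fun t => Module.finrank F (Module.End.eigenspace (g : Module.End F 𝕍) (ζ ^ (t : ℕ)))

end InnerAutomorphisms

/-- `r` and `s` agree up to a cyclic permutation of the entries. -/
def CyclicallyEqual {m : ℕ} (r s : Fin m → ℕ) : Prop :=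
  ∃ k : Fin m, ∀ i : Fin m, r (i + k) = s i

/-!
# Good index behaviour of `θ`-representations of order three on `𝔤𝔩(𝕍)`

Let `g³ = 1` and let `𝔤ᵢ = {x | g x g⁻¹ = ζⁱ x}`, the space `gradedPart g (ζ ^ i)`. The trace form
identifies the dual of `𝔤₁` with `𝔤₂`, and the annihilator of `𝔤₀·v + (𝔤₀)_v·η` with the space
`sliceKernel g ζ v η`: it consists of the `y ∈ 𝔤₂` which commute with `v` and, to first order, also
with `v + ε η` (`exists_deformation_of_mem_sliceKernel`). Hence the index of `𝔤₁*` is the minimum of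
the dimension of `sliceKernel g ζ v 0` over `v`, and the index of the dual slice representation at `v`
is the minimum of the dimension of `sliceKernel g ζ v η` over `η`. By Vinberg's inequality
(`lieIndex_le_slice`) good index behaviour only requires an upper bound for the latter.

Let `a`, `b`, `c` be the dimensions of the eigenspaces of `g`, rotated such that `c` is the smallest;
multiplying `g` by a power of `ζ` rotates them and does not change the representation. The index of
`𝔤₁*` is `c`: for a sum of `c` cycles with distinct eigenvalues the powers `v ^ (3 j + 2)`, `j < c`,
are independent and span the kernel (`exists_generic`), and independence is an open condition.

* If `c ≥ 2` and `a, b ≥ 3`, let `v` have a Jordan chain of length `3` with colours `1, 2, 0`, one of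
  length `5` with colours `0, 1, 2, 0, 1`, and otherwise chains of length `1` and cycles. The torus
  part of the stabiliser of `v` acts on a space of elements of `𝔤₂` commuting with `v`, and its weights
  there span so small a space that at least `c + 1` dimensions lie in every slice kernel
  (`exists_large_sliceKernel`).
* If `c ≤ 1`, then `v` is a linear map `A` between two spaces with a functional and a vector attached,
  and a direction `η` with small slice kernel is written down case by case. Its component along `A`
  embeds the kernel of `A` into a complement of its image (`hasGoodSlice`).
* If two of the dimensions are equal to `2` and the third one is at least `2`, the Fitting
  decomposition of `v` separates an invertible part, treated by means of `v³`, and a nilpotent part of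
  smaller dimension, treated by the previous case. There remain nilpotent `v`. In a homogeneous Jordan
  basis let `η` map the last vectors of some chains to multiples of vectors of other chains. The
  slice kernel is then described by equations with at most two terms between the coordinates of `y`
  (`sum_chainCoord_eq`). Up to chains of length `1` and colour `2` there are finitely many
  configurations of chains, and for each of them `linkTable` contains an `η` for which two coordinates
  determine all others (`isGood_of_mem_linkTable`).
-/

open Polynomial Module

/-! ### The index of a dual module and of its slices -/

section PolynomialCurves

variable {F W : Type*} [Field F] [AddCommGroup W] [Module F W]

/-- A map `F → W` is a polynomial curve if all its coordinates are polynomial functions. -/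
def IsPolyCurve (f : F → W) : Prop :=
  ∀ φ : Dual F W, ∃ P : F[X], ∀ t, φ (f t) = P.eval t

theorem isPolyCurve_const (w : W) : IsPolyCurve (fun _ : F => w) :=
  fun φ => ⟨C (φ w), fun t => by simp⟩

theorem IsPolyCurve.add {f h : F → W} (hf : IsPolyCurve f) (hh : IsPolyCurve h) :
    IsPolyCurve (fun t => f t + h t) := by
  intro φ
  obtain ⟨P, hP⟩ := hf φ
  obtain ⟨Q, hQ⟩ := hh φ
  exact ⟨P + Q, fun t => by simp [hP, hQ]⟩

theorem IsPolyCurve.smul {f : F → W} (hf : IsPolyCurve f) :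
    IsPolyCurve (fun t => t • f t) := by
  intro φ
  obtain ⟨P, hP⟩ := hf φ
  exact ⟨X * P, fun t => by simp [hP]⟩

theorem IsPolyCurve.map {W' : Type*} [AddCommGroup W'] [Module F W'] {f : F → W}
    (hf : IsPolyCurve f) (L : W →ₗ[F] W') : IsPolyCurve (fun t => L (f t)) :=
  fun φ => hf (φ ∘ₗ L)

/-- Linear independence of a family of polynomial curves is a Zariski open condition on the
parameter. -/
theorem finite_setOf_not_linearIndependent {κ : Type*} [Finite κ] {f : κ → F → W}
    (hf : ∀ k, IsPolyCurve (f k)) {t₀ : F} (h₀ : LinearIndependent F fun k => f k t₀) :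
    {t | ¬ LinearIndependent F fun k => f k t}.Finite := by
  classical
  have := Fintype.ofFinite κ
  let L : (κ →₀ F) →ₗ[F] W := Finsupp.linearCombination F fun k => f k t₀
  obtain ⟨π, hπ⟩ := L.exists_leftInverse_of_injective (LinearMap.ker_eq_bot.2 h₀)
  have hπ' : ∀ k, π (f k t₀) = Finsupp.single k 1 := fun k => by
    have := LinearMap.congr_fun hπ (Finsupp.single k 1)
    simpa [L] using this
  choose P hP using fun (i k : κ) => hf k (Finsupp.lapply i ∘ₗ π)
  have hP' : ∀ i k t, π (f k t) i = (P i k).eval t := fun i k t => hP i k t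
  let M : Matrix κ κ F[X] := Matrix.of P
  have hdet : ∀ t, M.det.eval t = (Matrix.of fun i k => π (f k t) i).det := by
    intro t
    rw [← Polynomial.coe_evalRingHom, RingHom.map_det]
    congr 1
    ext i k
    simp [M, hP']
  have hne : M.det ≠ 0 := by
    intro h
    have h1 := hdet t₀
    have : (Matrix.of fun i k => π (f k t₀) i) = (1 : Matrix κ κ F) := by
      ext i k
      simp [hπ', Matrix.one_apply, Finsupp.single_apply, eq_comm]
    rw [h, this] at h1
    simp at h1
  refine (M.det.roots.toFinset.finite_toSet).subset fun t ht => ?_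
  simp only [Finset.mem_coe, Multiset.mem_toFinset, mem_roots hne, IsRoot.def]
  by_contra hd
  refine ht ?_
  rw [hdet t] at hd
  have hli : LinearIndependent F fun k => (fun i => π (f k t) i) := by
    have := Matrix.linearIndependent_cols_of_det_ne_zero hd
    exact this
  let T : W →ₗ[F] (κ → F) := (Finsupp.lcoeFun (R := F) (M := F) (α := κ)) ∘ₗ π
  exact LinearIndependent.of_comp T hli

end PolynomialCurves

section Index

variable {F 𝔮 V : Type*} [Field F] [LieRing 𝔮] [LieAlgebra F 𝔮]
  [AddCommGroup V] [Module F V] [LieRingModule 𝔮 V] [LieModule F 𝔮 V]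

theorem mem_orbitTangent {v w : V} : w ∈ orbitTangent F 𝔮 v ↔ ∃ x : 𝔮, ⁅x, v⁆ = w := Iff.rfl

theorem orbitTangent_dual_dual (v : V) :
    orbitTangent F 𝔮 (Dual.eval F V v) = (orbitTangent F 𝔮 v).map (Dual.eval F V) := by
  have key : ∀ x : 𝔮, ⁅x, Dual.eval F V v⁆ = Dual.eval F V ⁅x, v⁆ := by
    intro x
    ext φ
    simp
  ext w
  simp only [mem_orbitTangent, Submodule.mem_map]
  constructor
  · rintro ⟨x, rfl⟩
    exact ⟨_, ⟨x, rfl⟩, (key x).symm⟩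
  · rintro ⟨_, ⟨x, rfl⟩, rfl⟩
    exact ⟨x, key x⟩

variable [FiniteDimensional F V]

/-- Functionals on `V*` are evaluations, so the index of `V*` is computed by the orbits in `V`. -/
theorem lieIndex_dual :
    lieIndex F 𝔮 (Dual F V) = finrank F V - ⨆ v : V, finrank F (orbitTangent F 𝔮 v) := by
  unfold lieIndex
  rw [Subspace.dual_finrank_eq]
  congr 1
  rw [← (evalEquiv F V).toEquiv.iSup_comp]
  congr 1
  ext v
  change finrank F (orbitTangent F 𝔮 (Dual.eval F V v)) = _
  rw [orbitTangent_dual_dual]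
  exact ((orbitTangent F 𝔮 v).equivMapOfInjective _ (eval_apply_injective F)).finrank_eq.symm

theorem lieIndex_dual_le_iff {n : ℕ} :
    lieIndex F 𝔮 (Dual F V) ≤ n ↔ ∃ v : V, finrank F V ≤ finrank F (orbitTangent F 𝔮 v) + n := by
  have hbdd : BddAbove (Set.range fun v : V => finrank F (orbitTangent F 𝔮 v)) :=
    ⟨finrank F V, by rintro _ ⟨v, rfl⟩; exact Submodule.finrank_le _⟩
  rw [lieIndex_dual, Nat.sub_le_iff_le_add]
  constructor
  · intro h
    obtain ⟨v, hv⟩ := Nat.sSup_mem (Set.range_nonempty fun v : V =>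
      finrank F (orbitTangent F 𝔮 v)) hbdd
    refine ⟨v, ?_⟩
    change _ = ⨆ v : V, _ at hv
    have hv' : finrank F (orbitTangent F 𝔮 v) = ⨆ v : V, finrank F (orbitTangent F 𝔮 v) := hv
    omega
  · rintro ⟨v, hv⟩
    have := le_ciSup hbdd v
    omega

theorem le_lieIndex_dual_iff {n : ℕ} :
    n ≤ lieIndex F 𝔮 (Dual F V) ↔ ∀ v : V, finrank F (orbitTangent F 𝔮 v) + n ≤ finrank F V := by
  cases n with
  | zero => simp [Submodule.finrank_le]
  | succ n =>
    rw [Nat.succ_le_iff, ← not_le, lieIndex_dual_le_iff]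
    push Not
    exact forall_congr' fun v => by omega

/-- The subspace `𝔮·v + 𝔮_v·η` of `V`, the preimage of the tangent space at `η` to the orbit of
the stabiliser `𝔮_v` in the slice representation `V / 𝔮·v`. -/
def sliceTangent (F 𝔮 : Type*) {V : Type*} [Field F] [LieRing 𝔮] [LieAlgebra F 𝔮]
    [AddCommGroup V] [Module F V] [LieRingModule 𝔮 V] [LieModule F 𝔮 V] (v η : V) :
    Submodule F V :=
  orbitTangent F 𝔮 v ⊔ orbitTangent F (lieStabilizer F 𝔮 v) η

theorem finrank_orbitTangent_slice (v η : V) :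
    finrank F (orbitTangent F (lieStabilizer F 𝔮 v)
        (LieSubmodule.Quotient.mk (N := orbitTangentLie F 𝔮 v) η)) +
      finrank F (orbitTangent F 𝔮 v) = finrank F (sliceTangent F 𝔮 v η) := by
  set W := orbitTangent F 𝔮 v
  set T := orbitTangent F (lieStabilizer F 𝔮 v) η
  have h1 : orbitTangent F (lieStabilizer F 𝔮 v)
        (LieSubmodule.Quotient.mk (N := orbitTangentLie F 𝔮 v) η) = T.map W.mkQ := by
    ext w
    simp only [mem_orbitTangent]
    constructor
    · rintro ⟨x, rfl⟩
      exact ⟨_, ⟨x, rfl⟩, rfl⟩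
    · rintro ⟨_, ⟨x, rfl⟩, rfl⟩
      exact ⟨x, rfl⟩
  have h2 : finrank F (T.map W.mkQ) + finrank F W = finrank F (W ⊔ T : Submodule F V) := by
    have h3 : (W ⊔ T).map W.mkQ = T.map W.mkQ := by simp [Submodule.map_sup]
    have h4 := LinearMap.finrank_range_add_finrank_ker (W.mkQ.domRestrict (W ⊔ T))
    rw [LinearMap.range_domRestrict, h3, LinearMap.ker_domRestrict, Submodule.ker_mkQ] at h4
    rw [← h4]
    congr 1
    exact (Submodule.comapSubtypeEquivOfLe (le_sup_left : W ≤ W ⊔ T)).finrank_eq.symm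
  refine Eq.trans ?_ h2
  congr 1
  exact congrArg (fun S : Submodule F (V ⧸ W) => finrank F S) h1

theorem finrank_quotient_orbitTangentLie (v : V) :
    finrank F (V ⧸ orbitTangentLie F 𝔮 v) + finrank F (orbitTangent F 𝔮 v) = finrank F V :=
  Submodule.finrank_quotient_add_finrank (orbitTangent F 𝔮 v)

theorem lieIndex_slice_le_iff {v : V} {n : ℕ} :
    lieIndex F (lieStabilizer F 𝔮 v) (Dual F (V ⧸ orbitTangentLie F 𝔮 v)) ≤ n ↔
      ∃ η : V, finrank F V ≤ finrank F (sliceTangent F 𝔮 v η) + n := by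
  have : FiniteDimensional F (V ⧸ orbitTangentLie F 𝔮 v) :=
    inferInstanceAs (FiniteDimensional F (V ⧸ orbitTangent F 𝔮 v))
  rw [lieIndex_dual_le_iff, (LieSubmodule.Quotient.surjective_mk' _).exists]
  refine exists_congr fun η => ?_
  have h1 := finrank_orbitTangent_slice (F := F) (𝔮 := 𝔮) v η
  have h2 := finrank_quotient_orbitTangentLie (F := F) (𝔮 := 𝔮) v
  rw [← h1, ← h2, LieSubmodule.Quotient.mk'_apply]
  omega

theorem le_lieIndex_slice_iff {v : V} {n : ℕ} :
    n ≤ lieIndex F (lieStabilizer F 𝔮 v) (Dual F (V ⧸ orbitTangentLie F 𝔮 v)) ↔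
      ∀ η : V, finrank F (sliceTangent F 𝔮 v η) + n ≤ finrank F V := by
  cases n with
  | zero => simp [Submodule.finrank_le]
  | succ n =>
    rw [Nat.succ_le_iff, ← not_le, lieIndex_slice_le_iff]
    push Not
    exact forall_congr' fun v => by omega

/-- The infinitesimal form of Vinberg's inequality: a generic point of the line `v + t η` has an
orbit at least as large as predicted by the slice representation at `v`. -/
theorem exists_finrank_sliceTangent_le [Infinite F] (v η : V) :
    ∃ w : V, finrank F (sliceTangent F 𝔮 v η) ≤ finrank F (orbitTangent F 𝔮 w) := by
  let f : 𝔮 ⊕ lieStabilizer F 𝔮 v → F → V :=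
    Sum.elim (fun x t => ⁅x, v + t • η⁆) (fun z _ => ⁅z, η⁆)
  have hspan : Submodule.span F (Set.range fun i => f i 0) = sliceTangent F 𝔮 v η := by
    apply le_antisymm
    · rw [Submodule.span_le]
      rintro _ ⟨x | z, rfl⟩
      · refine Submodule.mem_sup_left ⟨x, by simp [f]⟩
      · exact Submodule.mem_sup_right ⟨z, rfl⟩
    · refine sup_le ?_ ?_
      · rintro _ ⟨x, rfl⟩
        exact Submodule.subset_span ⟨Sum.inl x, by simp [f]⟩
      · rintro _ ⟨z, rfl⟩
        exact Submodule.subset_span ⟨Sum.inr z, rfl⟩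
  obtain ⟨κ, a, -, hsp, hli⟩ := exists_linearIndependent' F fun i => f i 0
  have hfin : Finite κ := by
    have := hli.finite
    exact this
  have := Fintype.ofFinite κ
  have hpoly : ∀ k, IsPolyCurve (f (a k)) := by
    intro k
    rcases a k with x | z
    · have h1 := ((isPolyCurve_const (F := F) ⁅x, v⁆).add
        (isPolyCurve_const (F := F) ⁅x, η⁆).smul)
      have h2 : f (Sum.inl x) = fun t => ⁅x, v⁆ + t • ⁅x, η⁆ := by
        funext t; simp [f]
      rw [h2]; exact h1
    · exact isPolyCurve_const _
  have hbad := finite_setOf_not_linearIndependent (f := fun k => f (a k)) hpoly hli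
  obtain ⟨t, ht⟩ := (hbad.union (Set.finite_singleton 0)).exists_notMem
  simp only [Set.mem_union, Set.mem_ofPred_eq, Set.mem_singleton_iff, not_or, not_not] at ht
  refine ⟨v + t • η, ?_⟩
  have hcard : finrank F (sliceTangent F 𝔮 v η) = Fintype.card κ := by
    rw [← hspan, ← hsp]
    exact finrank_span_eq_card hli
  rw [hcard, ← finrank_span_eq_card ht.1]
  refine Submodule.finrank_mono (Submodule.span_le.2 ?_)
  rintro _ ⟨k, rfl⟩
  rcases hk : a k with x | z
  · exact ⟨x, by simp [f, hk]⟩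
  · refine ⟨t⁻¹ • (z : 𝔮), ?_⟩
    have hz : ⁅(z : 𝔮), v⁆ = 0 := z.2
    simp only [hk, f, Sum.elim_inr, smul_lie, lie_add, hz, lie_smul, smul_smul,
      smul_zero, zero_add, mul_comm t, inv_mul_cancel₀ ht.2, one_smul]
    rfl

/-- Vinberg's inequality `ind(𝔮, V*) ≤ ind(𝔮_v, (V / 𝔮·v)*)`. -/
theorem lieIndex_le_slice [Infinite F] (v : V) :
    lieIndex F 𝔮 (Dual F V) ≤
      lieIndex F (lieStabilizer F 𝔮 v) (Dual F (V ⧸ orbitTangentLie F 𝔮 v)) := by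
  obtain ⟨η, hη⟩ := lieIndex_slice_le_iff.1 (le_refl
    (lieIndex F (lieStabilizer F 𝔮 v) (Dual F (V ⧸ orbitTangentLie F 𝔮 v))))
  obtain ⟨w, hw⟩ := exists_finrank_sliceTangent_le (F := F) (𝔮 := 𝔮) v η
  exact lieIndex_dual_le_iff.2 ⟨w, by omega⟩

end Index

/-! ### The grading of `End 𝕍` and the trace form -/

section GradedParts

variable {F 𝕍 : Type*} [Field F] [AddCommGroup 𝕍] [Module F 𝕍]

/-- The space `{x | g x g⁻¹ = c x}`, written without the inverse of `g`. -/
def gradedPart (g : End F 𝕍) (c : F) : Submodule F (End F 𝕍) where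
  carrier := {x | g * x = c • (x * g)}
  zero_mem' := by simp
  add_mem' := by
    intro x y hx hy
    simp only [Set.mem_ofPred_eq] at hx hy ⊢
    rw [mul_add, hx, hy, add_mul, smul_add]
  smul_mem' := by
    intro a x hx
    simp only [Set.mem_ofPred_eq] at hx ⊢
    rw [mul_smul_comm, hx, smul_mul_assoc, smul_comm]

theorem mem_gradedPart {g : End F 𝕍} {c : F} {x : End F 𝕍} :
    x ∈ gradedPart g c ↔ g * x = c • (x * g) := Iff.rfl

theorem mul_mem_gradedPart {g : End F 𝕍} {c d : F} {x y : End F 𝕍}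
    (hx : x ∈ gradedPart g c) (hy : y ∈ gradedPart g d) : x * y ∈ gradedPart g (c * d) := by
  rw [mem_gradedPart] at *
  rw [← mul_assoc, hx, smul_mul_assoc, mul_assoc, hy, mul_smul_comm, smul_smul, mul_assoc]

theorem smul_gradedPart (g : End F 𝕍) {a : F} (ha : a ≠ 0) (c : F) :
    gradedPart (a • g) c = gradedPart g c := by
  ext x
  rw [mem_gradedPart, mem_gradedPart, smul_mul_assoc, mul_smul_comm, smul_comm]
  exact (smul_right_injective _ ha).eq_iff

theorem mul_mul_sq_of_mem {g : End F 𝕍} (hg : g ^ 3 = 1) {c : F} {x : End F 𝕍}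
    (hx : x ∈ gradedPart g c) : g * x * g ^ 2 = c • x := by
  rw [hx, smul_mul_assoc, mul_assoc, ← pow_succ', hg, mul_one]

theorem sq_mul_mul_of_mem {g : End F 𝕍} (hg : g ^ 3 = 1) {c : F} {x : End F 𝕍}
    (hx : x ∈ gradedPart g c) : g ^ 2 * x * g = c ^ 2 • x := by
  rw [pow_two, mul_assoc g, hx, mul_smul_comm, ← mul_assoc, hx, smul_mul_assoc, smul_mul_assoc,
    mul_assoc x, ← pow_two, smul_mul_assoc, mul_assoc, ← pow_succ, hg, mul_one, smul_smul,
    ← pow_two]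

/-- The projection of `End 𝕍` onto `gradedPart g c`, for `g³ = 1` and `c³ = 1`. -/
def gradedProj (g : End F 𝕍) (c : F) (x : End F 𝕍) : End F 𝕍 :=
  (3 : F)⁻¹ • (x + c ^ 2 • (g * x * g ^ 2) + c • (g ^ 2 * x * g))

theorem gradedProj_mem {g : End F 𝕍} (hg : g ^ 3 = 1) {c : F} (hc : c ^ 3 = 1) (x : End F 𝕍) :
    gradedProj g c x ∈ gradedPart g c := by
  refine Submodule.smul_mem _ _ ?_
  rw [mem_gradedPart]
  have h1 : g * (g ^ 2 * x * g) = x * g := by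
    rw [← mul_assoc, ← mul_assoc, ← pow_succ', hg, one_mul]
  have h2 : g * x * g ^ 2 * g = g * x := by
    rw [mul_assoc, ← pow_succ, hg, mul_one]
  have h3 : g * (g * x * g ^ 2) = g ^ 2 * x * g * g := by
    simp only [pow_two, mul_assoc]
  simp only [mul_add, add_mul, mul_smul_comm, smul_mul_assoc, h1, h2, h3, smul_add, smul_smul]
  rw [← pow_succ', hc, one_smul, ← pow_two]
  abel

theorem gradedProj_of_mem (h3 : (3 : F) ≠ 0) {g : End F 𝕍} (hg : g ^ 3 = 1) {c : F}
    (hc : c ^ 3 = 1) {x : End F 𝕍} (hx : x ∈ gradedPart g c) : gradedProj g c x = x := by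
  rw [gradedProj, mul_mul_sq_of_mem hg hx, sq_mul_mul_of_mem hg hx, smul_smul, smul_smul,
    ← pow_succ, ← pow_succ', hc, one_smul, show x + x + x = (3 : F) • x by module, smul_smul,
    inv_mul_cancel₀ h3, one_smul]

theorem gradedProj_sub_lie {g v x : End F 𝕍} (hg : g ^ 3 = 1) {c d : F} (hd : d ^ 3 = 1)
    (hv : v ∈ gradedPart g d) :
    v * gradedProj g c x - gradedProj g c x * v = gradedProj g (d * c) (v * x - x * v) := by
  have h1 : g * (v * x) * g ^ 2 = d • (v * (g * x * g ^ 2)) := by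
    rw [← mul_assoc, ← mul_assoc, hv, smul_mul_assoc, smul_mul_assoc]; simp only [mul_assoc]
  have h2 : g ^ 2 * (v * x) * g = d ^ 2 • (v * (g ^ 2 * x * g)) := by
    have : g ^ 2 * v = d ^ 2 • (v * g ^ 2) := by
      rw [pow_two g, mul_assoc, hv, mul_smul_comm, ← mul_assoc, hv, smul_mul_assoc, smul_smul,
        mul_assoc, ← pow_two]
    rw [← mul_assoc, this, smul_mul_assoc, smul_mul_assoc]; simp only [mul_assoc]
  have h3 : g * (x * v) * g ^ 2 = d • (g * x * g ^ 2 * v) := by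
    have : v * g ^ 2 = d • (g ^ 2 * v) := by
      have h := mul_mul_sq_of_mem hg hv
      have h' := congrArg (fun z => g ^ 2 * z) h
      simp only [← mul_assoc, ← pow_succ, hg, one_mul] at h'
      rw [h', mul_smul_comm]
    rw [mul_assoc, mul_assoc x, this]; simp only [mul_smul_comm, mul_assoc]
  have h4 : g ^ 2 * (x * v) * g = d ^ 2 • (g ^ 2 * x * g * v) := by
    have : v * g = d ^ 2 • (g * v) := by
      rw [hv, smul_smul, ← pow_succ, hd, one_smul]
    rw [mul_assoc, mul_assoc x, this]; simp only [mul_smul_comm, mul_assoc]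
  simp only [gradedProj, mul_sub, sub_mul, h1, h2, h3, h4, mul_smul_comm, smul_mul_assoc, mul_add,
    add_mul, smul_sub, smul_add, smul_smul, mul_pow]
  have e1 : d ^ 2 * c ^ 2 * d = c ^ 2 := by
    rw [mul_right_comm, ← pow_succ, hd, one_mul]
  have e2 : d * c * d ^ 2 = c := by
    rw [mul_right_comm, ← pow_succ', hd, one_mul]
  simp only [mul_assoc] at e1 e2 ⊢
  simp only [e1, e2]
  module

section Trace

theorem trace_mul_gradedProj {g : End F 𝕍} (hg : g ^ 3 = 1) (h3 : (3 : F) ≠ 0) {c : F}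
    (hc : c ^ 3 = 1) {y : End F 𝕍} (hy : y ∈ gradedPart g (c ^ 2)) (x : End F 𝕍) :
    LinearMap.trace F 𝕍 (y * gradedProj g c x) = LinearMap.trace F 𝕍 (y * x) := by
  have h1 : LinearMap.trace F 𝕍 (y * (g * x * g ^ 2)) = c * LinearMap.trace F 𝕍 (y * x) := by
    rw [← mul_assoc, LinearMap.trace_mul_comm, ← mul_assoc, ← mul_assoc,
      sq_mul_mul_of_mem hg hy, smul_mul_assoc, map_smul, smul_eq_mul]
    congr 1
    linear_combination c * hc
  have h2 : LinearMap.trace F 𝕍 (y * (g ^ 2 * x * g)) = c ^ 2 * LinearMap.trace F 𝕍 (y * x) := by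
    rw [← mul_assoc, LinearMap.trace_mul_comm, ← mul_assoc, ← mul_assoc,
      mul_mul_sq_of_mem hg hy, smul_mul_assoc, map_smul, smul_eq_mul]
  simp only [gradedProj, mul_smul_comm, mul_add, map_smul, map_add, h1, h2, smul_eq_mul]
  field_simp
  linear_combination 2 * LinearMap.trace F 𝕍 (y * x) * hc

/-- The trace pairing between `gradedPart g (c ^ 2)` and `gradedPart g c`. -/
noncomputable def tracePairing (g : End F 𝕍) (c : F) :
    gradedPart g (c ^ 2) →ₗ[F] Dual F (gradedPart g c) :=
  ((LinearMap.mul F (End F 𝕍)).compr₂ (LinearMap.trace F 𝕍)).domRestrict₁₂ _ _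

@[simp] theorem tracePairing_apply (g : End F 𝕍) (c : F) (y : gradedPart g (c ^ 2))
    (x : gradedPart g c) :
    tracePairing g c y x = LinearMap.trace F 𝕍 ((y : End F 𝕍) * (x : End F 𝕍)) := rfl

variable [FiniteDimensional F 𝕍]

theorem eq_zero_of_trace_mul_eq_zero {y : End F 𝕍}
    (h : ∀ x, LinearMap.trace F 𝕍 (y * x) = 0) : y = 0 := by
  ext u
  rw [LinearMap.zero_apply, ← Module.forall_dual_apply_eq_zero_iff F]
  intro φ
  have h1 := h (dualTensorHom F 𝕍 𝕍 (φ ⊗ₜ u))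
  have h2 : y * dualTensorHom F 𝕍 𝕍 (φ ⊗ₜ u) = dualTensorHom F 𝕍 𝕍 (φ ⊗ₜ y u) := by
    ext w; simp
  rw [h2, LinearMap.trace_eq_contract_apply, contractLeft_apply] at h1
  exact h1

theorem eq_zero_of_trace_mul_gradedPart {g : End F 𝕍} (hg : g ^ 3 = 1) (h3 : (3 : F) ≠ 0) {c : F}
    (hc : c ^ 3 = 1) {y : End F 𝕍} (hy : y ∈ gradedPart g (c ^ 2))
    (h : ∀ x ∈ gradedPart g c, LinearMap.trace F 𝕍 (y * x) = 0) : y = 0 :=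
  eq_zero_of_trace_mul_eq_zero fun x => by
    rw [← trace_mul_gradedProj hg h3 hc hy]; exact h _ (gradedProj_mem hg hc x)

theorem tracePairing_injective {g : End F 𝕍} (hg : g ^ 3 = 1) (h3 : (3 : F) ≠ 0) {c : F}
    (hc : c ^ 3 = 1) : Function.Injective (tracePairing g c) := by
  rw [← LinearMap.ker_eq_bot, LinearMap.ker_eq_bot']
  intro y hy
  refine Subtype.ext (eq_zero_of_trace_mul_gradedPart hg h3 hc y.2 fun x hx => ?_)
  exact LinearMap.congr_fun hy ⟨x, hx⟩

theorem finrank_gradedPart_sq {g : End F 𝕍} (hg : g ^ 3 = 1) (h3 : (3 : F) ≠ 0) {c : F}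
    (hc : c ^ 3 = 1) : finrank F (gradedPart g (c ^ 2)) = finrank F (gradedPart g c) := by
  have key : ∀ {d : F}, d ^ 3 = 1 →
      finrank F (gradedPart g (d ^ 2)) ≤ finrank F (gradedPart g d) := by
    intro d hd
    rw [← Subspace.dual_finrank_eq (V := gradedPart g d)]
    exact LinearMap.finrank_le_finrank_of_injective (tracePairing_injective hg h3 hd)
  refine le_antisymm (key hc) ?_
  have h := key (d := c ^ 2) (by rw [← pow_mul, mul_comm, pow_mul, hc, one_pow])
  rwa [← pow_mul, show 2 * 2 = 3 + 1 from rfl, pow_succ, hc, one_mul] at h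

theorem finrank_annihilator_add {g : End F 𝕍} (hg : g ^ 3 = 1) (h3 : (3 : F) ≠ 0) {c : F}
    (hc : c ^ 3 = 1) (W : Submodule F (gradedPart g c)) :
    finrank F (W.dualAnnihilator.comap (tracePairing g c)) + finrank F W =
      finrank F (gradedPart g c) := by
  have hdim : finrank F (gradedPart g (c ^ 2)) = finrank F (Dual F (gradedPart g c)) := by
    rw [Subspace.dual_finrank_eq]; exact finrank_gradedPart_sq hg h3 hc
  let e := LinearEquiv.ofInjectiveOfFinrankEq (tracePairing g c)
    (tracePairing_injective hg h3 hc) hdim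
  have h1 := Subspace.finrank_add_finrank_dualAnnihilator_eq W
  have h2 : finrank F (W.dualAnnihilator.comap (tracePairing g c)) =
      finrank F W.dualAnnihilator := by
    have h4 : W.dualAnnihilator.comap (tracePairing g c) =
        W.dualAnnihilator.map (e.symm : _ →ₗ[F] _) :=
      (Submodule.map_equiv_eq_comap_symm e.symm W.dualAnnihilator).symm ▸ rfl
    rw [h4]
    exact LinearEquiv.finrank_map_eq e.symm W.dualAnnihilator
  omega

/-- An element `h` of degree `0` orthogonal to the centraliser of `v` in degree `0` has the form
`[v, y]`: the operator `ad v` is skew-symmetric for the trace form. -/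
theorem exists_lie_eq_of_trace_centralizer {g v h : End F 𝕍} (hg : g ^ 3 = 1) (h3 : (3 : F) ≠ 0)
    {c : F} (hc : c ^ 3 = 1) (hv : v ∈ gradedPart g c) (hh : h ∈ gradedPart g 1)
    (H : ∀ x ∈ gradedPart g 1, x * v = v * x → LinearMap.trace F 𝕍 (x * h) = 0) :
    ∃ y ∈ gradedPart g (c ^ 2), v * y - y * v = h := by
  let ad : End F 𝕍 →ₗ[F] End F 𝕍 := LinearMap.mulLeft F v - LinearMap.mulRight F v
  have had : ∀ x, ad x = v * x - x * v := fun x => rfl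
  have hmem : h ∈ LinearMap.range ad := by
    rw [← Subspace.dualAnnihilator_dualCoannihilator_eq (W := LinearMap.range ad),
      Submodule.mem_dualCoannihilator]
    intro φ hφ
    -- every functional on `End 𝕍` is of the form `tr (x ·)`
    let B : End F 𝕍 →ₗ[F] Dual F (End F 𝕍) :=
      (LinearMap.mul F (End F 𝕍)).compr₂ (LinearMap.trace F 𝕍)
    have hB : ∀ x z, B x z = LinearMap.trace F 𝕍 (x * z) := fun x z => rfl
    have hBinj : Function.Injective B := by
      rw [← LinearMap.ker_eq_bot, LinearMap.ker_eq_bot']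
      exact fun x hx => eq_zero_of_trace_mul_eq_zero fun z => LinearMap.congr_fun hx z
    obtain ⟨x, rfl⟩ := (LinearMap.injective_iff_surjective_of_finrank_eq_finrank
      (Subspace.dual_finrank_eq (V := End F 𝕍)).symm).1 hBinj φ
    have hxv : x * v = v * x := by
      rw [← sub_eq_zero]
      refine eq_zero_of_trace_mul_eq_zero fun z => ?_
      have h1 := (Submodule.mem_dualAnnihilator _).1 hφ (ad z) ⟨z, rfl⟩
      rw [hB, had, mul_sub, map_sub, ← mul_assoc, ← mul_assoc,
        LinearMap.trace_mul_comm F (x * z), ← mul_assoc, ← map_sub, ← sub_mul] at h1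
      exact h1
    have h1 := H (gradedProj g 1 x) (gradedProj_mem hg (one_pow 3) x) (by
      have := gradedProj_sub_lie (c := 1) (x := x) hg hc hv
      rw [hxv, sub_self] at this
      simp only [gradedProj, mul_zero, zero_mul, smul_zero, add_zero] at this
      exact (sub_eq_zero.1 this).symm)
    rw [hB, LinearMap.trace_mul_comm]
    rw [LinearMap.trace_mul_comm, trace_mul_gradedProj hg h3 (one_pow 3) (by simpa using hh)] at h1
    exact h1
  obtain ⟨y, hy⟩ := hmem
  refine ⟨gradedProj g (c ^ 2) y, gradedProj_mem hg ?_ y, ?_⟩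
  · rw [← pow_mul, mul_comm, pow_mul, hc, one_pow]
  · rw [gradedProj_sub_lie hg hc hv, ← had, hy, ← pow_succ', hc]
    exact gradedProj_of_mem h3 hg (one_pow 3) hh

end Trace

end GradedParts

/-! ### Slice kernels -/

section SliceKernel

variable {F 𝕍 : Type*} [Field F] [AddCommGroup 𝕍] [Module F 𝕍]

/-- For `v, η` in `𝔤₁ = gradedPart g ζ`, the annihilator of `𝔤₀·v + (𝔤₀)_v·η` in
`𝔤₂ = gradedPart g (ζ ^ 2)` under the trace form. Its dimension is the codimension of the orbit of
`η` in the slice representation at `v`. -/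
noncomputable def sliceKernel (g : End F 𝕍) (ζ : F) (v η : End F 𝕍) :
    Submodule F (End F 𝕍) where
  carrier := {y | y ∈ gradedPart g (ζ ^ 2) ∧ v * y = y * v ∧
    ∀ x ∈ gradedPart g 1, x * v = v * x → LinearMap.trace F 𝕍 (y * (x * η - η * x)) = 0}
  zero_mem' := ⟨zero_mem _, by simp, by simp⟩
  add_mem' := by
    rintro y z ⟨h1, h2, h3⟩ ⟨k1, k2, k3⟩
    refine ⟨add_mem h1 k1, by rw [mul_add, add_mul, h2, k2], fun x hx hxv => ?_⟩
    rw [add_mul, map_add, h3 x hx hxv, k3 x hx hxv, add_zero]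
  smul_mem' := by
    rintro c y ⟨h1, h2, h3⟩
    refine ⟨Submodule.smul_mem _ _ h1, by rw [mul_smul_comm, smul_mul_assoc, h2],
      fun x hx hxv => ?_⟩
    rw [smul_mul_assoc, map_smul, h3 x hx hxv, smul_zero]

theorem mem_sliceKernel {g : End F 𝕍} {ζ : F} {v η y : End F 𝕍} :
    y ∈ sliceKernel g ζ v η ↔ y ∈ gradedPart g (ζ ^ 2) ∧ v * y = y * v ∧
      ∀ x ∈ gradedPart g 1, x * v = v * x →
        LinearMap.trace F 𝕍 (y * (x * η - η * x)) = 0 := Iff.rfl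

theorem mem_sliceKernel_zero {g : End F 𝕍} {ζ : F} {v y : End F 𝕍} :
    y ∈ sliceKernel g ζ v 0 ↔ y ∈ gradedPart g (ζ ^ 2) ∧ v * y = y * v := by
  simp [mem_sliceKernel]

variable [FiniteDimensional F 𝕍]

/-- Elements of the slice kernel are those elements of the centraliser of `v` in degree `2` which
deform to first order along `v + ε η`. -/
theorem exists_deformation_of_mem_sliceKernel {g : End F 𝕍} (hg : g ^ 3 = 1) (h3 : (3 : F) ≠ 0)
    {ζ : F} (hζ : ζ ^ 3 = 1) {v η y : End F 𝕍} (hv : v ∈ gradedPart g ζ)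
    (hη : η ∈ gradedPart g ζ) (hy : y ∈ sliceKernel g ζ v η) :
    ∃ y' ∈ gradedPart g (ζ ^ 2), y * η + y' * v = η * y + v * y' := by
  obtain ⟨h1, -, h4⟩ := hy
  have h5 : y * η - η * y ∈ gradedPart g 1 := by
    rw [← hζ]
    exact sub_mem (by simpa [← pow_succ] using mul_mem_gradedPart h1 hη)
      (by simpa [← pow_succ'] using mul_mem_gradedPart hη h1)
  obtain ⟨y', h6, h7⟩ := exists_lie_eq_of_trace_centralizer hg h3 hζ hv h5 (fun x hx hxv => by
    have := h4 x hx hxv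
    have e1 : LinearMap.trace F 𝕍 (x * (y * η)) = LinearMap.trace F 𝕍 (y * (η * x)) := by
      rw [LinearMap.trace_mul_comm, mul_assoc]
    have e2 : LinearMap.trace F 𝕍 (x * (η * y)) = LinearMap.trace F 𝕍 (y * (x * η)) := by
      rw [← mul_assoc, LinearMap.trace_mul_comm]
    rw [mul_sub, map_sub] at this
    rw [mul_sub, map_sub, e1, e2, ← neg_eq_zero, neg_sub, this])
  refine ⟨y', h6, ?_⟩
  rw [eq_comm, ← sub_eq_zero]
  rw [← sub_eq_zero] at h7
  rw [← h7]; abel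

end SliceKernel

section Criterion

variable {F 𝕍 : Type*} [Field F] [AddCommGroup 𝕍] [Module F 𝕍]
  {θ : End F 𝕍 ≃ₗ⁅F⁆ End F 𝕍} {g : (End F 𝕍)ˣ}

theorem isConjBy_apply_eq_iff (hθ : IsConjBy θ g) (c : F) (x : End F 𝕍) :
    θ x = c • x ↔ x ∈ gradedPart (g : End F 𝕍) c := by
  rw [hθ, mem_gradedPart, ← smul_mul_assoc]
  exact Units.mul_inv_eq_iff_eq_mul g

theorem mem_gradedPiece_iff (hθ : IsConjBy θ g) {c : F} {x : End F 𝕍} :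
    x ∈ gradedPiece θ c ↔ x ∈ gradedPart (g : End F 𝕍) c :=
  isConjBy_apply_eq_iff hθ c x

theorem mem_fixedSubalgebra_iff (hθ : IsConjBy θ g) {x : End F 𝕍} :
    x ∈ fixedSubalgebra θ ↔ x ∈ gradedPart (g : End F 𝕍) 1 := by
  rw [← isConjBy_apply_eq_iff hθ, one_smul]
  exact Iff.rfl

/-- The trace form turns orbit codimensions in slice representations into dimensions of slice
kernels. -/
theorem finrank_sliceKernel_add [FiniteDimensional F 𝕍] (hθ : IsConjBy θ g)
    (hg : (g : End F 𝕍) ^ 3 = 1) (h3 : (3 : F) ≠ 0) {ζ : F} (hζ : ζ ^ 3 = 1)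
    (v η : gradedPiece θ ζ) :
    finrank F (sliceKernel (g : End F 𝕍) ζ v η) +
      finrank F (sliceTangent F (fixedSubalgebra θ) v η) = finrank F (gradedPiece θ ζ) := by
  have hsub : (gradedPiece θ ζ).toSubmodule = gradedPart (g : End F 𝕍) ζ := by
    ext x; exact mem_gradedPiece_iff hθ
  let e : gradedPiece θ ζ ≃ₗ[F] gradedPart (g : End F 𝕍) ζ := LinearEquiv.ofEq _ _ hsub
  have he : ∀ x : gradedPiece θ ζ, ((e x : gradedPart (g : End F 𝕍) ζ) : End F 𝕍) = x :=
    fun x => rfl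
  set S := sliceTangent F (fixedSubalgebra θ) v η with hS
  have h1 := finrank_annihilator_add hg h3 hζ (S.map (e : _ →ₗ[F] _))
  rw [LinearEquiv.finrank_map_eq e S, ← e.finrank_eq] at h1
  rw [← h1, ← Submodule.finrank_map_subtype_eq]
  have hvm : (v : End F 𝕍) ∈ gradedPart (g : End F 𝕍) ζ := (mem_gradedPiece_iff hθ).1 v.2
  suffices h : sliceKernel (g : End F 𝕍) ζ v η =
      ((S.map (e : _ →ₗ[F] _)).dualAnnihilator.comap (tracePairing (g : End F 𝕍) ζ)).map
        (gradedPart (g : End F 𝕍) (ζ ^ 2)).subtype by rw [h]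
  ext y
  rw [mem_sliceKernel, Submodule.mem_map]
  constructor
  · rintro ⟨hy, hyv, hyη⟩
    refine ⟨⟨y, hy⟩, ?_, rfl⟩
    rw [Submodule.mem_comap, Submodule.mem_dualAnnihilator]
    rintro _ ⟨w, hw, rfl⟩
    have hw : w ∈ S := hw
    rw [tracePairing_apply]
    change LinearMap.trace F 𝕍 (y * (w : End F 𝕍)) = 0
    have hle : S ≤ LinearMap.ker ((LinearMap.trace F 𝕍 ∘ₗ LinearMap.mulLeft F y) ∘ₗ
        (gradedPiece θ ζ).toSubmodule.subtype) := by
      refine sup_le ?_ ?_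
      · rintro _ ⟨x, rfl⟩
        rw [LinearMap.mem_ker]
        change LinearMap.trace F 𝕍 (y * ((x : End F 𝕍) * v - v * x)) = 0
        rw [mul_sub, map_sub, ← mul_assoc, ← mul_assoc, ← hyv, LinearMap.trace_mul_comm,
          ← mul_assoc, sub_self]
      · rintro _ ⟨x, rfl⟩
        rw [LinearMap.mem_ker]
        change LinearMap.trace F 𝕍 (y * (((x : fixedSubalgebra θ) : End F 𝕍) * η - η * _)) = 0
        refine hyη _ ((mem_fixedSubalgebra_iff hθ).1 (x : fixedSubalgebra θ).2) ?_
        have hx : ⁅(x : fixedSubalgebra θ), v⁆ = 0 := x.2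
        have := congrArg (fun z : gradedPiece θ ζ => (z : End F 𝕍)) hx
        exact sub_eq_zero.1 this
    exact hle hw
  · rintro ⟨⟨y, hy⟩, hy', rfl⟩
    rw [Submodule.mem_comap, Submodule.mem_dualAnnihilator] at hy'
    have hperp : ∀ w ∈ S, LinearMap.trace F 𝕍 (y * (w : End F 𝕍)) = 0 := fun w hw =>
      hy' (e w) ⟨w, hw, rfl⟩
    refine ⟨hy, ?_, ?_⟩
    · change (v : End F 𝕍) * y = y * v
      have hmem : (v : End F 𝕍) * y - y * v ∈ gradedPart (g : End F 𝕍) (1 ^ 2) := by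
        rw [one_pow, ← hζ]
        exact sub_mem (by simpa [← pow_succ'] using mul_mem_gradedPart hvm hy)
          (by simpa [← pow_succ] using mul_mem_gradedPart hy hvm)
      refine sub_eq_zero.1 (eq_zero_of_trace_mul_gradedPart hg h3 (one_pow 3) hmem fun x hx => ?_)
      have := hperp ⁅(⟨x, (mem_fixedSubalgebra_iff hθ).2 hx⟩ : fixedSubalgebra θ), v⁆
        (Submodule.mem_sup_left ⟨_, rfl⟩)
      change LinearMap.trace F 𝕍 (y * (x * (v : End F 𝕍) - v * x)) = 0 at this
      rw [← this, sub_mul, mul_sub, map_sub, map_sub, LinearMap.trace_mul_comm F y,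
        mul_assoc x, LinearMap.trace_mul_comm F x, mul_assoc y]
    · intro x hx hxv
      refine hperp ⁅(⟨x, (mem_fixedSubalgebra_iff hθ).2 hx⟩ : fixedSubalgebra θ), η⁆
        (Submodule.mem_sup_right ⟨⟨⟨x, (mem_fixedSubalgebra_iff hθ).2 hx⟩, ?_⟩, rfl⟩)
      change ⁅_, v⁆ = 0
      apply Subtype.ext
      exact sub_eq_zero.2 hxv

theorem sliceTangent_zero_right {𝔮 V : Type*} [LieRing 𝔮] [LieAlgebra F 𝔮]
    [AddCommGroup V] [Module F V] [LieRingModule 𝔮 V] [LieModule F 𝔮 V] (v : V) :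
    sliceTangent F 𝔮 v 0 = orbitTangent F 𝔮 v := by
  refine le_antisymm (sup_le le_rfl ?_) le_sup_left
  rintro _ ⟨x, rfl⟩
  rw [lie_zero]
  exact zero_mem _

variable [FiniteDimensional F 𝕍] [CharZero F]

/-- If every slice representation has an orbit of codimension at most `m`, while no orbit in `𝔤₁`
has codimension less than `m`, then Vinberg's inequality is an equality at every point. -/
theorem thetaRepHasGIB_of_sliceKernel (hθ : IsConjBy θ g) (hg : (g : End F 𝕍) ^ 3 = 1) {ζ : F}
    (hζ : ζ ^ 3 = 1) {m : ℕ}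
    (hlow : ∀ v ∈ gradedPart (g : End F 𝕍) ζ, m ≤ finrank F (sliceKernel (g : End F 𝕍) ζ v 0))
    (hup : ∀ v ∈ gradedPart (g : End F 𝕍) ζ, ∃ η ∈ gradedPart (g : End F 𝕍) ζ,
      finrank F (sliceKernel (g : End F 𝕍) ζ v η) ≤ m) : ThetaRepHasGIB θ ζ := by
  have h3 : (3 : F) ≠ 0 := by norm_num
  intro v
  have h1 : m ≤ lieIndex F (fixedSubalgebra θ) (Dual F (gradedPiece θ ζ)) := by
    rw [le_lieIndex_dual_iff]
    intro w
    have h4 := finrank_sliceKernel_add hθ hg h3 hζ w 0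
    have h5 := hlow w ((mem_gradedPiece_iff hθ).1 w.2)
    rw [sliceTangent_zero_right] at h4
    rw [← h4]
    change _ ≤ finrank F (sliceKernel (g : End F 𝕍) ζ w 0) + _
    omega
  have h2 : lieIndex F (lieStabilizer F (fixedSubalgebra θ) v)
      (Dual F (gradedPiece θ ζ ⧸ orbitTangentLie F (fixedSubalgebra θ) v)) ≤ m := by
    rw [lieIndex_slice_le_iff]
    obtain ⟨η, hη, h⟩ := hup v ((mem_gradedPiece_iff hθ).1 v.2)
    refine ⟨⟨η, (mem_gradedPiece_iff hθ).2 hη⟩, ?_⟩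
    rw [← finrank_sliceKernel_add hθ hg h3 hζ v ⟨η, (mem_gradedPiece_iff hθ).2 hη⟩]
    change finrank F (sliceKernel (g : End F 𝕍) ζ v η) + _ ≤ _
    omega
  exact le_antisymm (lieIndex_le_slice v) (h2.trans h1)

/-- If some orbit in `𝔤₁` has codimension at most `m`, while all orbits of the slice representation
at some `v` have codimension greater than `m`, then good index behaviour fails at `v`. -/
theorem not_thetaRepHasGIB_of_sliceKernel (hθ : IsConjBy θ g) (hg : (g : End F 𝕍) ^ 3 = 1) {ζ : F}
    (hζ : ζ ^ 3 = 1) {m : ℕ} {v₀ v : End F 𝕍} (hv₀ : v₀ ∈ gradedPart (g : End F 𝕍) ζ)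
    (hup : finrank F (sliceKernel (g : End F 𝕍) ζ v₀ 0) ≤ m)
    (hv : v ∈ gradedPart (g : End F 𝕍) ζ)
    (hlow : ∀ η ∈ gradedPart (g : End F 𝕍) ζ,
      m + 1 ≤ finrank F (sliceKernel (g : End F 𝕍) ζ v η)) : ¬ ThetaRepHasGIB θ ζ := by
  have h3 : (3 : F) ≠ 0 := by norm_num
  intro hgib
  have hgib := hgib ⟨v, (mem_gradedPiece_iff hθ).2 hv⟩
  have h1 : lieIndex F (fixedSubalgebra θ) (Dual F (gradedPiece θ ζ)) ≤ m := by
    rw [lieIndex_dual_le_iff]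
    refine ⟨⟨v₀, (mem_gradedPiece_iff hθ).2 hv₀⟩, ?_⟩
    rw [← finrank_sliceKernel_add hθ hg h3 hζ ⟨v₀, (mem_gradedPiece_iff hθ).2 hv₀⟩ 0,
      sliceTangent_zero_right]
    change finrank F (sliceKernel (g : End F 𝕍) ζ v₀ 0) + _ ≤ _
    omega
  rw [hgib] at h1
  have h2 : m + 1 ≤ m := by
    refine le_trans ?_ h1
    rw [le_lieIndex_slice_iff]
    intro η
    rw [← finrank_sliceKernel_add hθ hg h3 hζ ⟨v, (mem_gradedPiece_iff hθ).2 hv⟩ η]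
    have := hlow η ((mem_gradedPiece_iff hθ).1 η.2)
    change _ ≤ finrank F (sliceKernel (g : End F 𝕍) ζ v η) + _
    omega
  omega

end Criterion

/-! ### Homogeneous bases and semicontinuity -/

section GradedBasis

variable {F 𝕍 : Type*} [Field F] [AddCommGroup 𝕍] [Module F 𝕍]

theorem apply_eigenvector_of_mem_gradedPart {g x : End F 𝕍} {c d : F} (hx : x ∈ gradedPart g c)
    {w : 𝕍} (hw : g w = d • w) : g (x w) = (d * c) • x w := by
  have := LinearMap.congr_fun hx w
  simp only [Module.End.mul_apply, LinearMap.smul_apply, hw, map_smul, smul_smul] at this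
  rw [this, mul_comm]

theorem mem_gradedPart_of_basis {I : Type*} {g x : End F 𝕍} {c : F} (b : Basis I F 𝕍) {d : I → F}
    (hb : ∀ i, g (b i) = d i • b i) (hx : ∀ i, g (x (b i)) = (d i * c) • x (b i)) :
    x ∈ gradedPart g c := by
  rw [mem_gradedPart]
  refine b.ext fun i => ?_
  simp only [Module.End.mul_apply, LinearMap.smul_apply, hb, map_smul, smul_smul, hx, mul_comm c]

theorem repr_eq_zero_of_eigenvector {I : Type*} {g : End F 𝕍} (b : Basis I F 𝕍) {d : I → F}
    (hb : ∀ i, g (b i) = d i • b i) {w : 𝕍} {a : F} (hw : g w = a • w) {j : I} (hj : d j ≠ a) :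
    b.repr w j = 0 := by
  have h1 : ∀ u, b.repr (g u) j = d j * b.repr u j := by
    intro u
    have : (b.coord j) ∘ₗ g = d j • b.coord j := by
      refine b.ext fun i => ?_
      rcases eq_or_ne i j with rfl | hij
      · simp [hb]
      · simp [hb, Finsupp.single_eq_of_ne' hij]
    exact LinearMap.congr_fun this u
  have h2 := h1 w
  rw [hw, map_smul, Finsupp.smul_apply, smul_eq_mul] at h2
  have h3 : (d j - a) * b.repr w j = 0 := by linear_combination -h2
  exact (mul_eq_zero.1 h3).resolve_left (sub_ne_zero.2 hj)

theorem isInternal_eigenspaces {g : End F 𝕍} (hg : g ^ 3 = 1) (h3 : (3 : F) ≠ 0) {ζ : F}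
    (hζ : IsPrimitiveRoot ζ 3) :
    DirectSum.IsInternal fun c : Fin 3 => End.eigenspace g (ζ ^ (c : ℕ)) := by
  rw [DirectSum.isInternal_submodule_iff_iSupIndep_and_iSup_eq_top]
  have hinj : Function.Injective fun c : Fin 3 => ζ ^ (c : ℕ) := fun c d h =>
    Fin.ext (hζ.pow_inj c.2 d.2 h)
  refine ⟨(End.eigenspaces_iSupIndep g).comp hinj, ?_⟩
  rw [eq_top_iff]
  intro x _
  have hζ0 : 1 + ζ + ζ ^ 2 = 0 := by
    have := hζ.geom_sum_eq_zero (by norm_num)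
    simpa [Finset.sum_range_succ] using this
  have hg3 : g (g (g x)) = x := LinearMap.congr_fun (show g * (g * g) = 1 by
    rw [← pow_two, ← pow_succ', hg]) x
  have hmem : ∀ c : Fin 3, (x + ζ ^ (2 * (c : ℕ)) • g x + ζ ^ (c : ℕ) • g (g x)) ∈
      ⨆ c : Fin 3, End.eigenspace g (ζ ^ (c : ℕ)) := by
    intro c
    refine Submodule.mem_iSup_of_mem c ?_
    rw [End.mem_eigenspace_iff]
    have h1 : ζ ^ (c : ℕ) * ζ ^ (2 * (c : ℕ)) = 1 := by
      rw [← pow_add, show (c : ℕ) + 2 * c = 3 * c by ring, pow_mul, hζ.pow_eq_one, one_pow]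
    simp only [map_add, map_smul, hg3, smul_add, smul_smul, h1, one_smul, ← pow_add,
      ← two_mul]
    abel
  have hsum : x = (3 : F)⁻¹ • ∑ c : Fin 3,
      (x + ζ ^ (2 * (c : ℕ)) • g x + ζ ^ (c : ℕ) • g (g x)) := by
    have h4 : ζ ^ 4 = ζ := by rw [pow_succ, hζ.pow_eq_one, one_mul]
    have h5 : ∑ c : Fin 3, (x + ζ ^ (2 * (c : ℕ)) • g x + ζ ^ (c : ℕ) • g (g x)) =
        (3 : F) • x + (1 + ζ + ζ ^ 2) • g x + (1 + ζ + ζ ^ 2) • g (g x) := by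
      simp only [Fin.sum_univ_three, Fin.val_zero, Fin.val_one, Fin.val_two, mul_zero, pow_zero,
        mul_one, pow_one]
      rw [show 2 * 2 = 4 from rfl, h4]
      module
    rw [h5, hζ0, zero_smul, zero_smul, add_zero, add_zero, smul_smul, inv_mul_cancel₀ h3, one_smul]
  rw [hsum]
  exact Submodule.smul_mem _ _ (Submodule.sum_mem _ fun c _ => hmem c)

variable [FiniteDimensional F 𝕍]

/-- The dimension of the `ζ ^ t`-eigenspace of `g`. -/
noncomputable def eigenDim (g : End F 𝕍) (ζ : F) (t : ℕ) : ℕ :=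
  finrank F (End.eigenspace g (ζ ^ t))

/-- A basis of eigenvectors of `g` indexed by any type coloured compatibly with the eigenspace
dimensions. -/
theorem exists_basis_of_coloring {g : End F 𝕍} (hg : g ^ 3 = 1) (h3 : (3 : F) ≠ 0) {ζ : F}
    (hζ : IsPrimitiveRoot ζ 3) {I : Type*} [Fintype I] (col : I → Fin 3)
    (hcol : ∀ c, Fintype.card {i // col i = c} = eigenDim g ζ c) :
    ∃ b : Basis I F 𝕍, ∀ i, g (b i) = ζ ^ (col i : ℕ) • b i := by
  let b₀ := (isInternal_eigenspaces hg h3 hζ).collectedBasis fun c =>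
    Module.finBasis F (End.eigenspace g (ζ ^ (c : ℕ)))
  have hb₀ : ∀ i, g (b₀ i) = ζ ^ (i.1 : ℕ) • b₀ i := fun i =>
    End.mem_eigenspace_iff.1 ((isInternal_eigenspaces hg h3 hζ).collectedBasis_mem _ i)
  let e : I ≃ Σ c : Fin 3, Fin (finrank F (End.eigenspace g (ζ ^ (c : ℕ)))) :=
    (Equiv.sigmaFiberEquiv col).symm.trans
      (Equiv.sigmaCongrRight fun c => Fintype.equivFinOfCardEq (hcol c))
  refine ⟨b₀.reindex e.symm, fun i => ?_⟩
  rw [Basis.reindex_apply, Equiv.symm_symm, hb₀]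
  rfl

end GradedBasis

section Generic

variable {F 𝕍 : Type*} [Field F] [AddCommGroup 𝕍] [Module F 𝕍]

theorem eq_zero_of_sum_mul_pow_eq_zero [CharZero F] {n : ℕ} {a : Fin n → F}
    (h : ∀ i : Fin n, ∑ j : Fin n, a j * ((i : ℕ) + 1 : F) ^ (j : ℕ) = 0) : a = 0 := by
  refine Matrix.eq_zero_of_mulVec_eq_zero
    (M := Matrix.vandermonde fun i : Fin n => ((i : ℕ) + 1 : F)) ?_ ?_
  · rw [Matrix.det_vandermonde_ne_zero_iff]
    intro i j hij
    have : ((i : ℕ) : F) = (j : ℕ) := add_right_cancel hij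
    exact Fin.ext (Nat.cast_injective this)
  · funext i
    rw [Matrix.mulVec, dotProduct, Pi.zero_apply, ← h i]
    exact Finset.sum_congr rfl fun j _ => by rw [Matrix.vandermonde_apply, mul_comm]

theorem pow_apply_cycle {u : End F 𝕍} {e₀ e₁ e₂ : 𝕍} {a : F} (h0 : u e₀ = e₁)
    (h1 : u e₁ = e₂) (h2 : u e₂ = a • e₀) (j : ℕ) : (u ^ (3 * j + 2)) e₀ = a ^ j • e₂ := by
  have h3 : ∀ j : ℕ, (u ^ (3 * j)) e₀ = a ^ j • e₀ := by
    intro j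
    induction j with
    | zero => simp
    | succ j ih =>
      rw [show 3 * (j + 1) = 3 * j + 3 by ring, pow_add, Module.End.mul_apply,
        show (u ^ 3) e₀ = a • e₀ by
          rw [pow_succ, pow_two, Module.End.mul_apply, Module.End.mul_apply, h0, h1, h2],
        map_smul, ih, smul_smul, pow_succ, mul_comm]
  rw [add_comm, pow_add, Module.End.mul_apply, h3, map_smul, pow_two, Module.End.mul_apply, h0, h1]

/-- The relevant minor of the matrix of powers is a Vandermonde determinant in the eigenvalues
`1, …, n` of `u ^ 3` on the cycles. -/
theorem linearIndependent_pow_of_cycles [CharZero F] {u : End F 𝕍} {n : ℕ}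
    {e₀ e₁ e₂ : Fin n → 𝕍} (hne : ∀ i, e₂ i ≠ 0) (h0 : ∀ i, u (e₀ i) = e₁ i)
    (h1 : ∀ i, u (e₁ i) = e₂ i) (h2 : ∀ i, u (e₂ i) = ((i : ℕ) + 1 : F) • e₀ i) :
    LinearIndependent F fun j : Fin n => u ^ (3 * (j : ℕ) + 2) := by
  rw [Fintype.linearIndependent_iff]
  intro a ha
  refine fun j => congrFun (eq_zero_of_sum_mul_pow_eq_zero fun i => ?_) j
  have := LinearMap.congr_fun ha (e₀ i)
  simp only [LinearMap.sum_apply, LinearMap.smul_apply, pow_apply_cycle (h0 i) (h1 i) (h2 i),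
    smul_smul, LinearMap.zero_apply, ← Finset.sum_smul] at this
  exact (smul_eq_zero.1 this).resolve_right (hne i)

theorem pow_mem_gradedPart {g v : End F 𝕍} {ζ : F} (hv : v ∈ gradedPart g ζ) (n : ℕ) :
    v ^ n ∈ gradedPart g (ζ ^ n) := by
  induction n with
  | zero => simp [mem_gradedPart]
  | succ n ih => rw [pow_succ, pow_succ]; exact mul_mem_gradedPart ih hv

theorem pow_mem_gradedPart_sq {g v : End F 𝕍} {ζ : F} (hζ : ζ ^ 3 = 1) (hv : v ∈ gradedPart g ζ)
    (j : ℕ) : v ^ (3 * j + 2) ∈ gradedPart g (ζ ^ 2) := by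
  have := pow_mem_gradedPart hv (3 * j + 2)
  rwa [pow_add, pow_mul, hζ, one_pow, one_mul] at this

theorem isPolyCurve_pow (u w : End F 𝕍) (n : ℕ) :
    IsPolyCurve fun t : F => (u + t • w) ^ n := by
  induction n with
  | zero => simpa using isPolyCurve_const (F := F) (1 : End F 𝕍)
  | succ n ih =>
    have h1 := (ih.map (LinearMap.mulRight F u)).add (ih.map (LinearMap.mulRight F w)).smul
    have h2 : (fun t : F => (u + t • w) ^ (n + 1)) = fun t =>
        LinearMap.mulRight F u ((u + t • w) ^ n) +
          t • LinearMap.mulRight F w ((u + t • w) ^ n) := by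
      funext t
      simp [pow_succ, mul_add]
    rw [h2]; exact h1

variable [FiniteDimensional F 𝕍]

/-- The orbit dimension is maximal at a generic point of any line, which transports the lower bound
for the codimension of an orbit from a point where enough powers are independent. -/
theorem le_finrank_sliceKernel_zero [CharZero F] {θ : End F 𝕍 ≃ₗ⁅F⁆ End F 𝕍} {g : (End F 𝕍)ˣ}
    (hθ : IsConjBy θ g) (hg : (g : End F 𝕍) ^ 3 = 1) {ζ : F} (hζ : ζ ^ 3 = 1) {n : ℕ}
    {u : End F 𝕍} (hu : u ∈ gradedPart (g : End F 𝕍) ζ)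
    (hli : LinearIndependent F fun j : Fin n => u ^ (3 * (j : ℕ) + 2))
    {v : End F 𝕍} (hv : v ∈ gradedPart (g : End F 𝕍) ζ) :
    n ≤ finrank F (sliceKernel (g : End F 𝕍) ζ v 0) := by
  have h3 : (3 : F) ≠ 0 := by norm_num
  have hbad₁ := finite_setOf_not_linearIndependent (t₀ := (0 : F))
    (f := fun (j : Fin n) t => (u + t • v) ^ (3 * (j : ℕ) + 2))
    (fun j => isPolyCurve_pow u v _) (by simpa using hli)
  let v' : gradedPiece θ ζ := ⟨v, (mem_gradedPiece_iff hθ).2 hv⟩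
  let u' : gradedPiece θ ζ := ⟨u, (mem_gradedPiece_iff hθ).2 hu⟩
  -- the orbit at `v + t u` is at least as large as the orbit at `v` for almost all `t`
  obtain ⟨κ, a, -, hsp, hli'⟩ := exists_linearIndependent' F fun x : fixedSubalgebra θ => ⁅x, v'⁆
  have hfin : Finite κ := hli'.finite
  have := Fintype.ofFinite κ
  have hbad₂ := finite_setOf_not_linearIndependent (t₀ := (0 : F))
    (f := fun (k : κ) t => ⁅a k, v'⁆ + t • ⁅a k, u'⁆)
    (fun k => (isPolyCurve_const _).add (isPolyCurve_const _).smul)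
    (by simp only [zero_smul, add_zero]; exact hli')
  obtain ⟨t, ht⟩ := ((hbad₁.union (hbad₂.preimage
    (inv_injective (G := F)).injOn)).union (Set.finite_singleton 0)).exists_notMem
  simp only [Set.mem_union, Set.mem_preimage, Set.mem_ofPred_eq, Set.mem_singleton_iff, not_or,
    not_not] at ht
  obtain ⟨⟨ht1, ht2⟩, ht0⟩ := ht
  have hspan : Submodule.span F (Set.range fun x : fixedSubalgebra θ => ⁅x, v'⁆) = orbitTangent F (fixedSubalgebra θ) v' := by
    apply le_antisymm
    · rw [Submodule.span_le]; rintro _ ⟨x, rfl⟩; exact ⟨x, rfl⟩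
    · rintro _ ⟨x, rfl⟩; exact Submodule.subset_span ⟨x, rfl⟩
  have horb : finrank F (orbitTangent F (fixedSubalgebra θ) v') ≤ finrank F (orbitTangent F (fixedSubalgebra θ) (u' + t • v')) := by
    rw [← hspan, ← hsp,
      show finrank F (Submodule.span F (Set.range ((fun x : fixedSubalgebra θ => ⁅x, v'⁆) ∘ a)))
      = Fintype.card κ from finrank_span_eq_card hli', ← finrank_span_eq_card ht2]
    refine Submodule.finrank_mono (Submodule.span_le.2 ?_)
    rintro _ ⟨k, rfl⟩
    refine ⟨t⁻¹ • a k, ?_⟩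
    simp only [smul_lie, lie_add, lie_smul, smul_smul, mul_inv_cancel₀ ht0, one_smul, add_comm]
  have hpow : n ≤ finrank F (sliceKernel (g : End F 𝕍) ζ (u + t • v) 0) := by
    have hmem : u + t • v ∈ gradedPart (g : End F 𝕍) ζ :=
      add_mem hu (Submodule.smul_mem _ _ hv)
    rw [← Fintype.card_fin n, ← finrank_span_eq_card ht1]
    refine Submodule.finrank_mono (Submodule.span_le.2 ?_)
    rintro _ ⟨j, rfl⟩
    exact mem_sliceKernel_zero.2 ⟨pow_mem_gradedPart_sq hζ hmem _, by rw [← pow_succ', pow_succ]⟩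
  have h1 := finrank_sliceKernel_add hθ hg h3 hζ v' 0
  have h2 := finrank_sliceKernel_add hθ hg h3 hζ (u' + t • v') 0
  rw [sliceTangent_zero_right] at h1 h2
  change finrank F (sliceKernel (g : End F 𝕍) ζ v 0) + _ = _ at h1
  change finrank F (sliceKernel (g : End F 𝕍) ζ (u + t • v) 0) + _ = _ at h2
  change finrank F (orbitTangent F (fixedSubalgebra θ) v') ≤ _ at horb
  omega

end Generic

/-! ### A generic element of `𝔤₁` -/

section GenericElement

variable {F 𝕍 : Type*} [Field F] [AddCommGroup 𝕍] [Module F 𝕍]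

/-- A basis of eigenvectors, split into the three eigenspaces of `g`. -/
theorem exists_basis_sum [FiniteDimensional F 𝕍] {g : End F 𝕍} (hg : g ^ 3 = 1) (h3 : (3 : F) ≠ 0) {ζ : F}
    (hζ : IsPrimitiveRoot ζ 3) :
    ∃ b : Basis (Fin (eigenDim g ζ 0) ⊕ Fin (eigenDim g ζ 1) ⊕ Fin (eigenDim g ζ 2)) F 𝕍,
      (∀ i, g (b (.inl i)) = (1 : F) • b (.inl i)) ∧
      (∀ i, g (b (.inr (.inl i))) = ζ • b (.inr (.inl i))) ∧
      (∀ i, g (b (.inr (.inr i))) = ζ ^ 2 • b (.inr (.inr i))) := by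
  obtain ⟨b, hb⟩ := exists_basis_of_coloring hg h3 hζ
    (I := Fin (eigenDim g ζ 0) ⊕ Fin (eigenDim g ζ 1) ⊕ Fin (eigenDim g ζ 2))
    (Sum.elim (fun _ => 0) (Sum.elim (fun _ => 1) fun _ => 2)) (by
      intro c
      rw [Fintype.card_subtype, Finset.card_filter, Fintype.sum_sum_type, Fintype.sum_sum_type]
      fin_cases c <;> simp)
  refine ⟨b, fun i => ?_, fun i => ?_, fun i => ?_⟩ <;> rw [hb] <;> simp

/-- A representation of the cyclic quiver whose arrows have maximal rank and whose cycles have the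
eigenvalues `1, …, n`. -/
theorem exists_cycles_of_basis {g : End F 𝕍} {ζ : F} (hζ3 : ζ ^ 3 = 1)
    {p q n : ℕ} (b : Basis (Fin p ⊕ Fin q ⊕ Fin n) F 𝕍)
    (hX : ∀ i, g (b (.inl i)) = (1 : F) • b (.inl i))
    (hY : ∀ i, g (b (.inr (.inl i))) = ζ • b (.inr (.inl i)))
    (hZ : ∀ i, g (b (.inr (.inr i))) = ζ ^ 2 • b (.inr (.inr i)))
    (h02 : n ≤ p) :
    ∃ v ∈ gradedPart g ζ,
      (∀ i : Fin p, ∀ h : (i : ℕ) < q, v (b (.inl i)) = b (.inr (.inl ⟨i, h⟩))) ∧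
      (∀ i : Fin p, ¬ (i : ℕ) < q → v (b (.inl i)) = 0) ∧
      (∀ i : Fin q, ∀ h : (i : ℕ) < n, v (b (.inr (.inl i))) = b (.inr (.inr ⟨i, h⟩))) ∧
      (∀ i : Fin q, ¬ (i : ℕ) < n → v (b (.inr (.inl i))) = 0) ∧
      (∀ i : Fin n, v (b (.inr (.inr i))) = ((i : ℕ) + 1 : F) • b (.inl (Fin.castLE h02 i))) := by
  classical
  let d : Fin p ⊕ Fin q ⊕ Fin n → F := Sum.elim (fun _ => 1) (Sum.elim (fun _ => ζ) fun _ => ζ ^ 2)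
  have hb : ∀ i, g (b i) = d i • b i := by
    rintro (i | i | i)
    exacts [hX i, hY i, hZ i]
  let f : Fin p ⊕ Fin q ⊕ Fin n → 𝕍 := Sum.elim
    (fun i => if h : (i : ℕ) < q then b (.inr (.inl ⟨i, h⟩)) else 0)
    (Sum.elim (fun i => if h : (i : ℕ) < n then b (.inr (.inr ⟨i, h⟩)) else 0)
      fun i => ((i : ℕ) + 1 : F) • b (.inl (Fin.castLE h02 i)))
  let v : End F 𝕍 := b.constr F f
  have hvX : ∀ i : Fin p, ∀ h : (i : ℕ) < q, v (b (.inl i)) = b (.inr (.inl ⟨i, h⟩)) := by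
    intro i h; simp [v, f, h]
  have hvX' : ∀ i : Fin p, ¬ (i : ℕ) < q → v (b (.inl i)) = 0 := by
    intro i h; simp [v, f, h]
  have hvY : ∀ i : Fin q, ∀ h : (i : ℕ) < n, v (b (.inr (.inl i))) = b (.inr (.inr ⟨i, h⟩)) := by
    intro i h; simp [v, f, h]
  have hvY' : ∀ i : Fin q, ¬ (i : ℕ) < n → v (b (.inr (.inl i))) = 0 := by
    intro i h; simp [v, f, h]
  have hvZ : ∀ i : Fin n, v (b (.inr (.inr i))) =
      ((i : ℕ) + 1 : F) • b (.inl (Fin.castLE h02 i)) := by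
    intro i; simp [v, f]
  have hv : v ∈ gradedPart g ζ := by
    refine mem_gradedPart_of_basis b hb ?_
    rintro (i | i | i)
    · by_cases h : (i : ℕ) < q
      · rw [hvX i h, hY]; simp [d]
      · rw [hvX' i h]; simp
    · by_cases h : (i : ℕ) < n
      · rw [hvY i h, hZ]; simp [d, pow_two]
      · rw [hvY' i h]; simp
    · rw [hvZ, map_smul, hX]; simp [d, ← pow_succ, hζ3]
  exact ⟨v, hv, hvX, hvX', hvY, hvY', hvZ⟩

/-- The codimension bound for the element with full-rank arrows and distinct nonzero eigenvalues on
its cycles. -/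
theorem finrank_sliceKernel_generic_le [CharZero F] {g : End F 𝕍} {ζ : F}
    (hζ : IsPrimitiveRoot ζ 3)
    {p q n : ℕ} (b : Basis (Fin p ⊕ Fin q ⊕ Fin n) F 𝕍)
    (hX : ∀ i, g (b (.inl i)) = (1 : F) • b (.inl i))
    (hY : ∀ i, g (b (.inr (.inl i))) = ζ • b (.inr (.inl i)))
    (hZ : ∀ i, g (b (.inr (.inr i))) = ζ ^ 2 • b (.inr (.inr i)))
    (h02 : n ≤ p) (h12 : n ≤ q)
    {v : End F 𝕍} (hvX : ∀ i : Fin p, ∀ h : (i : ℕ) < q, v (b (.inl i)) = b (.inr (.inl ⟨i, h⟩)))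
    (hvX' : ∀ i : Fin p, ¬ (i : ℕ) < q → v (b (.inl i)) = 0)
    (hvY : ∀ i : Fin q, ∀ h : (i : ℕ) < n, v (b (.inr (.inl i))) = b (.inr (.inr ⟨i, h⟩)))
    (hvY' : ∀ i : Fin q, ¬ (i : ℕ) < n → v (b (.inr (.inl i))) = 0)
    (hvZ : ∀ i : Fin n, v (b (.inr (.inr i))) = ((i : ℕ) + 1 : F) • b (.inl (Fin.castLE h02 i))) :
    finrank F (sliceKernel g ζ v 0) ≤ n := by
  classical
  have hζ1 : ζ ≠ 1 := hζ.ne_one (by norm_num)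
  have hζ3 : ζ ^ 3 = 1 := hζ.pow_eq_one
  have hζ0 : ζ ≠ 0 := hζ.ne_zero (by norm_num)
  have hζ21 : ζ ^ 2 ≠ 1 := fun h => hζ1 (by rw [← hζ3, pow_succ, h, one_mul])
  have hζ2 : ζ ^ 2 ≠ ζ := fun h => hζ1 (mul_left_cancel₀ hζ0 (by rw [← pow_two, h, mul_one]))
  let d : Fin p ⊕ Fin q ⊕ Fin n → F := Sum.elim (fun _ => 1) (Sum.elim (fun _ => ζ) fun _ => ζ ^ 2)
  have hb : ∀ i, g (b i) = d i • b i := by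
    rintro (i | i | i)
    exacts [hX i, hY i, hZ i]
  let Λ : sliceKernel g ζ v 0 →ₗ[F] (Fin n → F) := LinearMap.pi fun i =>
    (b.coord (.inr (.inr i)) ∘ₗ LinearMap.applyₗ (b (.inl (Fin.castLE h02 i)))) ∘ₗ
      (sliceKernel g ζ v 0).subtype
  suffices hinj : Function.Injective Λ by
    simpa using LinearMap.finrank_le_finrank_of_injective hinj
  rw [← LinearMap.ker_eq_bot, LinearMap.ker_eq_bot']
  rintro ⟨y, hy⟩ hΛ
  obtain ⟨hyg, hyv⟩ := mem_sliceKernel_zero.1 hy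
  have hΛ' : ∀ i : Fin n, b.repr (y (b (.inl (Fin.castLE h02 i)))) (.inr (.inr i)) = 0 :=
    fun i => congrFun hΛ i
  have hcomm : ∀ w, v (y w) = y (v w) := fun w => LinearMap.congr_fun hyv w
  -- `y` maps the eigenvectors for `1` into the span of the eigenvectors for `ζ ^ 2`
  have hyX : ∀ i, y (b (.inl i)) =
      ∑ k, b.repr (y (b (.inl i))) (.inr (.inr k)) • b (.inr (.inr k)) := by
    intro i
    have h1 := apply_eigenvector_of_mem_gradedPart hyg (hX i)
    rw [one_mul] at h1
    conv_lhs => rw [← b.sum_repr (y (b (.inl i)))]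
    simp only [Fintype.sum_sum_type]
    rw [Finset.sum_eq_zero, Finset.sum_eq_zero, zero_add, zero_add]
    · intro k _
      rw [repr_eq_zero_of_eigenvector b hb h1 (j := .inr (.inl k)) hζ2.symm, zero_smul]
    · intro k _
      rw [repr_eq_zero_of_eigenvector b hb h1 (j := .inl k) hζ21.symm, zero_smul]
  have hyY : ∀ j, y (b (.inr (.inl j))) =
      ∑ k, b.repr (y (b (.inr (.inl j)))) (.inl k) • b (.inl k) := by
    intro j
    have h1 := apply_eigenvector_of_mem_gradedPart hyg (hY j)
    rw [← pow_succ', hζ3] at h1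
    conv_lhs => rw [← b.sum_repr (y (b (.inr (.inl j))))]
    simp only [Fintype.sum_sum_type]
    rw [Finset.sum_eq_zero (f := fun k => _ • b (.inr (.inl k))),
      Finset.sum_eq_zero (f := fun k => _ • b (.inr (.inr k))), zero_add, add_zero]
    · intro k _
      rw [repr_eq_zero_of_eigenvector b hb h1 (j := .inr (.inr k)) hζ21, zero_smul]
    · intro k _
      rw [repr_eq_zero_of_eigenvector b hb h1 (j := .inr (.inl k)) hζ1, zero_smul]
  have hv3Z : ∀ k : Fin n, v (v (v (b (.inr (.inr k))))) = ((k : ℕ) + 1 : F) • b (.inr (.inr k)) := by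
    intro k
    rw [hvZ, map_smul, hvX _ (k.2.trans_le h12), map_smul, hvY _ k.2]
    rfl
  have hv3 : ∀ i k, b.repr (v (v (v (y (b (.inl i)))))) (.inr (.inr k)) =
      ((k : ℕ) + 1 : F) * b.repr (y (b (.inl i))) (.inr (.inr k)) := by
    intro i k
    conv_lhs => rw [hyX i]
    simp only [map_sum, map_smul, hv3Z, Basis.repr_self, Finsupp.coe_finsetSum, Finset.sum_apply,
      Finsupp.smul_apply, Finsupp.single_apply, Sum.inr.injEq, smul_eq_mul, mul_ite, mul_one,
      mul_zero, Finset.sum_ite_eq', Finset.mem_univ, if_true]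
    rw [mul_comm]
  have hcast : ∀ k : ℕ, (k + 1 : F) ≠ 0 := fun k => Nat.cast_add_one_ne_zero k
  have hX0 : ∀ i, y (b (.inl i)) = 0 := by
    intro i
    rw [hyX i]
    refine Finset.sum_eq_zero fun k _ => ?_
    suffices h : b.repr (y (b (.inl i))) (.inr (.inr k)) = 0 by rw [h, zero_smul]
    have h1 := hv3 i k
    rw [hcomm, hcomm, hcomm] at h1
    by_cases hi : (i : ℕ) < n
    · have hvi : v (v (v (b (.inl i)))) = ((i : ℕ) + 1 : F) • b (.inl i) := by
        rw [hvX i (hi.trans_le h12), hvY _ hi, hvZ]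
        rfl
      rw [hvi, map_smul, map_smul, Finsupp.smul_apply, smul_eq_mul] at h1
      rcases eq_or_ne (k : ℕ) i with hki | hki
      · have := hΛ' k
        rwa [show Fin.castLE h02 k = i from Fin.ext hki] at this
      · have h2 : ((i : F) - (k : ℕ)) * b.repr (y (b (.inl i))) (.inr (.inr k)) = 0 := by
          linear_combination h1
        refine (mul_eq_zero.1 h2).resolve_left (sub_ne_zero.2 fun h => hki ?_)
        exact (Nat.cast_injective h).symm
    · have hvi : v (v (b (.inl i))) = 0 := by
        by_cases hq : (i : ℕ) < q
        · rw [hvX i hq, hvY' _ hi]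
        · rw [hvX' i hq, map_zero]
      rw [hvi, map_zero, map_zero, map_zero, Finsupp.zero_apply] at h1
      exact (mul_eq_zero.1 h1.symm).resolve_left (hcast _)
  have hY0 : ∀ j, y (b (.inr (.inl j))) = 0 := by
    intro j
    by_cases hj : (j : ℕ) < p
    · rw [← show v (b (.inl ⟨j, hj⟩)) = b (.inr (.inl j)) from hvX ⟨j, hj⟩ j.2, ← hcomm, hX0, map_zero]
    · have hpq : p ≤ q := by omega
      have h1 : v (y (b (.inr (.inl j)))) = 0 := by
        rw [hcomm, hvY' j (by omega), map_zero]
      rw [hyY j, map_sum] at h1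
      rw [hyY j]
      refine Finset.sum_eq_zero fun k _ => ?_
      have h2 := congrArg (fun w => b.repr w (.inr (.inl (Fin.castLE hpq k)))) h1
      simp only [map_smul, hvX _ (Fin.is_lt _ |>.trans_le hpq), map_sum, Basis.repr_self,
        Finsupp.coe_finsetSum, Finset.sum_apply, Finsupp.smul_apply, Finsupp.single_apply,
        Sum.inr.injEq, Sum.inl.injEq, smul_eq_mul, mul_ite, mul_one, mul_zero, map_zero,
        Finsupp.zero_apply, Fin.ext_iff, Fin.val_castLE] at h2
      rw [Finset.sum_eq_single k (fun x _ hx => if_neg fun h => hx (Fin.ext h)) (by simp),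
        if_pos rfl] at h2
      rw [h2, zero_smul]
  have hZ0 : ∀ k, y (b (.inr (.inr k))) = 0 := by
    intro k
    rw [← show v (b (.inr (.inl (Fin.castLE h12 k)))) = b (.inr (.inr k)) from hvY _ k.2,
      ← hcomm, hY0, map_zero]
  apply Subtype.ext
  refine b.ext ?_
  rintro (i | i | i)
  exacts [hX0 i, hY0 i, hZ0 i]

theorem exists_generic_of_basis [CharZero F] {g : End F 𝕍} {ζ : F} (hζ : IsPrimitiveRoot ζ 3)
    {p q n : ℕ} (b : Basis (Fin p ⊕ Fin q ⊕ Fin n) F 𝕍)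
    (hX : ∀ i, g (b (.inl i)) = (1 : F) • b (.inl i))
    (hY : ∀ i, g (b (.inr (.inl i))) = ζ • b (.inr (.inl i)))
    (hZ : ∀ i, g (b (.inr (.inr i))) = ζ ^ 2 • b (.inr (.inr i)))
    (h02 : n ≤ p) (h12 : n ≤ q) :
    ∃ v ∈ gradedPart g ζ, finrank F (sliceKernel g ζ v 0) ≤ n ∧
      LinearIndependent F fun j : Fin n => v ^ (3 * (j : ℕ) + 2) := by
  obtain ⟨v, hv, hvX, hvX', hvY, hvY', hvZ⟩ :=
    exists_cycles_of_basis hζ.pow_eq_one b hX hY hZ h02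
  refine ⟨v, hv, finrank_sliceKernel_generic_le hζ b hX hY hZ h02 h12 hvX hvX' hvY hvY' hvZ, ?_⟩
  exact linearIndependent_pow_of_cycles (e₀ := fun i => b (.inl (Fin.castLE h02 i)))
      (e₁ := fun i => b (.inr (.inl (Fin.castLE h12 i)))) (e₂ := fun i => b (.inr (.inr i)))
      (fun i => b.ne_zero _) (fun i => hvX _ (i.2.trans_le h12)) (fun i => hvY _ i.2) hvZ

/-- If `ζ ^ 2` has the smallest eigenspace, of dimension `n`, then some `v ∈ 𝔤₁` has `n` cycles with
distinct eigenvalues and an orbit of codimension at most `n`. -/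
theorem exists_generic [CharZero F] [FiniteDimensional F 𝕍] {g : End F 𝕍} (hg : g ^ 3 = 1) {ζ : F}
    (hζ : IsPrimitiveRoot ζ 3) (h02 : eigenDim g ζ 2 ≤ eigenDim g ζ 0)
    (h12 : eigenDim g ζ 2 ≤ eigenDim g ζ 1) :
    ∃ v ∈ gradedPart g ζ, finrank F (sliceKernel g ζ v 0) ≤ eigenDim g ζ 2 ∧
      LinearIndependent F fun j : Fin (eigenDim g ζ 2) => v ^ (3 * (j : ℕ) + 2) := by
  obtain ⟨b, hX, hY, hZ⟩ := exists_basis_sum hg (by norm_num) hζ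
  exact exists_generic_of_basis hζ b hX hY hZ h02 h12

end GenericElement

/-! ### A point with large slice kernels -/

section RankOne

variable {F 𝕍 : Type*} [Field F] [AddCommGroup 𝕍] [Module F 𝕍]

theorem mul_smulRight (x : End F 𝕍) (φ : Dual F 𝕍) (w : 𝕍) :
    x * (φ.smulRight w : End F 𝕍) = φ.smulRight (x w) := by
  ext u; simp

theorem smulRight_mul (x : End F 𝕍) (φ : Dual F 𝕍) (w : 𝕍) :
    (φ.smulRight w : End F 𝕍) * x = (φ ∘ₗ x).smulRight w := by
  ext u; simp

theorem coord_smulRight_mem_gradedPart {I : Type*} {g : End F 𝕍} (b : Basis I F 𝕍) {d : I → F}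
    (hb : ∀ i, g (b i) = d i • b i) {c : F} {j k : I} (h : d k = d j * c) :
    ((b.coord j).smulRight (b k) : End F 𝕍) ∈ gradedPart g c := by
  refine mem_gradedPart_of_basis b hb fun i => ?_
  rcases eq_or_ne i j with rfl | hij
  · simp [hb, h]
  · simp [Finsupp.single_eq_of_ne' hij]

/-- If `x` acts on `y` by the scalar `p` from the left and by `q` from the right, then the
functional `tr (y [x, η])` of `x` only sees `q - p`. -/
theorem trace_mul_lie_of_scalars {x y η : End F 𝕍} {p q : F} (h1 : x * y = p • y)
    (h2 : y * x = q • y) :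
    LinearMap.trace F 𝕍 (y * (x * η - η * x)) = (q - p) * LinearMap.trace F 𝕍 (y * η) := by
  have h3 : LinearMap.trace F 𝕍 (y * (η * x)) = LinearMap.trace F 𝕍 (x * y * η) := by
    rw [← mul_assoc, LinearMap.trace_mul_comm, ← mul_assoc]
  rw [mul_sub, map_sub, h3, ← mul_assoc, h1, h2, smul_mul_assoc, smul_mul_assoc, map_smul, map_smul,
    smul_eq_mul, smul_eq_mul, sub_mul]

end RankOne

section Counterexample

/-- The index type of the Jordan basis of the point where good index behaviour fails: Jordan blocks
of lengths `3` and `5`, then `z`, `x`, `y` blocks of length `1`, then `k` cycles. -/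
abbrev BadIndex (z x y k : ℕ) : Type :=
  Fin 3 ⊕ Fin 5 ⊕ Fin z ⊕ Fin x ⊕ Fin y ⊕ (Fin k × Fin 3)

/-- The eigenspace to which a vector of the Jordan basis belongs. -/
def badColor (z x y k : ℕ) : BadIndex z x y k → Fin 3 :=
  Sum.elim ![1, 2, 0] (Sum.elim ![0, 1, 2, 0, 1] (Sum.elim (fun _ => 2)
    (Sum.elim (fun _ => 0) (Sum.elim (fun _ => 1) fun i => i.2))))

variable {F 𝕍 : Type*} [Field F] [AddCommGroup 𝕍] [Module F 𝕍]

/-- The relations satisfied by an endomorphism `v` acting on the Jordan basis, together with the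
dual relations for the coordinate functionals. -/
structure IsBadEndo {z x y k : ℕ} (b : Basis (BadIndex z x y k) F 𝕍) (v : End F 𝕍) : Prop where
  P0 : v (b (.inl 0)) = b (.inl 1)
  P1 : v (b (.inl 1)) = b (.inl 2)
  P2 : v (b (.inl 2)) = 0
  Q0 : v (b (.inr (.inl 0))) = b (.inr (.inl 1))
  Q1 : v (b (.inr (.inl 1))) = b (.inr (.inl 2))
  Q2 : v (b (.inr (.inl 2))) = b (.inr (.inl 3))
  Q3 : v (b (.inr (.inl 3))) = b (.inr (.inl 4))
  Q4 : v (b (.inr (.inl 4))) = 0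
  S : ∀ i, v (b (.inr (.inr (.inl i)))) = 0
  A : ∀ i, v (b (.inr (.inr (.inr (.inl i))))) = 0
  C : ∀ i, v (b (.inr (.inr (.inr (.inr (.inl i)))))) = 0
  E0 : ∀ i, v (b (.inr (.inr (.inr (.inr (.inr (i, 0))))))) =
    b (.inr (.inr (.inr (.inr (.inr (i, 1))))))
  E1 : ∀ i, v (b (.inr (.inr (.inr (.inr (.inr (i, 1))))))) =
    b (.inr (.inr (.inr (.inr (.inr (i, 2))))))
  E2 : ∀ i, v (b (.inr (.inr (.inr (.inr (.inr (i, 2))))))) =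
    ((i : ℕ) + 1 : F) • b (.inr (.inr (.inr (.inr (.inr (i, 0))))))

theorem exists_isBadEndo {z x y k : ℕ} (b : Basis (BadIndex z x y k) F 𝕍) {g : End F 𝕍} {ζ : F}
    (hζ : ζ ^ 3 = 1) (hb : ∀ i, g (b i) = ζ ^ (badColor z x y k i : ℕ) • b i) :
    ∃ v ∈ gradedPart g ζ, IsBadEndo b v := by
  let f : BadIndex z x y k → 𝕍 :=
    Sum.elim ![b (.inl 1), b (.inl 2), 0]
      (Sum.elim ![b (.inr (.inl 1)), b (.inr (.inl 2)), b (.inr (.inl 3)), b (.inr (.inl 4)), 0]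
        (Sum.elim (fun _ => 0) (Sum.elim (fun _ => 0) (Sum.elim (fun _ => 0) fun i =>
          ![b (.inr (.inr (.inr (.inr (.inr (i.1, 1)))))),
            b (.inr (.inr (.inr (.inr (.inr (i.1, 2)))))),
            ((i.1 : ℕ) + 1 : F) • b (.inr (.inr (.inr (.inr (.inr (i.1, 0))))))] i.2))))
  have hf : ∀ i, b.constr F f (b i) = f i := fun i => b.constr_basis F f i
  have h : IsBadEndo b (b.constr F f) := by
    constructor <;> intros <;> rw [hf] <;> rfl
  refine ⟨b.constr F f, mem_gradedPart_of_basis b hb ?_, h⟩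
  rintro (i | i | i | i | i | ⟨i, j⟩)
  · fin_cases i
    · simp [h.P0, hb, badColor, pow_two]
    · simp [h.P1, hb, badColor, ← pow_succ, hζ]
    · simp [h.P2]
  · fin_cases i
    · simp [h.Q0, hb, badColor]
    · simp [h.Q1, hb, badColor, pow_two]
    · simp [h.Q2, hb, badColor, ← pow_succ, hζ]
    · simp [h.Q3, hb, badColor]
    · simp [h.Q4]
  · simp [h.S]
  · simp [h.A]
  · simp [h.C]
  · fin_cases j
    · simp [h.E0, hb, badColor]
    · simp [h.E1, hb, badColor, pow_two]
    · simp [h.E2, hb, badColor, ← pow_succ, hζ]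

namespace IsBadEndo

variable {z x y k : ℕ} {b : Basis (BadIndex z x y k) F 𝕍} {v : End F 𝕍}

theorem basis_cases {p : BadIndex z x y k → Prop} (h0 : p (.inl 0)) (h1 : p (.inl 1))
    (h2 : p (.inl 2)) (k0 : p (.inr (.inl 0))) (k1 : p (.inr (.inl 1))) (k2 : p (.inr (.inl 2)))
    (k3 : p (.inr (.inl 3))) (k4 : p (.inr (.inl 4))) (hS : ∀ i, p (.inr (.inr (.inl i))))
    (hA : ∀ i, p (.inr (.inr (.inr (.inl i))))) (hC : ∀ i, p (.inr (.inr (.inr (.inr (.inl i))))))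
    (hE : ∀ i j, p (.inr (.inr (.inr (.inr (.inr (i, j))))))) : ∀ i, p i := by
  rintro (i | i | i | i | i | ⟨i, j⟩)
  · fin_cases i
    exacts [h0, h1, h2]
  · fin_cases i
    exacts [k0, k1, k2, k3, k4]
  exacts [hS i, hA i, hC i, hE i j]

/-- A functional vanishing on the image of `v` and on the tops of the Jordan blocks is zero. -/
theorem functional_eq_zero [CharZero F] (h : IsBadEndo b v) {φ : Dual F 𝕍} (hφ : ∀ u, φ (v u) = 0)
    (hP : φ (b (.inl 0)) = 0) (hQ : φ (b (.inr (.inl 0))) = 0)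
    (hS : ∀ i, φ (b (.inr (.inr (.inl i)))) = 0)
    (hA : ∀ i, φ (b (.inr (.inr (.inr (.inl i))))) = 0)
    (hC : ∀ i, φ (b (.inr (.inr (.inr (.inr (.inl i)))))) = 0) : φ = 0 := by
  refine b.ext (basis_cases hP ?_ ?_ hQ ?_ ?_ ?_ ?_ hS hA hC ?_)
  · rw [← h.P0, hφ]; rfl
  · rw [← h.P1, hφ]; rfl
  · rw [← h.Q0, hφ]; rfl
  · rw [← h.Q1, hφ]; rfl
  · rw [← h.Q2, hφ]; rfl
  · rw [← h.Q3, hφ]; rfl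
  · intro i j
    fin_cases j
    · have h1 := hφ (b (.inr (.inr (.inr (.inr (.inr (i, 2)))))))
      rw [h.E2, map_smul, smul_eq_mul] at h1
      exact (mul_eq_zero.1 h1).resolve_left (Nat.cast_add_one_ne_zero _)
    · have h1 := hφ (b (.inr (.inr (.inr (.inr (.inr (i, 0)))))))
      rwa [h.E0] at h1
    · have h1 := hφ (b (.inr (.inr (.inr (.inr (.inr (i, 1)))))))
      rwa [h.E1] at h1

/-- The coordinates of `v u` in terms of those of `u`. -/
theorem coord_apply (h : IsBadEndo b v) :
    (∀ u, b.coord (.inl 0) (v u) = 0) ∧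
    (∀ u, b.coord (.inl 1) (v u) = b.coord (.inl 0) u) ∧
    (∀ u, b.coord (.inl 2) (v u) = b.coord (.inl 1) u) ∧
    (∀ u, b.coord (.inr (.inl 0)) (v u) = 0) ∧
    (∀ u, b.coord (.inr (.inl 1)) (v u) = b.coord (.inr (.inl 0)) u) ∧
    (∀ u, b.coord (.inr (.inl 2)) (v u) = b.coord (.inr (.inl 1)) u) ∧
    (∀ u, b.coord (.inr (.inl 3)) (v u) = b.coord (.inr (.inl 2)) u) ∧
    (∀ u, b.coord (.inr (.inl 4)) (v u) = b.coord (.inr (.inl 3)) u) ∧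
    (∀ i u, b.coord (.inr (.inr (.inl i))) (v u) = 0) ∧
    (∀ i u, b.coord (.inr (.inr (.inr (.inl i)))) (v u) = 0) ∧
    (∀ i u, b.coord (.inr (.inr (.inr (.inr (.inl i))))) (v u) = 0) ∧
    (∀ i u, b.coord (.inr (.inr (.inr (.inr (.inr (i, 1)))))) (v u) =
      b.coord (.inr (.inr (.inr (.inr (.inr (i, 0)))))) u) ∧
    (∀ i u, b.coord (.inr (.inr (.inr (.inr (.inr (i, 2)))))) (v u) =
      b.coord (.inr (.inr (.inr (.inr (.inr (i, 1)))))) u) ∧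
    (∀ i u, b.coord (.inr (.inr (.inr (.inr (.inr (i, 0)))))) (v u) =
      ((i : ℕ) + 1 : F) * b.coord (.inr (.inr (.inr (.inr (.inr (i, 2)))))) u) := by
  have key : ∀ φ ψ : Dual F 𝕍, (∀ i, φ (v (b i)) = ψ (b i)) → ∀ u, φ (v u) = ψ u := by
    intro φ ψ hφ u
    exact LinearMap.congr_fun (b.ext hφ : φ ∘ₗ v = ψ) u
  have hcyc : ∀ (i : Fin k) (j : Fin 3), v (b (.inr (.inr (.inr (.inr (.inr (i, j))))))) =
      ![b (.inr (.inr (.inr (.inr (.inr (i, 1)))))), b (.inr (.inr (.inr (.inr (.inr (i, 2)))))),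
        ((i : ℕ) + 1 : F) • b (.inr (.inr (.inr (.inr (.inr (i, 0))))))] j := by
    intro i j
    fin_cases j
    exacts [h.E0 i, h.E1 i, h.E2 i]
  refine ⟨key _ 0 ?_, key _ _ ?_, key _ _ ?_, key _ 0 ?_, key _ _ ?_, key _ _ ?_, key _ _ ?_,
    key _ _ ?_, fun i => key _ 0 ?_, fun i => key _ 0 ?_, fun i => key _ 0 ?_, fun i => key _ _ ?_,
    fun i => key _ _ ?_, fun i => key _ (((i : ℕ) + 1 : F) • b.coord _) ?_⟩
  all_goals
    refine basis_cases ?_ ?_ ?_ ?_ ?_ ?_ ?_ ?_ ?_ ?_ ?_ ?_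
    all_goals first
      | (simp [h.P0, h.P1, h.P2, h.Q0, h.Q1, h.Q2, h.Q3, h.Q4, h.S, h.A, h.C, Finsupp.single_apply]; done)
      | (intro i' j
         rw [hcyc]
         fin_cases j <;> simp [Finsupp.single_apply] <;> aesop)

/-- A vector of the kernel of `v` is determined by its coordinates at the ends of the Jordan
blocks. -/
theorem vector_eq_zero [CharZero F] (h : IsBadEndo b v) {w : 𝕍} (hw : v w = 0)
    (hP : b.coord (.inl 2) w = 0) (hQ : b.coord (.inr (.inl 4)) w = 0)
    (hS : ∀ i, b.coord (.inr (.inr (.inl i))) w = 0)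
    (hA : ∀ i, b.coord (.inr (.inr (.inr (.inl i)))) w = 0)
    (hC : ∀ i, b.coord (.inr (.inr (.inr (.inr (.inl i))))) w = 0) : w = 0 := by
  obtain ⟨-, p1, p2, -, q1, q2, q3, q4, -, -, -, e1, e2, e0⟩ := h.coord_apply
  refine b.ext_elem fun i => ?_
  rw [map_zero, Finsupp.zero_apply, ← Basis.coord_apply]
  refine basis_cases (p := fun i => b.coord i w = 0) ?_ ?_ hP ?_ ?_ ?_ ?_ hQ hS hA hC ?_ i
  · rw [← p1, hw, map_zero]
  · rw [← p2, hw, map_zero]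
  · rw [← q1, hw, map_zero]
  · rw [← q2, hw, map_zero]
  · rw [← q3, hw, map_zero]
  · rw [← q4, hw, map_zero]
  · intro i j
    fin_cases j
    · have := e1 i w
      rw [hw, map_zero] at this
      exact this.symm
    · have := e2 i w
      rw [hw, map_zero] at this
      exact this.symm
    · have := e0 i w
      rw [hw, map_zero] at this
      exact (mul_eq_zero.1 this.symm).resolve_left (Nat.cast_add_one_ne_zero _)

theorem coord_eq_zero_of_color {g : End F 𝕍} {ζ : F} (hζ : IsPrimitiveRoot ζ 3)
    (hb : ∀ i, g (b i) = ζ ^ (badColor z x y k i : ℕ) • b i) {X : End F 𝕍}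
    (hX : X ∈ gradedPart g 1) {i j : BadIndex z x y k}
    (hij : badColor z x y k j ≠ badColor z x y k i) : b.coord j (X (b i)) = 0 := by
  have h1 := apply_eigenvector_of_mem_gradedPart hX (hb i)
  rw [mul_one] at h1
  refine repr_eq_zero_of_eigenvector b hb h1 fun h => hij (Fin.ext ?_)
  exact hζ.pow_inj (Fin.is_lt _) (Fin.is_lt _) h

/-- An element `X` of the centraliser of `v` in degree `0` acts by scalars `p`, `q`, `s` on the
Jordan blocks of length `3`, `5` and on the block of length `1` in the `ζ²`-eigenspace, up to terms
which the elements of the slice kernel below do not see. -/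
theorem centralizer_scalars [CharZero F] (h : IsBadEndo b v) (hz : z ≤ 1) {g : End F 𝕍} {ζ : F}
    (hζ : IsPrimitiveRoot ζ 3) (hb : ∀ i, g (b i) = ζ ^ (badColor z x y k i : ℕ) • b i)
    {X : End F 𝕍} (hX : X ∈ gradedPart g 1) (hXv : X * v = v * X) :
    ∃ p q : F, ∃ s : Fin z → F,
      (b.coord (.inl 0) ∘ₗ X = p • b.coord (.inl 0) ∧
        b.coord (.inl 1) ∘ₗ X = p • b.coord (.inl 1) ∧
        b.coord (.inr (.inl 0)) ∘ₗ X = q • b.coord (.inr (.inl 0)) ∧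
        b.coord (.inr (.inl 1)) ∘ₗ X = q • b.coord (.inr (.inl 1)) ∧
        ∀ i, b.coord (.inr (.inr (.inl i))) ∘ₗ X = s i • b.coord (.inr (.inr (.inl i)))) ∧
      X (b (.inl 2)) = p • b (.inl 2) ∧ X (b (.inl 1)) = p • b (.inl 1) ∧
      X (b (.inr (.inl 4))) = q • b (.inr (.inl 4)) ∧
      X (b (.inr (.inl 3))) = q • b (.inr (.inl 3)) ∧
      ∀ i, X (b (.inr (.inr (.inl i)))) = s i • b (.inr (.inr (.inl i))) := by
  have hsub : ∀ i j : Fin z, i = j := fun i j => Fin.ext (by omega)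
  obtain ⟨p0, p1, p2, q0, q1, q2, q3, q4, cS, cA, cC, -, -, -⟩ := h.coord_apply
  have hc : ∀ u, X (v u) = v (X u) := fun u => LinearMap.congr_fun hXv u
  have hcol : ∀ {i j : BadIndex z x y k}, badColor z x y k j ≠ badColor z x y k i →
      b.coord j (X (b i)) = 0 := fun hij => coord_eq_zero_of_color hζ hb hX hij
  have hcol' : ∀ {i j : BadIndex z x y k}, badColor z x y k j ≠ badColor z x y k i →
      b.coord j (b i) = 0 := fun {i j} hij => by
    rw [Basis.coord_apply, Basis.repr_self, Finsupp.single_eq_of_ne]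
    rintro rfl; exact hij rfl
  have hne : ∀ {i j : BadIndex z x y k}, j ≠ i → b.coord j (b i) = 0 := fun {i j} hij => by
    rw [Basis.coord_apply, Basis.repr_self, Finsupp.single_eq_of_ne hij]
  have hself : ∀ i, b.coord i (b i) = 1 := fun i => by simp
  set p := b.coord (.inl 0) (X (b (.inl 0))) with hp
  set q := b.coord (.inr (.inl 0)) (X (b (.inr (.inl 0)))) with hq
  let s : Fin z → F := fun i => b.coord (.inr (.inr (.inl i))) (X (b (.inr (.inr (.inl i)))))
  have hs : ∀ i, b.coord (.inr (.inr (.inl i))) (X (b (.inr (.inr (.inl i))))) = s i :=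
    fun i => rfl
  have fP0 : b.coord (.inl 0) ∘ₗ X = p • b.coord (.inl 0) := by
    rw [← sub_eq_zero]
    apply h.functional_eq_zero
    · intro u
      simp only [LinearMap.sub_apply, LinearMap.comp_apply, LinearMap.smul_apply, hc, p0,
        smul_zero, sub_zero]
    · simp only [LinearMap.sub_apply, LinearMap.comp_apply, LinearMap.smul_apply, ← hp, hself,
        smul_eq_mul, mul_one, sub_self]
    · simp only [LinearMap.sub_apply, LinearMap.comp_apply, LinearMap.smul_apply]
      rw [hcol (by simp [badColor]), hcol' (by simp [badColor]), smul_zero, sub_zero]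
    · intro i
      simp only [LinearMap.sub_apply, LinearMap.comp_apply, LinearMap.smul_apply]
      rw [hcol (by simp [badColor]), hcol' (by simp [badColor]), smul_zero, sub_zero]
    · intro i
      simp only [LinearMap.sub_apply, LinearMap.comp_apply, LinearMap.smul_apply]
      rw [hcol (by simp [badColor]), hcol' (by simp [badColor]), smul_zero, sub_zero]
    · intro i
      simp only [LinearMap.sub_apply, LinearMap.comp_apply, LinearMap.smul_apply]
      rw [← p1, ← hc, h.C, map_zero, map_zero, hne (by simp), smul_zero, sub_zero]
  have fP0' : ∀ u, b.coord (.inl 0) (X u) = p • b.coord (.inl 0) u := LinearMap.congr_fun fP0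
  have fP1 : b.coord (.inl 1) ∘ₗ X = p • b.coord (.inl 1) := by
    rw [← sub_eq_zero]
    apply h.functional_eq_zero
    · intro u
      simp only [LinearMap.sub_apply, LinearMap.comp_apply, LinearMap.smul_apply, hc, p1,
        fP0', sub_self]
    · simp only [LinearMap.sub_apply, LinearMap.comp_apply, LinearMap.smul_apply]
      rw [hcol (by simp [badColor]), hcol' (by simp [badColor]), smul_zero, sub_zero]
    · simp only [LinearMap.sub_apply, LinearMap.comp_apply, LinearMap.smul_apply]
      rw [hcol (by simp [badColor]), hcol' (by simp [badColor]), smul_zero, sub_zero]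
    · intro i
      simp only [LinearMap.sub_apply, LinearMap.comp_apply, LinearMap.smul_apply]
      rw [← p2, ← hc, h.S, map_zero, map_zero, hne (by simp), smul_zero, sub_zero]
    · intro i
      simp only [LinearMap.sub_apply, LinearMap.comp_apply, LinearMap.smul_apply]
      rw [hcol (by simp [badColor]), hcol' (by simp [badColor]), smul_zero, sub_zero]
    · intro i
      simp only [LinearMap.sub_apply, LinearMap.comp_apply, LinearMap.smul_apply]
      rw [hcol (by simp [badColor]), hcol' (by simp [badColor]), smul_zero, sub_zero]
  have fQ0 : b.coord (.inr (.inl 0)) ∘ₗ X = q • b.coord (.inr (.inl 0)) := by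
    rw [← sub_eq_zero]
    apply h.functional_eq_zero
    · intro u
      simp only [LinearMap.sub_apply, LinearMap.comp_apply, LinearMap.smul_apply, hc, q0,
        smul_zero, sub_zero]
    · simp only [LinearMap.sub_apply, LinearMap.comp_apply, LinearMap.smul_apply]
      rw [hcol (by simp [badColor]), hcol' (by simp [badColor]), smul_zero, sub_zero]
    · simp only [LinearMap.sub_apply, LinearMap.comp_apply, LinearMap.smul_apply, ← hq, hself,
        smul_eq_mul, mul_one, sub_self]
    · intro i
      simp only [LinearMap.sub_apply, LinearMap.comp_apply, LinearMap.smul_apply]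
      rw [hcol (by simp [badColor]), hcol' (by simp [badColor]), smul_zero, sub_zero]
    · intro i
      simp only [LinearMap.sub_apply, LinearMap.comp_apply, LinearMap.smul_apply]
      rw [← q1, ← hc, h.A, map_zero, map_zero, hne (by simp), smul_zero, sub_zero]
    · intro i
      simp only [LinearMap.sub_apply, LinearMap.comp_apply, LinearMap.smul_apply]
      rw [hcol (by simp [badColor]), hcol' (by simp [badColor]), smul_zero, sub_zero]
  have fQ0' : ∀ u, b.coord (.inr (.inl 0)) (X u) = q • b.coord (.inr (.inl 0)) u :=
    LinearMap.congr_fun fQ0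
  have fQ1 : b.coord (.inr (.inl 1)) ∘ₗ X = q • b.coord (.inr (.inl 1)) := by
    rw [← sub_eq_zero]
    apply h.functional_eq_zero
    · intro u
      simp only [LinearMap.sub_apply, LinearMap.comp_apply, LinearMap.smul_apply, hc, q1,
        fQ0', sub_self]
    · simp only [LinearMap.sub_apply, LinearMap.comp_apply, LinearMap.smul_apply]
      rw [← q2, ← q3, ← q4, ← hc, h.P0, ← hc, h.P1, ← hc, h.P2, map_zero, map_zero, hne (by simp),
        smul_zero, sub_zero]
    · simp only [LinearMap.sub_apply, LinearMap.comp_apply, LinearMap.smul_apply]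
      rw [hcol (by simp [badColor]), hcol' (by simp [badColor]), smul_zero, sub_zero]
    · intro i
      simp only [LinearMap.sub_apply, LinearMap.comp_apply, LinearMap.smul_apply]
      rw [hcol (by simp [badColor]), hcol' (by simp [badColor]), smul_zero, sub_zero]
    · intro i
      simp only [LinearMap.sub_apply, LinearMap.comp_apply, LinearMap.smul_apply]
      rw [hcol (by simp [badColor]), hcol' (by simp [badColor]), smul_zero, sub_zero]
    · intro i
      simp only [LinearMap.sub_apply, LinearMap.comp_apply, LinearMap.smul_apply]
      rw [← q2, ← hc, h.C, map_zero, map_zero, hne (by simp), smul_zero, sub_zero]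
  have fQ1' : ∀ u, b.coord (.inr (.inl 1)) (X u) = q • b.coord (.inr (.inl 1)) u :=
    LinearMap.congr_fun fQ1
  have fS : ∀ i, b.coord (.inr (.inr (.inl i))) ∘ₗ X = s i • b.coord (.inr (.inr (.inl i))) := by
    intro i
    rw [← sub_eq_zero]
    apply h.functional_eq_zero
    · intro u
      simp only [LinearMap.sub_apply, LinearMap.comp_apply, LinearMap.smul_apply, hc, cS,
        smul_zero, sub_zero]
    · simp only [LinearMap.sub_apply, LinearMap.comp_apply, LinearMap.smul_apply]
      rw [hcol (by simp [badColor]), hcol' (by simp [badColor]), smul_zero, sub_zero]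
    · simp only [LinearMap.sub_apply, LinearMap.comp_apply, LinearMap.smul_apply]
      rw [hcol (by simp [badColor]), hcol' (by simp [badColor]), smul_zero, sub_zero]
    · intro j
      obtain rfl := hsub i j
      simp only [LinearMap.sub_apply, LinearMap.comp_apply, LinearMap.smul_apply, hs, hself,
        smul_eq_mul, mul_one, sub_self]
    · intro i
      simp only [LinearMap.sub_apply, LinearMap.comp_apply, LinearMap.smul_apply]
      rw [hcol (by simp [badColor]), hcol' (by simp [badColor]), smul_zero, sub_zero]
    · intro i
      simp only [LinearMap.sub_apply, LinearMap.comp_apply, LinearMap.smul_apply]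
      rw [hcol (by simp [badColor]), hcol' (by simp [badColor]), smul_zero, sub_zero]
  refine ⟨p, q, s, ⟨fP0, fP1, fQ0, fQ1, fS⟩, ?_⟩
  have wP2 : X (b (.inl 2)) = p • b (.inl 2) := by
    rw [← sub_eq_zero]
    apply h.vector_eq_zero
    · rw [map_sub, map_smul, ← hc, h.P2, map_zero, smul_zero, sub_zero]
    · rw [map_sub, map_smul, ← h.P1, hc, p2, p2, ← h.P0, hc, p1, p1, fP0', sub_self]
    · rw [map_sub, map_smul, hcol (by simp [badColor]), hcol' (by simp [badColor]), smul_zero,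
        sub_zero]
    · intro i
      rw [map_sub, map_smul, hcol (by simp [badColor]), hcol' (by simp [badColor]), smul_zero,
        sub_zero]
    · intro i
      rw [map_sub, map_smul, ← h.P1, hc, cA, cA, smul_zero, sub_zero]
    · intro i
      rw [map_sub, map_smul, hcol (by simp [badColor]), hcol' (by simp [badColor]), smul_zero,
        sub_zero]
  have wP1 : X (b (.inl 1)) = p • b (.inl 1) := by
    rw [← sub_eq_zero]
    apply h.vector_eq_zero
    · rw [map_sub, map_smul, ← hc, h.P1, wP2, sub_self]
    · rw [map_sub, map_smul, hcol (by simp [badColor]), hcol' (by simp [badColor]), smul_zero,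
        sub_zero]
    · rw [map_sub, map_smul, hcol (by simp [badColor]), hcol' (by simp [badColor]), smul_zero,
        sub_zero]
    · intro i
      rw [map_sub, map_smul, ← h.P0, hc, cS, cS, smul_zero, sub_zero]
    · intro i
      rw [map_sub, map_smul, hcol (by simp [badColor]), hcol' (by simp [badColor]), smul_zero,
        sub_zero]
    · intro i
      rw [map_sub, map_smul, hcol (by simp [badColor]), hcol' (by simp [badColor]), smul_zero,
        sub_zero]
  have wQ4 : X (b (.inr (.inl 4))) = q • b (.inr (.inl 4)) := by
    rw [← sub_eq_zero]
    apply h.vector_eq_zero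
    · rw [map_sub, map_smul, ← hc, h.Q4, map_zero, smul_zero, sub_zero]
    · rw [map_sub, map_smul, hcol (by simp [badColor]), hcol' (by simp [badColor]), smul_zero,
        sub_zero]
    · rw [map_sub, map_smul, ← h.Q3, hc, q4, q4, ← h.Q2, hc, q3, q3, ← h.Q1, hc, q2, q2, fQ1',
        sub_self]
    · intro i
      rw [map_sub, map_smul, hcol (by simp [badColor]), hcol' (by simp [badColor]), smul_zero,
        sub_zero]
    · intro i
      rw [map_sub, map_smul, hcol (by simp [badColor]), hcol' (by simp [badColor]), smul_zero,
        sub_zero]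
    · intro i
      rw [map_sub, map_smul, ← h.Q3, hc, cC, cC, smul_zero, sub_zero]
  refine ⟨wP2, wP1, wQ4, ?_, fun i => ?_⟩
  · rw [← sub_eq_zero]
    apply h.vector_eq_zero
    · rw [map_sub, map_smul, ← hc, h.Q3, wQ4, sub_self]
    · rw [map_sub, map_smul, ← h.Q2, hc, p2, ← h.Q1, hc, p1, ← h.Q0, hc, p0, p2, p1, p0,
        smul_zero, sub_zero]
    · rw [map_sub, map_smul, hcol (by simp [badColor]), hcol' (by simp [badColor]), smul_zero,
        sub_zero]
    · intro i
      rw [map_sub, map_smul, hcol (by simp [badColor]), hcol' (by simp [badColor]), smul_zero,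
        sub_zero]
    · intro i
      rw [map_sub, map_smul, ← h.Q2, hc, cA, cA, smul_zero, sub_zero]
    · intro i
      rw [map_sub, map_smul, hcol (by simp [badColor]), hcol' (by simp [badColor]), smul_zero,
        sub_zero]
  · rw [← sub_eq_zero]
    apply h.vector_eq_zero
    · rw [map_sub, map_smul, ← hc, h.S, map_zero, smul_zero, sub_zero]
    · rw [map_sub, map_smul, hcol (by simp [badColor]), hcol' (by simp [badColor]), smul_zero,
        sub_zero]
    · rw [map_sub, map_smul, hcol (by simp [badColor]), hcol' (by simp [badColor]), smul_zero,
        sub_zero]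
    · intro j
      obtain rfl := hsub i j
      rw [map_sub, map_smul, hs, hself, smul_eq_mul, mul_one, sub_self]
    · intro i
      rw [map_sub, map_smul, hcol (by simp [badColor]), hcol' (by simp [badColor]), smul_zero,
        sub_zero]
    · intro i
      rw [map_sub, map_smul, hcol (by simp [badColor]), hcol' (by simp [badColor]), smul_zero,
        sub_zero]

end IsBadEndo

/-- If the functionals `x ↦ tr (y i [x, η])` on the stabiliser of `v` all lie in a space of
dimension at most `|κ|`, then at most `|κ|` dimensions of the span of the `y i` are lost when
passing to the slice kernel at `η`. -/
theorem le_finrank_sliceKernel_of_weights [FiniteDimensional F 𝕍] {g v η : End F 𝕍} {ζ : F}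
    {ι κ : Type*} [Fintype ι] [Fintype κ] {y : ι → End F 𝕍} (hli : LinearIndependent F y)
    (hy : ∀ i, y i ∈ gradedPart g (ζ ^ 2)) (hyv : ∀ i, v * y i = y i * v) (a : κ → ι → F)
    (hw : ∀ x ∈ gradedPart g 1, x * v = v * x → ∃ c : κ → F, ∀ i,
      LinearMap.trace F 𝕍 (y i * (x * η - η * x)) =
        (∑ k, c k * a k i) * LinearMap.trace F 𝕍 (y i * η)) :
    Fintype.card ι ≤ finrank F (sliceKernel g ζ v η) + Fintype.card κ := by
  let T : (ι → F) →ₗ[F] (κ → F) := LinearMap.pi fun k =>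
    Fintype.linearCombination F fun i => a k i * LinearMap.trace F 𝕍 (y i * η)
  have hT : ∀ γ k, T γ k = ∑ i, γ i * (a k i * LinearMap.trace F 𝕍 (y i * η)) := fun γ k => by
    simp [T, Fintype.linearCombination_apply]
  have hΨ : Function.Injective (Fintype.linearCombination F y) :=
    hli.fintypeLinearCombination_injective
  have hmap : (LinearMap.ker T).map (Fintype.linearCombination F y) ≤ sliceKernel g ζ v η := by
    rintro _ ⟨γ, hγ, rfl⟩
    have hγ' : ∀ k, ∑ i, γ i * (a k i * LinearMap.trace F 𝕍 (y i * η)) = 0 := fun k => by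
      rw [← hT, LinearMap.mem_ker.1 hγ, Pi.zero_apply]
    rw [mem_sliceKernel, Fintype.linearCombination_apply]
    refine ⟨Submodule.sum_mem _ fun i _ => Submodule.smul_mem _ _ (hy i), ?_, fun x hx hxv => ?_⟩
    · simp_rw [Finset.mul_sum, Finset.sum_mul, mul_smul_comm, smul_mul_assoc, hyv]
    · obtain ⟨c, hc⟩ := hw x hx hxv
      simp_rw [Finset.sum_mul, smul_mul_assoc, map_sum, map_smul, hc, smul_eq_mul, Finset.sum_mul,
        Finset.mul_sum]
      rw [Finset.sum_comm]
      refine Finset.sum_eq_zero fun k _ => ?_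
      rw [← mul_zero (c k), ← hγ' k, Finset.mul_sum]
      exact Finset.sum_congr rfl fun i _ => by ring
  have h1 := T.finrank_range_add_finrank_ker
  have h2 := Submodule.finrank_mono hmap
  rw [(Submodule.equivMapOfInjective _ hΨ _).finrank_eq.symm] at h2
  have h3 := (LinearMap.range T).finrank_le
  rw [finrank_fintype_fun_eq_card] at h1 h3
  omega

namespace IsBadEndo

variable {z x y k : ℕ} {b : Basis (BadIndex z x y k) F 𝕍} {v : End F 𝕍}

/-- Elements of the centraliser of `v` in degree `2`. -/
noncomputable def slice (b : Basis (BadIndex z x y k) F 𝕍) (v : End F 𝕍) :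
    Fin 4 ⊕ Fin z ⊕ Fin z ⊕ Fin k → End F 𝕍 :=
  Sum.elim ![(b.coord (.inl 0)).smulRight (b (.inl 2)), v ^ 2,
      (b.coord (.inl 0)).smulRight (b (.inr (.inl 3))) +
        (b.coord (.inl 1)).smulRight (b (.inr (.inl 4))),
      (b.coord (.inr (.inl 0))).smulRight (b (.inl 1)) +
        (b.coord (.inr (.inl 1))).smulRight (b (.inl 2))]
    (Sum.elim (fun i => (b.coord (.inr (.inr (.inl i)))).smulRight (b (.inr (.inl 4))))
      (Sum.elim (fun i => (b.coord (.inr (.inl 0))).smulRight (b (.inr (.inr (.inl i)))))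
        fun j => v ^ (3 * ((j : ℕ) + 1) + 2)))

/-- The weights of the elements of `slice` under the torus part of the centraliser of `v` in
degree `0`. -/
def weight (F : Type*) [Field F] (z k : ℕ) :
    Option (Fin z) → Fin 4 ⊕ Fin z ⊕ Fin z ⊕ Fin k → F :=
  fun κ => κ.elim (Sum.elim ![0, 0, 1, -1] fun _ => 0) fun i =>
    Sum.elim (fun _ => 0) (Sum.elim (Pi.single i 1) (Sum.elim (Pi.single i (-1)) fun _ => 0))

theorem card_badColor (z x y k : ℕ) (c : Fin 3) :
    Fintype.card {i // badColor z x y k i = c} = ![3 + k + x, 3 + k + y, 2 + z + k] c := by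
  rw [Fintype.card_subtype, Finset.card_filter, Fintype.sum_sum_type, Fintype.sum_sum_type,
    Fintype.sum_sum_type, Fintype.sum_sum_type, Fintype.sum_sum_type, Fintype.sum_prod_type]
  simp only [badColor, Sum.elim_inl, Sum.elim_inr, Fin.sum_univ_three, Fin.sum_univ_five]
  fin_cases c
  · simp; omega
  · simp; omega
  · simp; omega

theorem slice_mem_gradedPart {g : End F 𝕍} {ζ : F} (hζ : ζ ^ 3 = 1)
    (hb : ∀ i, g (b i) = ζ ^ (badColor z x y k i : ℕ) • b i) (hv : v ∈ gradedPart g ζ) :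
    ∀ i, slice b v i ∈ gradedPart g (ζ ^ 2) := by
  have h4 : ζ ^ 2 * ζ ^ 2 = ζ := by linear_combination ζ * hζ
  rintro (i | i | i | i)
  · fin_cases i
    · exact coord_smulRight_mem_gradedPart b hb (by simp [badColor]; linear_combination - hζ)
    · exact pow_mem_gradedPart hv 2
    · refine add_mem ?_ ?_ <;> refine coord_smulRight_mem_gradedPart b hb ?_
      · simp [badColor]; linear_combination - hζ
      · simp [badColor, h4]
    · refine add_mem ?_ ?_ <;> refine coord_smulRight_mem_gradedPart b hb ?_
      · simp [badColor]
      · simp [badColor]; linear_combination - hζ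
  · exact coord_smulRight_mem_gradedPart b hb (by simp [badColor, h4])
  · exact coord_smulRight_mem_gradedPart b hb (by simp [badColor])
  · exact pow_mem_gradedPart_sq hζ hv _

theorem mul_slice (h : IsBadEndo b v) : ∀ i, v * slice b v i = slice b v i * v := by
  obtain ⟨p0, p1, p2, q0, q1, q2, q3, q4, cS, cA, cC, -, -, -⟩ := h.coord_apply
  have e : ∀ φ ψ : Dual F 𝕍, (∀ u, φ (v u) = ψ u) → φ ∘ₗ v = ψ := fun φ ψ h => LinearMap.ext h
  rintro (i | i | i | i)
  · fin_cases i
    · simp [slice, mul_smulRight, smulRight_mul, h.P2, e _ 0 p0]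
    · exact ((Commute.refl v).pow_right 2)
    · simp [slice, mul_add, add_mul, mul_smulRight, smulRight_mul, h.Q3, h.Q4, e _ 0 p0, e _ _ p1]
    · simp [slice, mul_add, add_mul, mul_smulRight, smulRight_mul, h.P1, h.P2, e _ 0 q0, e _ _ q1]
  · simp [slice, mul_smulRight, smulRight_mul, h.Q4, e _ 0 (cS i)]
  · simp [slice, mul_smulRight, smulRight_mul, h.S, e _ 0 q0]
  · exact ((Commute.refl v).pow_right _)

theorem linearIndependent_slice [CharZero F] (h : IsBadEndo b v) :
    LinearIndependent F (slice b v) := by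
  obtain ⟨p0, p1, p2, q0, q1, q2, q3, q4, cS, cA, cC, -, -, -⟩ := h.coord_apply
  rw [Fintype.linearIndependent_iff]
  intro γ hγ
  have hne : ∀ {i j : BadIndex z x y k}, j ≠ i → b.repr (b i) j = 0 := fun {i j} hij => by
    rw [Basis.repr_self, Finsupp.single_eq_of_ne hij]
  have hP : ∀ n, (v ^ (n + 3)) (b (.inl 0)) = 0 := fun n => by
    rw [pow_add, Module.End.mul_apply, pow_succ, pow_two]; simp [h.P0, h.P1, h.P2]
  have hQ : ∀ n, (v ^ (n + 5)) (b (.inr (.inl 0))) = 0 := fun n => by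
    rw [pow_add, Module.End.mul_apply, pow_succ, pow_succ, pow_succ, pow_two]
    simp [h.Q0, h.Q1, h.Q2, h.Q3, h.Q4]
  have hS : ∀ n i, (v ^ (n + 1)) (b (.inr (.inr (.inl i)))) = 0 := fun n i => by
    rw [pow_add, Module.End.mul_apply, pow_one, h.S, map_zero]
  have hval : ∀ (j : BadIndex z x y k) u, ∑ i, γ i * b.coord j (slice b v i u) = 0 := fun j u => by
    have := congrArg (b.coord j) (LinearMap.congr_fun hγ u)
    simpa using this
  have hP' : ∀ j : Fin k, (v ^ (3 * ((j : ℕ) + 1) + 2)) (b (.inl 0)) = 0 := fun j => by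
    rw [show 3 * ((j : ℕ) + 1) + 2 = 3 * j + 2 + 3 by ring, hP]
  have hQ' : ∀ j : Fin k, (v ^ (3 * ((j : ℕ) + 1) + 2)) (b (.inr (.inl 0))) = 0 := fun j => by
    rw [show 3 * ((j : ℕ) + 1) + 2 = 3 * j + 5 by ring, hQ]
  have hS' : ∀ (j : Fin k) i, (v ^ (3 * ((j : ℕ) + 1) + 2)) (b (.inr (.inr (.inl i)))) = 0 :=
    fun j i => by
    rw [show 3 * ((j : ℕ) + 1) + 2 = 3 * j + 4 + 1 by ring, hS]
  have g1 : γ (.inl 1) = 0 := by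
    have := hval (.inr (.inl 2)) (b (.inr (.inl 0)))
    simpa [slice, Fintype.sum_sum_type, Fin.sum_univ_four, hQ', pow_two, h.Q0, h.Q1,
      Finsupp.single_apply] using this
  have g3 : γ (.inl 3) = 0 := by
    have := hval (.inl 1) (b (.inr (.inl 0)))
    simpa [slice, Fintype.sum_sum_type, Fin.sum_univ_four, hQ', pow_two, h.Q0, h.Q1,
      Finsupp.single_apply] using this
  have g0 : γ (.inl 0) = 0 := by
    have := hval (.inl 2) (b (.inl 0))
    simpa [slice, Fintype.sum_sum_type, Fin.sum_univ_four, hP', pow_two, h.P0, h.P1, g1,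
      Finsupp.single_apply] using this
  have g2 : γ (.inl 2) = 0 := by
    have := hval (.inr (.inl 3)) (b (.inl 0))
    simpa [slice, Fintype.sum_sum_type, Fin.sum_univ_four, hP', pow_two, h.P0, h.P1, g1,
      Finsupp.single_apply] using this
  have hsa : ∀ i j, b.coord j (b i) = if i = j then 1 else 0 := fun i j => by
    rw [Basis.coord_apply, Basis.repr_self, Finsupp.single_apply]
  have gS : ∀ i, γ (.inr (.inl i)) = 0 := fun i => by
    have := hval (.inr (.inl 4)) (b (.inr (.inr (.inl i))))
    simp only [slice, Fintype.sum_sum_type, Sum.elim_inl, Sum.elim_inr, LinearMap.smulRight_apply,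
      map_smul, smul_eq_mul, hsa] at this
    simpa [Fin.sum_univ_four, hS', pow_two, h.S, Finsupp.single_apply] using this
  have gT : ∀ i, γ (.inr (.inr (.inl i))) = 0 := fun i => by
    have := hval (.inr (.inr (.inl i))) (b (.inr (.inl 0)))
    simpa [slice, Fintype.sum_sum_type, Fin.sum_univ_four, hQ', pow_two, h.Q0, h.Q1,
      Finsupp.single_apply] using this
  have gE : (fun i => γ (.inr (.inr (.inr i)))) = 0 := by
    refine eq_zero_of_sum_mul_pow_eq_zero fun i => ?_
    have := hval (.inr (.inr (.inr (.inr (.inr (i, 2))))))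
      (b (.inr (.inr (.inr (.inr (.inr (i, 0)))))))
    simp only [slice, Fintype.sum_sum_type, Fin.sum_univ_four, g0, g1, g2, g3, gS, gT, zero_mul,
      add_zero, zero_add, Finset.sum_const_zero, Sum.elim_inr] at this
    have hE : ∀ j : Fin k, γ (.inr (.inr (.inr j))) * b.coord (.inr (.inr (.inr (.inr (.inr (i, 2))))))
        ((v ^ (3 * ((j : ℕ) + 1) + 2)) (b (.inr (.inr (.inr (.inr (.inr (i, 0)))))))) =
        γ (.inr (.inr (.inr j))) * ((i : ℕ) + 1 : F) ^ (j : ℕ) * ((i : ℕ) + 1 : F) := fun j => by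
      rw [pow_apply_cycle (h.E0 i) (h.E1 i) (h.E2 i), map_smul, Basis.coord_apply, Basis.repr_self,
        Finsupp.single_eq_same, smul_eq_mul, mul_one, pow_succ, mul_assoc]
    rw [Finset.sum_congr rfl fun j _ => hE j, ← Finset.sum_mul] at this
    exact (mul_eq_zero.1 this).resolve_right (Nat.cast_add_one_ne_zero _)
  rintro (i | i | i | i)
  · fin_cases i
    exacts [g0, g1, g2, g3]
  exacts [gS i, gT i, congrFun gE i]

/-- The family `slice` has `4 + 2 z + k` members and the weights span a space of dimension at most
`1 + z`. -/
theorem le_finrank_sliceKernel [FiniteDimensional F 𝕍] [CharZero F] (h : IsBadEndo b v)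
    (hz : z ≤ 1) {g : End F 𝕍} {ζ : F} (hζ : IsPrimitiveRoot ζ 3)
    (hb : ∀ i, g (b i) = ζ ^ (badColor z x y k i : ℕ) • b i) (hv : v ∈ gradedPart g ζ)
    (η : End F 𝕍) : 3 + z + k ≤ finrank F (sliceKernel g ζ v η) := by
  have key := le_finrank_sliceKernel_of_weights (η := η) h.linearIndependent_slice
    (slice_mem_gradedPart hζ.pow_eq_one hb hv) h.mul_slice (weight F z k) fun X hX hXv => by
    obtain ⟨p, q, s, ⟨fP0, fP1, fQ0, fQ1, fS⟩, wP2, wP1, wQ4, wQ3, wS⟩ :=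
      h.centralizer_scalars hz hζ hb hX hXv
    refine ⟨fun κ => κ.elim (p - q) fun i => s i - q, ?_⟩
    have hpow : ∀ n, LinearMap.trace F 𝕍 (v ^ n * (X * η - η * X)) = 0 := fun n => by
      have hc : X * v ^ n = v ^ n * X := (Commute.pow_right (show Commute X v from hXv) n)
      rw [mul_sub, map_sub, ← mul_assoc, ← mul_assoc (v ^ n) η X, LinearMap.trace_mul_comm F _ X,
        ← mul_assoc, hc, sub_self]
    rintro (i | i | i | i)
    · fin_cases i
      · rw [trace_mul_lie_of_scalars (p := p) (q := p)]
        · simp [weight]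
        · simp [slice, mul_smulRight, wP2]; ext; simp [smul_comm p]
        · simp [slice, smulRight_mul, fP0]; ext; simp [mul_smul]
      · simp [slice, weight, hpow]
      · rw [trace_mul_lie_of_scalars (p := q) (q := p)]
        · simp [weight]
        · simp [slice, mul_add, mul_smulRight, wQ3, wQ4]; ext; simp [smul_comm q]
        · simp [slice, add_mul, smulRight_mul, fP0, fP1]; ext; simp [mul_smul]
      · rw [trace_mul_lie_of_scalars (p := p) (q := q)]
        · simp [weight]
        · simp [slice, mul_add, mul_smulRight, wP1, wP2]; ext; simp [smul_comm p]
        · simp [slice, add_mul, smulRight_mul, fQ0, fQ1]; ext; simp [mul_smul]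
    · rw [trace_mul_lie_of_scalars (p := q) (q := s i)]
      · simp [weight, Pi.single_apply]
      · simp [slice, mul_smulRight, wQ4]; ext; simp [smul_comm q]
      · simp [slice, smulRight_mul, fS]; ext; simp [mul_smul]
    · rw [trace_mul_lie_of_scalars (p := s i) (q := q)]
      · simp [weight, Pi.single_apply]
      · simp [slice, mul_smulRight, wS]; ext; simp [smul_comm (s i)]
      · simp [slice, smulRight_mul, fQ0]; ext; simp [mul_smul]
    · simp [slice, weight, hpow]
  simp only [Fintype.card_sum, Fintype.card_fin, Fintype.card_option] at key
  omega

end IsBadEndo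

/-- If all eigenspaces of `g` have dimension at least `2` and two of them dimension at least `3`,
there is a point of `𝔤₁` all of whose slice kernels are too large. -/
theorem exists_large_sliceKernel [FiniteDimensional F 𝕍] [CharZero F] {g : End F 𝕍}
    (hg : g ^ 3 = 1) {ζ : F} (hζ : IsPrimitiveRoot ζ 3) (h0 : 3 ≤ eigenDim g ζ 0)
    (h1 : 3 ≤ eigenDim g ζ 1) (h2 : 2 ≤ eigenDim g ζ 2) (h02 : eigenDim g ζ 2 ≤ eigenDim g ζ 0)
    (h12 : eigenDim g ζ 2 ≤ eigenDim g ζ 1) :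
    ∃ v ∈ gradedPart g ζ, ∀ η, eigenDim g ζ 2 + 1 ≤ finrank F (sliceKernel g ζ v η) := by
  obtain ⟨z, k, hz, hzk, hx, hy⟩ : ∃ z k, z ≤ 1 ∧ eigenDim g ζ 2 = 2 + z + k ∧
      3 + k ≤ eigenDim g ζ 0 ∧ 3 + k ≤ eigenDim g ζ 1 := by
    by_cases h : 3 ≤ eigenDim g ζ 2
    · exact ⟨1, eigenDim g ζ 2 - 3, le_rfl, by omega, by omega, by omega⟩
    · exact ⟨0, 0, by omega, by omega, by omega, by omega⟩
  obtain ⟨x, hx⟩ := Nat.exists_eq_add_of_le hx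
  obtain ⟨y, hy⟩ := Nat.exists_eq_add_of_le hy
  obtain ⟨b, hb⟩ := exists_basis_of_coloring hg (by norm_num) hζ (badColor z x y k) fun c => by
    rw [IsBadEndo.card_badColor]
    fin_cases c
    exacts [hx.symm, hy.symm, hzk.symm]
  obtain ⟨v, hv, hbad⟩ := exists_isBadEndo b hζ.pow_eq_one hb
  refine ⟨v, hv, fun η => ?_⟩
  have := hbad.le_finrank_sliceKernel hz hζ hb hv η
  omega

end Counterexample

/-! ### Slices for the cyclic quiver with a one-dimensional vertex -/

section CyclicQuiver

variable {F X Y Z : Type*} [Field F] [AddCommGroup X] [Module F X] [AddCommGroup Y] [Module F Y]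
  [AddCommGroup Z] [Module F Z]

/-- An embedding of the kernel of `A` into a complement of its image exists as `dim X ≤ dim Y`. -/
theorem exists_injOn_ker_isCompl_range [FiniteDimensional F X] [FiniteDimensional F Y]
    (h : finrank F X ≤ finrank F Y) (A : X →ₗ[F] Y) :
    ∃ W : Submodule F Y, IsCompl W (LinearMap.range A) ∧ ∃ B : X →ₗ[F] Y,
      (∀ x, B x ∈ W) ∧ ∀ x, A x = 0 → B x = 0 → x = 0 := by
  obtain ⟨W, hW⟩ := (LinearMap.range A).exists_isCompl
  have hd : finrank F (LinearMap.ker A) ≤ finrank F W := by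
    have h1 := A.finrank_range_add_finrank_ker
    have h2 := Submodule.finrank_add_eq_of_isCompl hW
    omega
  obtain ⟨j, hj⟩ := finrank_le_iff_exists_linearMap.1 hd
  obtain ⟨r, hr⟩ := (LinearMap.ker A).subtype.exists_leftInverse_of_injective
    (LinearMap.ker_eq_bot.2 Subtype.val_injective)
  refine ⟨W, hW.symm, W.subtype ∘ₗ j ∘ₗ r, fun x => (j (r x)).2, fun x hx hBx => ?_⟩
  have h1 : r x = ⟨x, hx⟩ := LinearMap.congr_fun hr ⟨x, hx⟩
  have h2 : j (r x) = 0 := Subtype.ext hBx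
  rw [h1, map_eq_zero_iff j hj] at h2
  exact congrArg Subtype.val h2

/-- A linear map `B` which embeds the kernel of `A` into a complement of its image; if possible, a
given functional does not vanish on the image of `A` and of its kernel under `B`. -/
theorem exists_transversal [FiniteDimensional F X] [FiniteDimensional F Y]
    (h : finrank F X ≤ finrank F Y) (A : X →ₗ[F] Y) (φ : Dual F Y) (hφ : φ ≠ 0) :
    ∃ B : X →ₗ[F] Y, (∀ x, B x ∈ LinearMap.range A → B x = 0) ∧
      (∀ x, A x = 0 → B x = 0 → x = 0) ∧
      ((∀ x, φ (A x) = 0) → LinearMap.ker A ≠ ⊥ → ∃ k, A k = 0 ∧ φ (B k) = 1) := by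
  obtain ⟨W, hW, B, hBW, hB⟩ := exists_injOn_ker_isCompl_range h A
  have hWI : ∀ w ∈ W, w ∈ LinearMap.range A → w = 0 := fun w h1 h2 =>
    Submodule.disjoint_def.1 hW.disjoint w h1 h2
  by_cases hk : ∃ k, A k = 0 ∧ φ (B k) ≠ 0
  · obtain ⟨k, hk, hφk⟩ := hk
    exact ⟨B, fun x => hWI _ (hBW x), hB, fun _ _ =>
      ⟨(φ (B k))⁻¹ • k, by rw [map_smul, hk, smul_zero], by simp [hφk]⟩⟩
  push Not at hk
  by_cases hφA : ∀ x, φ (A x) = 0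
  swap
  · exact ⟨B, fun x => hWI _ (hBW x), hB, fun h => absurd h hφA⟩
  by_cases hK : LinearMap.ker A = ⊥
  · exact ⟨B, fun x => hWI _ (hBW x), hB, fun _ h => absurd hK h⟩
  -- Here `φ` vanishes on the image of `A` and on `B (ker A)`, and `B` has to be modified.
  obtain ⟨k, hk0, hkne⟩ := (Submodule.ne_bot_iff _).1 hK
  obtain ⟨l, hl⟩ := Projective.exists_dual_eq_one F hkne
  obtain ⟨w, hwW, hw⟩ : ∃ w ∈ W, φ w ≠ 0 := by
    by_contra! hW0
    refine hφ (LinearMap.ext fun y => ?_)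
    obtain ⟨w, hw, _, ⟨x, rfl⟩, rfl⟩ := Submodule.mem_sup.1
      (hW.sup_eq_top ▸ Submodule.mem_top : y ∈ W ⊔ LinearMap.range A)
    rw [map_add, hW0 w hw, hφA, add_zero, LinearMap.zero_apply]
  refine ⟨B + l.smulRight ((φ w)⁻¹ • w), fun x => hWI _ ?_, fun x hx hBx => ?_, fun _ _ =>
    ⟨k, hk0, ?_⟩⟩
  · exact W.add_mem (hBW x) (W.smul_mem _ (W.smul_mem _ hwW))
  · have h1 : l x = 0 := by
      have := congrArg φ hBx
      simpa [hk x hx, hw] using this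
    refine hB x hx ?_
    simpa [h1] using hBx
  · simp [hk k hk0, hl, hw]

/-- The equations satisfied by an element `(y, f, q)` of the slice kernel at `(B, ψ, u)` of the point
`(A, φ, p)`, where `A : X → Y`, `φ : Y → F`, `p : F → X` and `y : Y → X`, `f : X → F`, `q : F → Y`:
it commutes with `(A, φ, p)`, also to first order along `(B, ψ, u)`. -/
structure IsSliceSolution (A : X →ₗ[F] Y) (φ : Dual F Y) (p : X) (B : X →ₗ[F] Y) (ψ : Dual F Y)
    (u : X) (y : Y →ₗ[F] X) (f : Dual F X) (q : Y) (y' : Y →ₗ[F] X) (f' : Dual F X) (q' : Y) :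
    Prop where
  c1 : ∀ x, y (A x) = f x • p
  c2 : ∀ w, A (y w) = φ w • q
  c3 : φ q = f p
  d1 : ∀ x, y (B x) + y' (A x) = f x • u + f' x • p
  d2 : ∀ w, ψ w • q + φ w • q' = B (y w) + A (y' w)
  d3 : f u + f' p = ψ q + φ q'

/-- The slice kernel of `(A, φ, p)` at some `(B, ψ, u)` is at most one-dimensional. -/
def HasGoodSlice (A : X →ₗ[F] Y) (φ : Dual F Y) (p : X) : Prop :=
  ∃ (B : X →ₗ[F] Y) (ψ : Dual F Y) (u : X) (y₀ : Y →ₗ[F] X) (f₀ : Dual F X) (q₀ : Y),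
    ∀ y f q y' f' q', IsSliceSolution A φ p B ψ u y f q y' f' q' →
      ∃ c : F, y = c • y₀ ∧ f = c • f₀ ∧ q = c • q₀

variable [FiniteDimensional F X] [FiniteDimensional F Y]

/-- A linear map which vanishes on the kernel of a functional `φ` has rank at most one. -/
theorem eq_smulRight_of_ker {φ : Dual F Y} {y : Y →ₗ[F] X} {w₀ : Y} (hw₀ : φ w₀ = 1)
    (h : ∀ w, φ w = 0 → y w = 0) (w : Y) : y w = φ w • y w₀ := by
  have := h (w - φ w • w₀) (by simp [hw₀])
  rwa [map_sub, map_smul, sub_eq_zero] at this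

theorem exists_apply_comp_eq_one {A : X →ₗ[F] Y} (h : A ≠ 0) :
    ∃ (ψ : Dual F Y) (x : X), ψ (A x) = 1 := by
  obtain ⟨x, hx⟩ : ∃ x, A x ≠ 0 := by
    by_contra! h'
    exact h (LinearMap.ext h')
  obtain ⟨ψ, hψ⟩ := Projective.exists_dual_eq_one F hx
  exact ⟨ψ, x, hψ⟩

/-- The direction only has a component along `A`, unless `A` is injective with image in the kernel of
`φ`. -/
theorem hasGoodSlice_of_ne_of_ne (h : finrank F X ≤ finrank F Y) (A : X →ₗ[F] Y) {φ : Dual F Y}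
    {p : X} (hφ : φ ≠ 0) (hp : p ≠ 0) : HasGoodSlice A φ p := by
  obtain ⟨w₀, hw₀⟩ : ∃ w₀, φ w₀ = 1 := by
    obtain ⟨w, hw⟩ : ∃ w, φ w ≠ 0 := by
      by_contra! h'
      exact hφ (LinearMap.ext h')
    exact ⟨(φ w)⁻¹ • w, by simp [hw]⟩
  by_cases hc : (∀ x, φ (A x) = 0) ∧ LinearMap.ker A = ⊥
  · obtain ⟨hφA, hK⟩ := hc
    have hA : ∀ x, A x = 0 → x = 0 := fun x hx => LinearMap.ker_eq_bot'.1 hK x hx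
    obtain ⟨ψ, x, hψ⟩ := exists_apply_comp_eq_one (A := A) fun hA0 => hp (hA p (by simp [hA0]))
    refine ⟨0, ψ, 0, φ.smulRight p, 0, A p, fun y f q y' f' q' hs => ?_⟩
    have hy := eq_smulRight_of_ker hw₀ (y := y) fun w hw => hA _ (by rw [hs.c2, hw, zero_smul])
    have hf : f = 0 := LinearMap.ext fun z => by
      have := hs.c1 z
      rw [hy, hφA, zero_smul, eq_comm, smul_eq_zero] at this
      exact this.resolve_right hp
    have hq : q = A (y w₀) := by rw [hs.c2, hw₀, one_smul]
    have h1 : y w₀ = f' x • p := by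
      have h2 := hs.d2 (A x)
      have h3 := hs.d1 x
      rw [LinearMap.zero_apply, map_zero, zero_add, smul_zero, zero_add] at h3
      rw [hψ, hφA, h3, LinearMap.zero_apply, zero_smul, add_zero, zero_add, one_smul, hq,
        ← sub_eq_zero, ← map_sub] at h2
      exact sub_eq_zero.1 (hA _ h2)
    refine ⟨f' x, LinearMap.ext fun w => ?_, by rw [hf, smul_zero], by rw [hq, h1, map_smul]⟩
    rw [hy, h1, LinearMap.smul_apply, LinearMap.smulRight_apply, smul_comm]
  · obtain ⟨B, hBI, hBK, hB⟩ := exists_transversal h A φ hφ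
    refine ⟨B, 0, 0, φ.smulRight p, φ ∘ₗ A, A p, fun y f q y' f' q' hs => ?_⟩
    have hy := eq_smulRight_of_ker hw₀ (y := y) fun w hw => by
      refine hBK _ (by rw [hs.c2, hw, zero_smul]) (hBI _ ⟨- y' w, ?_⟩)
      have := hs.d2 w
      rw [hw, zero_smul, LinearMap.zero_apply, zero_smul, add_zero, eq_comm,
        add_eq_zero_iff_eq_neg] at this
      rw [this, map_neg]
    obtain ⟨c, hc⟩ : ∃ c, y w₀ = c • p := by
      by_cases hφA : ∀ x, φ (A x) = 0
      · obtain ⟨k, hk, hφk⟩ := hB hφA fun h' => hc ⟨hφA, h'⟩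
        have := hs.d1 k
        rw [hy, hφk, one_smul, hk, map_zero, add_zero, smul_zero, zero_add] at this
        exact ⟨_, this⟩
      · push Not at hφA
        obtain ⟨x, hx⟩ := hφA
        have := hs.c1 x
        rw [hy] at this
        exact ⟨(φ (A x))⁻¹ * f x, by rw [mul_smul, ← this, inv_smul_smul₀ hx]⟩
    refine ⟨c, LinearMap.ext fun w => ?_, LinearMap.ext fun z => ?_, ?_⟩
    · rw [hy, hc, LinearMap.smul_apply, LinearMap.smulRight_apply, smul_comm]
    · have := hs.c1 z
      rw [hy, hc, smul_smul] at this
      rw [← smul_left_injective F hp this, LinearMap.smul_apply, LinearMap.comp_apply, smul_eq_mul,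
        mul_comm]
    · have := hs.c2 w₀
      rw [hw₀, one_smul, hc, map_smul] at this
      exact this.symm

/-- If `φ w = ψ w = 0`, then `y w ∈ ker A` and `B (y w) ∈ im A`, where `B` is transversal to `A`. -/
theorem IsSliceSolution.apply_eq_zero {A B : X →ₗ[F] Y} {φ ψ : Dual F Y} {p u : X}
    (hBI : ∀ x, B x ∈ LinearMap.range A → B x = 0) (hBK : ∀ x, A x = 0 → B x = 0 → x = 0)
    {y f q y' f' q'} (hs : IsSliceSolution A φ p B ψ u y f q y' f' q') {w : Y} (hφ : φ w = 0)
    (hψ : ψ w = 0) : y w = 0 := by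
  refine hBK _ (by rw [hs.c2, hφ, zero_smul]) (hBI _ ⟨- y' w, ?_⟩)
  have := hs.d2 w
  rw [hφ, zero_smul, hψ, zero_smul, add_zero, eq_comm, add_eq_zero_iff_eq_neg] at this
  rw [this, map_neg]

theorem hasGoodSlice_of_zero_left [Nontrivial X] (h : finrank F X ≤ finrank F Y) (A : X →ₗ[F] Y)
    {p : X} (hp : p ≠ 0) : HasGoodSlice A 0 p := by
  have : Nontrivial Y := finrank_pos_iff.1 (lt_of_lt_of_le finrank_pos h)
  obtain ⟨w₁, hw₁⟩ := exists_ne (0 : Y)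
  obtain ⟨φ₁, hφ₁⟩ := Projective.exists_dual_eq_one F hw₁
  obtain ⟨B, hBI, hBK, -⟩ := exists_transversal h A φ₁ fun h0 => by simp [h0] at hφ₁
  have key : ∀ {ψ y f q y' f' q'}, IsSliceSolution A 0 p B ψ 0 y f q y' f' q' →
      ∀ {w₀}, ψ w₀ = 1 → (∀ w, y w = ψ w • y w₀) ∧ q = B (y w₀) + A (y' w₀) ∧ f p = 0 ∧
      (∀ w, A (y w) = 0) ∧ ∀ x, y (B x) + y' (A x) = f' x • p := fun hs w₀ hw₀ => by
    have h2 := hs.d2 w₀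
    have h1 := hs.d1
    simp only [LinearMap.zero_apply, zero_smul, add_zero, hw₀, one_smul] at h2
    simp only [smul_zero, zero_add] at h1
    exact ⟨eq_smulRight_of_ker hw₀ fun w hw => hs.apply_eq_zero hBI hBK rfl hw, h2,
      by rw [← hs.c3, LinearMap.zero_apply],
      fun w => by rw [hs.c2 w, LinearMap.zero_apply, zero_smul], h1⟩
  -- The functional `ψ` is chosen so that the slice kernel is spanned by an explicit element.
  by_cases hAp : A p = 0
  · by_cases hA : A = 0
    · obtain ⟨ψ, hψ⟩ := Projective.exists_dual_eq_one F fun h' => hp (hBK p hAp h')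
      refine ⟨B, ψ, 0, ψ.smulRight p, 0, B p, fun y f q y' f' q' hs => ?_⟩
      obtain ⟨hy, hq, hf, hAy, h1⟩ := key hs hψ
      have h2 := h1 p
      rw [hA, LinearMap.zero_apply, map_zero, add_zero] at h2
      refine ⟨f' p, LinearMap.ext fun w => ?_, LinearMap.ext fun z => ?_, ?_⟩
      · rw [hy, h2, LinearMap.smul_apply, LinearMap.smulRight_apply, smul_comm]
      · have h3 := hs.c1 z
        rw [hA, LinearMap.zero_apply, map_zero, eq_comm, smul_eq_zero] at h3
        rw [h3.resolve_right hp, smul_zero, LinearMap.zero_apply]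
      · rw [hq, hA, LinearMap.zero_apply, add_zero, h2, map_smul]
    · obtain ⟨ψ, x, hψ⟩ := exists_apply_comp_eq_one hA
      refine ⟨B, ψ, 0, ψ.smulRight p, ψ ∘ₗ A, B p, fun y f q y' f' q' hs => ?_⟩
      obtain ⟨hy, hq, hf, hAy, h1⟩ := key hs hψ
      have h2 := hs.c1 x
      refine ⟨f x, LinearMap.ext fun w => ?_, LinearMap.ext fun z => ?_, ?_⟩
      · rw [hy, h2, LinearMap.smul_apply, LinearMap.smulRight_apply, smul_comm]
      · have h3 := hs.c1 z
        rw [hy, h2, smul_smul] at h3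
        rw [← smul_left_injective F hp h3, LinearMap.smul_apply, LinearMap.comp_apply, smul_eq_mul,
          mul_comm]
      · have h3 := congrArg A (h1 x)
        rw [map_add, hAy, zero_add, map_smul, hAp, smul_zero] at h3
        rw [hq, h3, add_zero, h2, map_smul]
  · obtain ⟨ψ, hψ⟩ := Projective.exists_dual_eq_one F hAp
    refine ⟨B, ψ, 0, 0, 0, A p, fun y f q y' f' q' hs => ?_⟩
    obtain ⟨hy, hq, hf, hAy, h1⟩ := key hs hψ
    have h2 := hs.c1 p
    rw [hf, zero_smul] at h2
    have hy0 : y = 0 := LinearMap.ext fun w => by rw [hy, h2, smul_zero, LinearMap.zero_apply]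
    refine ⟨f' p, by rw [hy0, smul_zero], LinearMap.ext fun z => ?_, ?_⟩
    · have h3 := hs.c1 z
      rw [hy0, LinearMap.zero_apply, eq_comm, smul_eq_zero] at h3
      rw [h3.resolve_right hp, smul_zero, LinearMap.zero_apply]
    · have h3 := h1 p
      rw [hy0, LinearMap.zero_apply, zero_add] at h3
      rw [hq, h2, map_zero, zero_add, h3, map_smul]

theorem hasGoodSlice_of_zero_right [Nontrivial X] (h : finrank F X ≤ finrank F Y) (A : X →ₗ[F] Y)
    {φ : Dual F Y} (hφ : φ ≠ 0) : HasGoodSlice A φ 0 := by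
  obtain ⟨B, hBI, hBK, hB⟩ := exists_transversal h A φ hφ
  obtain ⟨u₁, hu₁⟩ := exists_ne (0 : X)
  have hA0 : ∀ {y f q y' f' q' ψ u}, IsSliceSolution A φ 0 B ψ u y f q y' f' q' →
      ∀ x, y (A x) = 0 := fun hs x => by rw [hs.c1, smul_zero]
  by_cases hφA : ∀ x, φ (A x) = 0
  swap
  · push Not at hφA
    obtain ⟨x₁, hx₁⟩ := hφA
    obtain ⟨x, hx⟩ : ∃ x, φ (A x) = 1 := ⟨(φ (A x₁))⁻¹ • x₁, by simp [hx₁]⟩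
    have hAx : A x ≠ 0 := fun h0 => by simp [h0] at hx
    refine ⟨B, 0, x, 0, φ ∘ₗ A, 0, fun y f q y' f' q' hs => ?_⟩
    have hy : y = 0 := LinearMap.ext fun w => by
      rw [eq_smulRight_of_ker hx (fun w hw => hs.apply_eq_zero hBI hBK hw rfl), hA0 hs, smul_zero,
        LinearMap.zero_apply]
    have hq : q = 0 := by
      have := hs.c2 (A x)
      rwa [hx, one_smul, hy, LinearMap.zero_apply, map_zero, eq_comm] at this
    have h1 : ∀ z, f z • A x = φ (A z) • q' := fun z => by
      have h2 := congrArg A (hs.d1 z)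
      have h3 := hs.d2 (A z)
      rw [hA0 hs, hq, smul_zero, zero_add, map_zero, zero_add] at h3
      rwa [hy, LinearMap.zero_apply, zero_add, smul_zero, add_zero, ← h3, map_smul, eq_comm] at h2
    refine ⟨f x, by rw [hy, smul_zero], LinearMap.ext fun z => ?_, by rw [hq, smul_zero]⟩
    have h2 := h1 x
    rw [hx, one_smul] at h2
    have h3 := h1 z
    rw [← h2, smul_smul] at h3
    rw [smul_left_injective F hAx h3, LinearMap.smul_apply, LinearMap.comp_apply, smul_eq_mul,
      mul_comm]
  by_cases hK : LinearMap.ker A = ⊥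
  · have hA : ∀ x, A x = 0 → x = 0 := fun x hx => LinearMap.ker_eq_bot'.1 hK x hx
    obtain ⟨ψ, x, hψ⟩ := exists_apply_comp_eq_one (A := A) fun hA0 => hu₁ (hA u₁ (by simp [hA0]))
    have hx0 : x ≠ 0 := fun h0 => by simp [h0] at hψ
    have hAx : A x ≠ 0 := fun h0 => hx0 (hA x h0)
    obtain ⟨w₀, hw₀⟩ : ∃ w₀, φ w₀ = 1 := by
      obtain ⟨w, hw⟩ : ∃ w, φ w ≠ 0 := by
        by_contra! h'
        exact hφ (LinearMap.ext h')
      exact ⟨(φ w)⁻¹ • w, by simp [hw]⟩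
    refine ⟨0, ψ, x, φ.smulRight x, ψ ∘ₗ A, A x, fun y f q y' f' q' hs => ?_⟩
    have hy := eq_smulRight_of_ker hw₀ (y := y) fun w hw => hA _ (by rw [hs.c2, hw, zero_smul])
    have hq : A (y w₀) = q := by rw [hs.c2, hw₀, one_smul]
    have h1 : ∀ z, f z • A x = ψ (A z) • q := fun z => by
      have h2 := congrArg A (hs.d1 z)
      have h3 := hs.d2 (A z)
      rw [hφA, zero_smul, add_zero, LinearMap.zero_apply, zero_add] at h3
      rw [LinearMap.zero_apply, map_zero, zero_add, smul_zero, add_zero, map_smul] at h2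
      rw [h3, h2]
    have h2 : q = f x • A x := by rw [h1 x, hψ, one_smul]
    have h3 : y w₀ = f x • x := by
      rw [← sub_eq_zero]
      exact hA _ (by rw [map_sub, hq, map_smul, h2, sub_self])
    refine ⟨f x, LinearMap.ext fun w => ?_, LinearMap.ext fun z => ?_, h2⟩
    · rw [hy, h3, LinearMap.smul_apply, LinearMap.smulRight_apply, smul_comm]
    · have h4 := h1 z
      rw [h2, smul_smul] at h4
      rw [smul_left_injective F hAx h4, LinearMap.smul_apply, LinearMap.comp_apply, smul_eq_mul,
        mul_comm]
  · obtain ⟨k, hk, hφk⟩ := hB hφA hK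
    obtain ⟨u, hu, hAu⟩ : ∃ u, u ≠ 0 ∧ (A = 0 ∨ A u ≠ 0) := by
      by_cases hA : A = 0
      · exact ⟨u₁, hu₁, .inl hA⟩
      · obtain ⟨ψ, x, hψ⟩ := exists_apply_comp_eq_one hA
        exact ⟨x, fun h0 => by simp [h0] at hψ, .inr fun h0 => by simp [h0] at hψ⟩
    refine ⟨B, 0, u, φ.smulRight u, φ ∘ₗ B, A u, fun y f q y' f' q' hs => ?_⟩
    have hy := eq_smulRight_of_ker hφk (fun w hw => hs.apply_eq_zero hBI hBK hw rfl)
    have h1 : y (B k) = f k • u := by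
      have := hs.d1 k
      rwa [hk, map_zero, add_zero, smul_zero, add_zero] at this
    refine ⟨f k, LinearMap.ext fun w => ?_, LinearMap.ext fun z => ?_, ?_⟩
    · rw [hy, h1, LinearMap.smul_apply, LinearMap.smulRight_apply, smul_comm]
    · have h2 := hs.d1 z
      rw [smul_zero, add_zero, hy, h1] at h2
      rcases hAu with hA | hAu
      · rw [hA, LinearMap.zero_apply, map_zero, add_zero, smul_smul] at h2
        rw [← smul_left_injective F hu h2, LinearMap.smul_apply, LinearMap.comp_apply, smul_eq_mul,
          mul_comm]
      · have h3 := hs.d2 (A z)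
        rw [LinearMap.zero_apply, zero_smul, hφA, zero_smul, hA0 hs, map_zero, zero_add, zero_add]
          at h3
        have h4 := congrArg A h2
        rw [map_add, ← h3, add_zero, map_smul, map_smul, map_smul, smul_smul] at h4
        rw [← smul_left_injective F hAu h4, LinearMap.smul_apply, LinearMap.comp_apply, smul_eq_mul,
          mul_comm]
    · have h2 := hs.c2 (B k)
      rw [hφk, one_smul, h1, map_smul] at h2
      exact h2.symm

theorem hasGoodSlice_zero_zero [Nontrivial X] (h : finrank F X ≤ finrank F Y) (A : X →ₗ[F] Y) :
    HasGoodSlice A 0 0 := by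
  have : Nontrivial Y := finrank_pos_iff.1 (lt_of_lt_of_le finrank_pos h)
  obtain ⟨w₁, hw₁⟩ := exists_ne (0 : Y)
  obtain ⟨φ₁, hφ₁⟩ := Projective.exists_dual_eq_one F hw₁
  obtain ⟨B, hBI, hBK, -⟩ := exists_transversal h A φ₁ fun h0 => by simp [h0] at hφ₁
  by_cases hA : A = 0
  · obtain ⟨u, hu⟩ := exists_ne (0 : X)
    obtain ⟨ψ, hψ⟩ := Projective.exists_dual_eq_one F fun h' => hu (hBK u (by simp [hA]) h')
    refine ⟨B, ψ, u, ψ.smulRight u, ψ ∘ₗ B, B u, fun y f q y' f' q' hs => ?_⟩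
    have hy := eq_smulRight_of_ker hψ (fun w hw => hs.apply_eq_zero hBI hBK rfl hw)
    have h1 : ∀ z, y (B z) = f z • u := fun z => by
      have := hs.d1 z
      rwa [hA, LinearMap.zero_apply, map_zero, add_zero, smul_zero, add_zero] at this
    refine ⟨f u, LinearMap.ext fun w => ?_, LinearMap.ext fun z => ?_, ?_⟩
    · rw [hy, h1, LinearMap.smul_apply, LinearMap.smulRight_apply, smul_comm]
    · have h2 := h1 z
      rw [hy, h1, smul_smul] at h2
      rw [← smul_left_injective F hu h2, LinearMap.smul_apply, LinearMap.comp_apply, smul_eq_mul,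
        mul_comm]
    · have h2 := hs.d2 (B u)
      rw [hψ, LinearMap.zero_apply, zero_smul, one_smul, add_zero, hA, LinearMap.zero_apply,
        add_zero, h1, map_smul] at h2
      exact h2
  · obtain ⟨ψ, u, hψ⟩ := exists_apply_comp_eq_one hA
    have hAu : A u ≠ 0 := fun h0 => by simp [h0] at hψ
    refine ⟨B, ψ, u, 0, ψ ∘ₗ A, A u, fun y f q y' f' q' hs => ?_⟩
    have hy : y = 0 := LinearMap.ext fun w => by
      rw [eq_smulRight_of_ker hψ (fun w hw => hs.apply_eq_zero hBI hBK rfl hw), hs.c1, smul_zero,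
        smul_zero, LinearMap.zero_apply]
    have h1 : ∀ z, f z • A u = ψ (A z) • q := fun z => by
      have h2 := congrArg A (hs.d1 z)
      have h3 := hs.d2 (A z)
      rw [LinearMap.zero_apply, zero_smul, add_zero, hy, LinearMap.zero_apply, map_zero,
        zero_add] at h3
      rw [hy, LinearMap.zero_apply, zero_add, smul_zero, add_zero, map_smul] at h2
      rw [h3, h2]
    have h2 : q = f u • A u := by rw [h1 u, hψ, one_smul]
    refine ⟨f u, by rw [hy, smul_zero], LinearMap.ext fun z => ?_, h2⟩
    have h3 := h1 z
    rw [h2, smul_smul] at h3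
    rw [smul_left_injective F hAu h3, LinearMap.smul_apply, LinearMap.comp_apply, smul_eq_mul,
      mul_comm]

theorem hasGoodSlice_of_le [Nontrivial X] (h : finrank F X ≤ finrank F Y) (A : X →ₗ[F] Y)
    (φ : Dual F Y) (p : X) : HasGoodSlice A φ p := by
  by_cases hφ : φ = 0
  · by_cases hp : p = 0
    · rw [hφ, hp]
      exact hasGoodSlice_zero_zero h A
    · rw [hφ]
      exact hasGoodSlice_of_zero_left h A hp
  · by_cases hp : p = 0
    · rw [hp]
      exact hasGoodSlice_of_zero_right h A hφ
    · exact hasGoodSlice_of_ne_of_ne h A hφ hp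

/-- By duality it suffices to treat the case in which the dimension of `X` is at most that
of `Y`. -/
theorem HasGoodSlice.of_dualMap {A : X →ₗ[F] Y} {φ : Dual F Y} {p : X}
    (h : HasGoodSlice A.dualMap (Dual.eval F X p) φ) : HasGoodSlice A φ p := by
  obtain ⟨B, ψ, u, y₀, f₀, q₀, h⟩ := h
  let B₁ : X →ₗ[F] Y := (evalEquiv F Y).symm ∘ₗ B.dualMap ∘ₗ Dual.eval F X
  let y₁ : Y →ₗ[F] X := (evalEquiv F X).symm ∘ₗ y₀.dualMap ∘ₗ Dual.eval F Y
  have hB : ∀ (ξ : Dual F Y) x, ξ (B₁ x) = B ξ x := fun ξ x => by simp [B₁]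
  have hy : ∀ (ξ : Dual F X) w, ξ (y₁ w) = y₀ ξ w := fun ξ x => by simp [y₁]
  have hu : ∀ ξ : Dual F X, ξ ((evalEquiv F X).symm ψ) = ψ ξ := fun ξ => by simp
  have hf : ∀ ξ : Dual F Y, ξ ((evalEquiv F Y).symm f₀) = f₀ ξ := fun ξ => by simp
  refine ⟨B₁, u, (evalEquiv F X).symm ψ, y₁, q₀, (evalEquiv F Y).symm f₀,
    fun y f q y' f' q' hs => ?_⟩
  obtain ⟨c, h1, h2, h3⟩ := h y.dualMap (Dual.eval F Y q) f y'.dualMap (Dual.eval F Y q') f' {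
    c1 := fun ξ => LinearMap.ext fun w => by simpa [mul_comm] using congrArg ξ (hs.c2 w)
    c2 := fun ξ => LinearMap.ext fun x => by simpa [mul_comm] using congrArg ξ (hs.c1 x)
    c3 := hs.c3.symm
    d1 := fun ξ => LinearMap.ext fun w => by
      have := congrArg ξ (hs.d2 w)
      simp only [map_add, map_smul, smul_eq_mul, hB] at this
      simp [← this, mul_comm]
    d2 := fun ξ => LinearMap.ext fun x => by
      have := congrArg ξ (hs.d1 x)
      simp only [map_add, map_smul, smul_eq_mul, hu] at this
      simp [← hB, this, mul_comm]
    d3 := by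
      have := hs.d3
      rw [hu] at this
      simpa using this.symm }
  refine ⟨c, LinearMap.ext fun w => ?_, h3, ?_⟩
  · refine (forall_dual_apply_eq_zero_iff F _).1 ?_ |> sub_eq_zero.1
    intro ξ
    have := LinearMap.congr_fun (LinearMap.congr_fun h1 ξ) w
    rw [map_sub, sub_eq_zero, LinearMap.smul_apply, map_smul, hy]
    exact this
  · refine (forall_dual_apply_eq_zero_iff F _).1 ?_ |> sub_eq_zero.1
    intro ξ
    have := LinearMap.congr_fun h2 ξ
    rw [map_sub, sub_eq_zero, map_smul, hf]
    exact this

/-- Duality exchanges the two spaces, so that `dim X ≤ dim Y` may be assumed. -/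
theorem hasGoodSlice [Nontrivial X] [Nontrivial Y] (A : X →ₗ[F] Y) (φ : Dual F Y) (p : X) :
    HasGoodSlice A φ p := by
  rcases le_total (finrank F X) (finrank F Y) with h | h
  · exact hasGoodSlice_of_le h A φ p
  · have : Nontrivial (Dual F Y) := by
      rw [← finrank_pos_iff (R := F), Subspace.dual_finrank_eq]
      exact finrank_pos
    refine HasGoodSlice.of_dualMap (hasGoodSlice_of_le ?_ _ _ _)
    rwa [Subspace.dual_finrank_eq, Subspace.dual_finrank_eq]

end CyclicQuiver

/-! ### Eigenspaces of dimension at most one -/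

section SmallEigenspace

variable {F 𝕍 X Y Z : Type*} [Field F] [AddCommGroup 𝕍] [Module F 𝕍]
  [AddCommGroup X] [Module F X] [AddCommGroup Y] [Module F Y] [AddCommGroup Z] [Module F Z]
  {g : End F 𝕍} {ζ : F}

theorem eq_zero_of_smul_eq_smul {a b : F} (hab : a ≠ b) {x : X} (h : a • x = b • x) : x = 0 := by
  rw [← sub_eq_zero, ← sub_smul, smul_eq_zero] at h
  exact h.resolve_left (sub_ne_zero.2 hab)

/-- The components of an element of degree `1` with respect to a decomposition into eigenspaces. -/
theorem exists_components_one (hζ : IsPrimitiveRoot ζ 3) (e : (X × Y × Z) ≃ₗ[F] 𝕍)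
    (he : ∀ x y z, g (e (x, y, z)) = e (x, ζ • y, ζ ^ 2 • z)) {v : End F 𝕍}
    (hv : v ∈ gradedPart g ζ) : ∃ (A : X →ₗ[F] Y) (φ : Y →ₗ[F] Z) (p : Z →ₗ[F] X),
      ∀ x y z, v (e (x, y, z)) = e (p z, A x, φ y) := by
  have h1 : (1 : F) ≠ ζ := (hζ.ne_one (by norm_num)).symm
  have h0 : ζ ≠ 0 := hζ.ne_zero (by norm_num)
  have h2 : ζ ^ 2 ≠ ζ := fun h => h1 (mul_left_cancel₀ h0 (by rw [mul_one, ← pow_two, h]))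
  have h3 : ζ ^ 2 ≠ 1 := hζ.pow_ne_one_of_pos_of_lt (by norm_num) (by norm_num)
  have key : ∀ u, ((e.symm (g u)).1 = (e.symm u).1 ∧ (e.symm (g u)).2.1 = ζ • (e.symm u).2.1 ∧
      (e.symm (g u)).2.2 = ζ ^ 2 • (e.symm u).2.2) := fun u => by
    obtain ⟨⟨x, y, z⟩, rfl⟩ := e.surjective u
    simp [he]
  have hX : ∀ x, (e.symm (v (e (x, 0)))).1 = 0 ∧ (e.symm (v (e (x, 0)))).2.2 = 0 := fun x => by
    have h := apply_eigenvector_of_mem_gradedPart hv (w := e (x, 0)) (d := 1)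
      (by rw [one_smul, ← Prod.mk_zero_zero, he, smul_zero, smul_zero])
    obtain ⟨ha, -, hc⟩ := key (v (e (x, 0)))
    rw [h] at ha hc
    simp only [one_mul, map_smul, Prod.smul_fst, Prod.smul_snd] at ha hc
    exact ⟨eq_zero_of_smul_eq_smul h1.symm (by rw [ha, one_smul]), eq_zero_of_smul_eq_smul h2 hc.symm⟩
  have hY : ∀ x, (e.symm (v (e (0, x, 0)))).1 = 0 ∧ (e.symm (v (e (0, x, 0)))).2.1 = 0 := fun x => by
    have h := apply_eigenvector_of_mem_gradedPart hv (w := e (0, x, 0)) (d := ζ)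
      (by simp [he, ← map_smul])
    obtain ⟨ha, hb, -⟩ := key (v (e (0, x, 0)))
    rw [h] at ha hb
    simp only [← pow_two, map_smul, Prod.smul_fst, Prod.smul_snd] at ha hb
    exact ⟨eq_zero_of_smul_eq_smul h3 (by rw [ha, one_smul]), eq_zero_of_smul_eq_smul h2 hb⟩
  have hZ : ∀ x, (e.symm (v (e (0, 0, x)))).2.1 = 0 ∧ (e.symm (v (e (0, 0, x)))).2.2 = 0 := fun x => by
    have h := apply_eigenvector_of_mem_gradedPart hv (w := e (0, 0, x)) (d := ζ ^ 2)
      (by simp [he, ← map_smul])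
    obtain ⟨-, hb, hc⟩ := key (v (e (0, 0, x)))
    rw [h] at hb hc
    simp only [← pow_succ, hζ.pow_eq_one, map_smul, Prod.smul_fst, Prod.smul_snd] at hb hc
    exact ⟨eq_zero_of_smul_eq_smul h1 hb, eq_zero_of_smul_eq_smul h3.symm hc⟩
  refine ⟨LinearMap.fst F Y Z ∘ₗ LinearMap.snd F X (Y × Z) ∘ₗ e.symm.toLinearMap ∘ₗ v ∘ₗ
      e.toLinearMap ∘ₗ LinearMap.inl F X (Y × Z),
    LinearMap.snd F Y Z ∘ₗ LinearMap.snd F X (Y × Z) ∘ₗ e.symm.toLinearMap ∘ₗ v ∘ₗ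
      e.toLinearMap ∘ₗ LinearMap.inr F X (Y × Z) ∘ₗ LinearMap.inl F Y Z,
    LinearMap.fst F X (Y × Z) ∘ₗ e.symm.toLinearMap ∘ₗ v ∘ₗ
      e.toLinearMap ∘ₗ LinearMap.inr F X (Y × Z) ∘ₗ LinearMap.inr F Y Z, fun x y z => ?_⟩
  rw [show ((x, y, z) : X × Y × Z) = (x, 0) + (0, y, 0) + (0, 0, z) by simp, map_add, map_add,
    map_add, map_add]
  apply e.symm.injective
  ext <;> simp [hX, hY, hZ]

/-- Every triple of linear maps is the triple of components of an element of degree `1`. -/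
theorem exists_mem_gradedPart_of_components (hζ : ζ ^ 3 = 1) (e : (X × Y × Z) ≃ₗ[F] 𝕍)
    (he : ∀ x y z, g (e (x, y, z)) = e (x, ζ • y, ζ ^ 2 • z)) (A : X →ₗ[F] Y) (φ : Y →ₗ[F] Z)
    (p : Z →ₗ[F] X) : ∃ v ∈ gradedPart g ζ, ∀ x y z, v (e (x, y, z)) = e (p z, A x, φ y) := by
  let w : (X × Y × Z) →ₗ[F] (X × Y × Z) :=
    (p ∘ₗ LinearMap.snd F Y Z ∘ₗ LinearMap.snd F X (Y × Z)).prod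
      ((A ∘ₗ LinearMap.fst F X (Y × Z)).prod (φ ∘ₗ LinearMap.fst F Y Z ∘ₗ LinearMap.snd F X (Y × Z)))
  have hw : ∀ x y z, e.conj w (e (x, y, z)) = e (p z, A x, φ y) := fun x y z => by
    simp [w, LinearEquiv.conj_apply]
  refine ⟨e.conj w, mem_gradedPart.2 (LinearMap.ext fun u => ?_), hw⟩
  obtain ⟨⟨x, y, z⟩, rfl⟩ := e.surjective u
  rw [Module.End.mul_apply, LinearMap.smul_apply, Module.End.mul_apply, hw, he, he, hw, ← map_smul e]
  simp [smul_smul, ← pow_succ', ← pow_two, hζ]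

theorem exists_components_two (hζ : IsPrimitiveRoot ζ 3) (e : (X × Y × Z) ≃ₗ[F] 𝕍)
    (he : ∀ x y z, g (e (x, y, z)) = e (x, ζ • y, ζ ^ 2 • z)) {d : End F 𝕍}
    (hd : d ∈ gradedPart g (ζ ^ 2)) : ∃ (y : Y →ₗ[F] X) (f : X →ₗ[F] Z) (q : Z →ₗ[F] Y),
      ∀ x w z, d (e (x, w, z)) = e (y w, q z, f x) := by
  have h4 : (ζ ^ 2) ^ 2 = ζ := by linear_combination ζ * hζ.pow_eq_one
  obtain ⟨f, q, y, h⟩ := exists_components_one (hζ.pow_of_coprime 2 (by norm_num))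
    ((LinearEquiv.refl F X).prodCongr (LinearEquiv.prodComm F Z Y) ≪≫ₗ e)
    (fun x z y => by simp [he, h4]) hd
  exact ⟨y, f, q, fun x w z => by simpa using h x z w⟩

variable [FiniteDimensional F 𝕍]

theorem exists_prodEquiv (hg : g ^ 3 = 1) (h3 : (3 : F) ≠ 0) (hζ : IsPrimitiveRoot ζ 3) {p q n : ℕ}
    (hp : eigenDim g ζ 0 = p) (hq : eigenDim g ζ 1 = q) (hn : eigenDim g ζ 2 = n) :
    ∃ e : ((Fin p → F) × (Fin q → F) × (Fin n → F)) ≃ₗ[F] 𝕍,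
      ∀ x y z, g (e (x, y, z)) = e (x, ζ • y, ζ ^ 2 • z) := by
  obtain ⟨b, hX, hY, hZ⟩ := exists_basis_sum hg h3 hζ
  subst hp hq hn
  let e := ((LinearEquiv.refl F (Fin (eigenDim g ζ 0) → F)).prodCongr
    (LinearEquiv.sumArrowLequivProdArrow (Fin (eigenDim g ζ 1)) (Fin (eigenDim g ζ 2)) F F).symm ≪≫ₗ
    (LinearEquiv.sumArrowLequivProdArrow _ _ F F).symm) ≪≫ₗ b.equivFun.symm
  have he : ∀ x y z, e (x, y, z) = ∑ i, x i • b (.inl i) +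
      (∑ i, y i • b (.inr (.inl i)) + ∑ i, z i • b (.inr (.inr i))) := fun x y z => by
    simp [e, Basis.equivFun_symm_apply, Fintype.sum_sum_type]
  refine ⟨e, fun x y z => ?_⟩
  simp only [he, map_add, map_sum, map_smul, hX, hY, hZ, Pi.smul_apply, smul_eq_mul, one_smul,
    smul_smul, mul_comm]

/-- If one of the eigenspaces of `g` vanishes, `v` is a single linear map, and a transversal direction
has no slice kernel. -/
theorem exists_finrank_sliceKernel_le_zero [CharZero F] (hg : g ^ 3 = 1)
    (hζ : IsPrimitiveRoot ζ 3) (h2 : eigenDim g ζ 2 = 0) {v : End F 𝕍} (hv : v ∈ gradedPart g ζ) :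
    ∃ η ∈ gradedPart g ζ, finrank F (sliceKernel g ζ v η) ≤ 0 := by
  have h3 : (3 : F) ≠ 0 := by norm_num
  obtain ⟨e, he⟩ := exists_prodEquiv hg h3 hζ rfl rfl h2
  obtain ⟨A, φ, p, hAv⟩ := exists_components_one hζ e he hv
  suffices H : ∃ B : (Fin (eigenDim g ζ 0) → F) →ₗ[F] (Fin (eigenDim g ζ 1) → F),
      ∀ y y' : (Fin (eigenDim g ζ 1) → F) →ₗ[F] (Fin (eigenDim g ζ 0) → F), (∀ x, y (A x) = 0) →
      (∀ w, A (y w) = 0) → (∀ x, y (B x) + y' (A x) = 0) → (∀ w, 0 = B (y w) + A (y' w)) →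
      y = 0 by
    obtain ⟨B, H⟩ := H
    obtain ⟨η, hη, hBη⟩ := exists_mem_gradedPart_of_components hζ.pow_eq_one e he B 0 0
    refine ⟨η, hη, ?_⟩
    rw [Nat.le_zero, Submodule.finrank_eq_zero, Submodule.eq_bot_iff]
    intro d hd
    obtain ⟨d', hd', hdef⟩ := exists_deformation_of_mem_sliceKernel hg h3 hζ.pow_eq_one hv hη hd
    obtain ⟨hd, hc, -⟩ := hd
    obtain ⟨y, f, q, hy⟩ := exists_components_two hζ e he hd
    obtain ⟨y', f', q', hy'⟩ := exists_components_two hζ e he hd'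
    have h1 : ∀ x w z, _ := fun x w z => LinearMap.congr_fun hc (e (x, w, z))
    have h2 : ∀ x w z, _ := fun x w z => LinearMap.congr_fun hdef (e (x, w, z))
    simp only [Module.End.mul_apply, LinearMap.add_apply, hAv, hBη, hy, hy', ← map_add,
      e.injective.eq_iff, Prod.mk_add_mk, Prod.mk.injEq] at h1 h2
    have hf : f = 0 := Subsingleton.elim _ _
    have hf' : f' = 0 := Subsingleton.elim _ _
    have hφ : φ = 0 := Subsingleton.elim _ _
    have hp : p = 0 := Subsingleton.elim _ _
    have hq : q = 0 := Subsingleton.elim _ _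
    have hq' : q' = 0 := Subsingleton.elim _ _
    simp only [hf, hf', hφ, hp, hq, hq', LinearMap.zero_apply, add_zero, zero_add] at h1 h2
    have hy0 := H y y' (fun x => (h1 x 0 0).1.symm) (fun w => (h1 0 w 0).2.1)
      (fun x => (h2 x 0 0).1) fun w => (h2 0 w 0).2.1
    refine LinearMap.ext fun u => ?_
    obtain ⟨⟨x, w, z⟩, rfl⟩ := e.surjective u
    simp [hy, hy0, hf, hq]
  rcases le_total (eigenDim g ζ 0) (eigenDim g ζ 1) with h | h
  · obtain ⟨W, hW, B, hBW, hB⟩ := exists_injOn_ker_isCompl_range (by simpa using h) A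
    refine ⟨B, fun y y' h1 h2 _ h4 => LinearMap.ext fun w => hB _ (h2 w) ?_⟩
    refine Submodule.disjoint_def.1 hW.disjoint _ (hBW _) ⟨- y' w, ?_⟩
    rw [map_neg, neg_eq_iff_add_eq_zero, add_comm, ← h4]
  · obtain ⟨W, hW, B, hBW, hB⟩ := exists_injOn_ker_isCompl_range (by simpa using h) A.dualMap
    refine ⟨(evalEquiv F _).symm.toLinearMap ∘ₗ B.dualMap ∘ₗ Dual.eval F _, fun y y' h1 h2 h3' h4 =>
      LinearMap.ext fun w => (forall_dual_apply_eq_zero_iff F _).1 fun ξ => ?_⟩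
    refine LinearMap.congr_fun (hB (ξ ∘ₗ y) (LinearMap.ext fun x => ?_)
      (Submodule.disjoint_def.1 hW.disjoint _ (hBW _) ⟨- (ξ ∘ₗ y'), LinearMap.ext fun x => ?_⟩)) w
    · simp [h1]
    · have := congrArg ξ (h3' x)
      rw [map_add, map_zero, add_eq_zero_iff_neg_eq'] at this
      have h5 : ∀ ξ : Dual F (Fin (eigenDim g ζ 1) → F), ξ ((evalEquiv F _).symm
          (B.dualMap (Dual.eval F _ x))) = B ξ x := fun ξ => by simp
      exact this.trans (h5 (ξ ∘ₗ y))

theorem exists_finrank_sliceKernel_le_one [CharZero F] (hg : g ^ 3 = 1)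
    (hζ : IsPrimitiveRoot ζ 3) (h0 : eigenDim g ζ 0 ≠ 0) (h1 : eigenDim g ζ 1 ≠ 0)
    (h2 : eigenDim g ζ 2 = 1) {v : End F 𝕍} (hv : v ∈ gradedPart g ζ) :
    ∃ η ∈ gradedPart g ζ, finrank F (sliceKernel g ζ v η) ≤ 1 := by
  have h3 : (3 : F) ≠ 0 := by norm_num
  obtain ⟨e₁, he₁⟩ := exists_prodEquiv hg h3 hζ rfl rfl h2
  obtain ⟨e, he⟩ : ∃ e : ((Fin (eigenDim g ζ 0) → F) × (Fin (eigenDim g ζ 1) → F) × F) ≃ₗ[F] 𝕍,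
      ∀ x y z, g (e (x, y, z)) = e (x, ζ • y, ζ ^ 2 • z) :=
    ⟨(LinearEquiv.refl F _).prodCongr ((LinearEquiv.refl F _).prodCongr
      (LinearEquiv.funUnique (Fin 1) F F).symm) ≪≫ₗ e₁, fun x y z => by
        simp only [LinearEquiv.trans_apply, LinearEquiv.prodCongr_apply, LinearEquiv.refl_apply,
          map_smul]
        exact he₁ _ _ _⟩
  obtain ⟨A, φ, p, hAv⟩ := exists_components_one hζ e he hv
  have : Nonempty (Fin (eigenDim g ζ 0)) := ⟨⟨0, Nat.pos_of_ne_zero h0⟩⟩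
  have : Nonempty (Fin (eigenDim g ζ 1)) := ⟨⟨0, Nat.pos_of_ne_zero h1⟩⟩
  obtain ⟨B, ψ, u, y₀, f₀, q₀, H⟩ := hasGoodSlice A φ (p 1)
  obtain ⟨η, hη, hBη⟩ := exists_mem_gradedPart_of_components hζ.pow_eq_one e he B ψ
    (LinearMap.toSpanSingleton F _ u)
  refine ⟨η, hη, ?_⟩
  have hp : ∀ z, p z = z • p 1 := fun z => by rw [← map_smul, smul_eq_mul, mul_one]
  obtain ⟨d₀, hd₀⟩ : ∃ d₀ : End F 𝕍, ∀ x w z, d₀ (e (x, w, z)) = e (y₀ w, z • q₀, f₀ x) :=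
    ⟨e.conj ((y₀ ∘ₗ LinearMap.fst F _ F ∘ₗ LinearMap.snd F _ _).prod
      ((LinearMap.toSpanSingleton F _ q₀ ∘ₗ LinearMap.snd F _ F ∘ₗ LinearMap.snd F _ _).prod
        (f₀ ∘ₗ LinearMap.fst F _ _))), fun x w z => by simp [LinearEquiv.conj_apply]⟩
  refine (Submodule.finrank_mono (t := F ∙ d₀) fun d hd => ?_).trans
    ((finrank_span_le_card ({d₀} : Set (End F 𝕍))).trans (by simp))
  obtain ⟨d', hd', hdef⟩ := exists_deformation_of_mem_sliceKernel hg h3 hζ.pow_eq_one hv hη hd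
  obtain ⟨hd, hc, -⟩ := hd
  obtain ⟨y, f, q, hy⟩ := exists_components_two hζ e he hd
  obtain ⟨y', f', q', hy'⟩ := exists_components_two hζ e he hd'
  have hq : ∀ z, q z = z • q 1 := fun z => by rw [← map_smul, smul_eq_mul, mul_one]
  have hq' : ∀ z, q' z = z • q' 1 := fun z => by rw [← map_smul, smul_eq_mul, mul_one]
  have h1 : ∀ x w z, _ := fun x w z => LinearMap.congr_fun hc (e (x, w, z))
  have h2 : ∀ x w z, _ := fun x w z => LinearMap.congr_fun hdef (e (x, w, z))
  simp only [Module.End.mul_apply, LinearMap.add_apply, hAv, hBη, hy, hy', ← map_add,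
    e.injective.eq_iff, Prod.mk_add_mk, Prod.mk.injEq] at h1 h2
  obtain ⟨c, hc1, hc2, hc3⟩ := H y f (q 1) y' f' (q' 1) {
    c1 := fun x => by rw [← hp, (h1 x 0 0).1]
    c2 := fun w => by rw [← hq, (h1 0 w 0).2.1]
    c3 := (h1 0 0 1).2.2
    d1 := fun x => by simpa [← hp] using (h2 x 0 0).1
    d2 := fun w => by simpa [← hq, ← hq'] using (h2 0 w 0).2.1
    d3 := by simpa using (h2 0 0 1).2.2 }
  refine Submodule.mem_span_singleton.2 ⟨c, LinearMap.ext fun u => ?_⟩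
  obtain ⟨⟨x, w, z⟩, rfl⟩ := e.surjective u
  rw [LinearMap.smul_apply, hd₀, hy, hq, hc1, hc2, hc3, ← map_smul]
  simp [smul_comm z c]

end SmallEigenspace

/-! ### Slice kernels of direct sums -/

section Splitting

variable {F 𝕍 : Type*} [Field F] [AddCommGroup 𝕍] [Module F 𝕍]

theorem mem_sliceKernel_of_deformation {g v η y y' : End F 𝕍} {ζ : F}
    (hy : y ∈ gradedPart g (ζ ^ 2)) (hvy : v * y = y * v) (h : y * η + y' * v = η * y + v * y') :
    y ∈ sliceKernel g ζ v η := by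
  refine ⟨hy, hvy, fun x _ hx => ?_⟩
  have h1 : η * y - y * η = y' * v - v * y' := by
    rw [sub_eq_sub_iff_add_eq_add, ← h, add_comm]
  have h2 : LinearMap.trace F 𝕍 (x * (η * y - y * η)) = 0 := by
    rw [h1, mul_sub, map_sub, ← mul_assoc, ← mul_assoc, LinearMap.trace_mul_comm, hx, mul_assoc,
      ← mul_assoc v x, sub_self]
  rw [mul_sub, map_sub, ← mul_assoc x η y, LinearMap.trace_mul_comm F (x * η) y,
    LinearMap.trace_mul_comm F x (y * η), mul_assoc y η x] at h2
  rwa [mul_sub, map_sub]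

variable {U₁ U₂ : Type*} [AddCommGroup U₁] [Module F U₁] [AddCommGroup U₂] [Module F U₂]
  [FiniteDimensional F 𝕍]

/-- The slice kernel of a direct sum is the direct sum of the slice kernels, if its elements have
no components mapping one of the summands to the other. -/
theorem finrank_sliceKernel_le_add {g v η : End F 𝕍} (hg : g ^ 3 = 1) (h3 : (3 : F) ≠ 0) {ζ : F}
    (hζ : ζ ^ 3 = 1) (hv : v ∈ gradedPart g ζ) (hη : η ∈ gradedPart g ζ)
    (e : (U₁ × U₂) ≃ₗ[F] 𝕍) {g₁ v₁ η₁ : End F U₁} {g₂ v₂ η₂ : End F U₂}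
    (hge : ∀ a b, g (e (a, b)) = e (g₁ a, g₂ b)) (hve : ∀ a b, v (e (a, b)) = e (v₁ a, v₂ b))
    (hηe : ∀ a b, η (e (a, b)) = e (η₁ a, η₂ b))
    (h12 : ∀ y : U₂ →ₗ[F] U₁, (∀ b, v₁ (y b) = y (v₂ b)) → y = 0)
    (h21 : ∀ y : U₁ →ₗ[F] U₂, (∀ b, v₂ (y b) = y (v₁ b)) → y = 0) :
    finrank F (sliceKernel g ζ v η) ≤
      finrank F (sliceKernel g₁ ζ v₁ η₁) + finrank F (sliceKernel g₂ ζ v₂ η₂) := by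
  have : FiniteDimensional F (U₁ × U₂) := LinearEquiv.finiteDimensional e.symm
  have : FiniteDimensional F U₁ := Module.Finite.of_surjective (LinearMap.fst F U₁ U₂)
    LinearMap.fst_surjective
  have : FiniteDimensional F U₂ := Module.Finite.of_surjective (LinearMap.snd F U₁ U₂)
    LinearMap.snd_surjective
  let L₁ : End F 𝕍 →ₗ[F] End F U₁ :=
    { toFun := fun y => LinearMap.fst F U₁ U₂ ∘ₗ e.symm.toLinearMap ∘ₗ y ∘ₗ e.toLinearMap ∘ₗ
        LinearMap.inl F U₁ U₂
      map_add' := fun y z => by ext; simp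
      map_smul' := fun c y => by ext; simp }
  let L₂ : End F 𝕍 →ₗ[F] End F U₂ :=
    { toFun := fun y => LinearMap.snd F U₁ U₂ ∘ₗ e.symm.toLinearMap ∘ₗ y ∘ₗ e.toLinearMap ∘ₗ
        LinearMap.inr F U₁ U₂
      map_add' := fun y z => by ext; simp
      map_smul' := fun c y => by ext; simp }
  have hL₁ : ∀ y a, L₁ y a = (e.symm (y (e (a, 0)))).1 := fun y a => rfl
  have hL₂ : ∀ y a, L₂ y a = (e.symm (y (e (0, a)))).2 := fun y a => rfl
  have hsymm : ∀ {w : End F 𝕍} {w₁ : End F U₁} {w₂ : End F U₂},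
      (∀ a b, w (e (a, b)) = e (w₁ a, w₂ b)) → ∀ u : 𝕍,
      e.symm (w u) = (w₁ (e.symm u).1, w₂ (e.symm u).2) := fun {w w₁ w₂} h u => by
    obtain ⟨⟨a, b⟩, rfl⟩ := e.surjective u
    rw [h, e.symm_apply_apply, e.symm_apply_apply]
  have hoff : ∀ y, v * y = y * v → ∀ a b, y (e (a, b)) = e (L₁ y a, L₂ y b) := fun y hy a b => by
    have hc : ∀ u, v (y u) = y (v u) := LinearMap.congr_fun hy
    have z1 : LinearMap.fst F U₁ U₂ ∘ₗ e.symm.toLinearMap ∘ₗ y ∘ₗ e.toLinearMap ∘ₗ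
        LinearMap.inr F U₁ U₂ = 0 := h12 _ fun b => by
      have := congrArg (fun u => (e.symm u).1) (hc (e (0, b)))
      simpa [hsymm hve, hve] using this
    have z2 : LinearMap.snd F U₁ U₂ ∘ₗ e.symm.toLinearMap ∘ₗ y ∘ₗ e.toLinearMap ∘ₗ
        LinearMap.inl F U₁ U₂ = 0 := h21 _ fun b => by
      have := congrArg (fun u => (e.symm u).2) (hc (e (b, 0)))
      simpa [hsymm hve, hve] using this
    have z1' : (e.symm (y (e (0, b)))).1 = 0 := LinearMap.congr_fun z1 b
    have z2' : (e.symm (y (e (a, 0)))).2 = 0 := LinearMap.congr_fun z2 a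
    apply e.symm.injective
    rw [show (a, b) = (a, 0) + (0, b) by simp, map_add, map_add, map_add, e.symm_apply_apply]
    ext <;> simp [z1', z2', hL₁, hL₂]
  have m1 : ∀ y ∈ sliceKernel g ζ v η, L₁ y ∈ sliceKernel g₁ ζ v₁ η₁ := fun y hy => by
    obtain ⟨y', -, hy'⟩ := exists_deformation_of_mem_sliceKernel hg h3 hζ hv hη hy
    have hyy := hoff y hy.2.1
    refine mem_sliceKernel_of_deformation (y' := L₁ y') (mem_gradedPart.2 (LinearMap.ext fun a => ?_))
      (LinearMap.ext fun a => ?_) (LinearMap.ext fun a => ?_)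
    · have := congrArg (fun u => (e.symm u).1) (LinearMap.congr_fun (mem_gradedPart.1 hy.1) (e (a, 0)))
      simpa [hyy, hge] using this
    · have := congrArg (fun u => (e.symm u).1) (LinearMap.congr_fun hy.2.1 (e (a, 0)))
      simpa [hyy, hve] using this
    · have := congrArg (fun u => (e.symm u).1) (LinearMap.congr_fun hy' (e (a, 0)))
      simpa [hyy, hve, hηe, hL₁ y', hsymm hve] using this
  have m2 : ∀ y ∈ sliceKernel g ζ v η, L₂ y ∈ sliceKernel g₂ ζ v₂ η₂ := fun y hy => by
    obtain ⟨y', -, hy'⟩ := exists_deformation_of_mem_sliceKernel hg h3 hζ hv hη hy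
    have hyy := hoff y hy.2.1
    refine mem_sliceKernel_of_deformation (y' := L₂ y') (mem_gradedPart.2 (LinearMap.ext fun a => ?_))
      (LinearMap.ext fun a => ?_) (LinearMap.ext fun a => ?_)
    · have := congrArg (fun u => (e.symm u).2) (LinearMap.congr_fun (mem_gradedPart.1 hy.1) (e (0, a)))
      simpa [hyy, hge] using this
    · have := congrArg (fun u => (e.symm u).2) (LinearMap.congr_fun hy.2.1 (e (0, a)))
      simpa [hyy, hve] using this
    · have := congrArg (fun u => (e.symm u).2) (LinearMap.congr_fun hy' (e (0, a)))
      simpa [hyy, hve, hηe, hL₂ y', hsymm hve] using this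
  rw [← finrank_prod]
  refine LinearMap.finrank_le_finrank_of_injective
    (f := (L₁.restrict m1).prod (L₂.restrict m2)) ?_
  rw [← LinearMap.ker_eq_bot, LinearMap.ker_eq_bot']
  rintro ⟨y, hy⟩ h
  have h1 : L₁ y = 0 := congrArg (fun z => (z.1 : End F U₁)) h
  have h2 : L₂ y = 0 := congrArg (fun z => (z.2 : End F U₂)) h
  refine Subtype.ext (LinearMap.ext fun u => ?_)
  obtain ⟨⟨a, b⟩, rfl⟩ := e.surjective u
  rw [hoff y hy.2.1, h1, h2]
  exact map_zero e

end Splitting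

/-! ### Invertible elements of `𝔤₁` -/

section Invertible

variable {F 𝕍 : Type*} [Field F] [AddCommGroup 𝕍] [Module F 𝕍] [FiniteDimensional F 𝕍]
  {g v : End F 𝕍} {ζ : F}

theorem mul_apply_of_mem_gradedPart {c : F} (hv : v ∈ gradedPart g c) (u : 𝕍) :
    g (v u) = c • v (g u) := LinearMap.congr_fun (mem_gradedPart.1 hv) u

/-- For invertible `v ∈ 𝔤₁`, all eigenvectors of `g` come from the fixed space of `g`. -/
theorem exists_pow_apply_eq (hζ : ζ ≠ 0) (hv : v ∈ gradedPart g ζ) (hinj : Function.Injective v) :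
    ∀ (t : ℕ) (w : 𝕍), g w = ζ ^ t • w → ∃ u, g u = u ∧ w = (v ^ t) u
  | 0, w, hw => ⟨w, by simpa using hw, by simp⟩
  | t + 1, w, hw => by
    obtain ⟨w', rfl⟩ := LinearMap.injective_iff_surjective.1 hinj w
    have h1 : g w' = ζ ^ t • w' := by
      refine hinj ?_
      rw [mul_apply_of_mem_gradedPart hv, pow_succ', mul_smul] at hw
      rw [map_smul]
      exact smul_right_injective _ hζ hw
    obtain ⟨u, hu, rfl⟩ := exists_pow_apply_eq hζ hv hinj t w' h1
    exact ⟨u, hu, by rw [pow_succ', Module.End.mul_apply]⟩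

/-- Endomorphisms agreeing on the images of the fixed space of `g` under the positive powers of an
invertible `v ∈ 𝔤₁` are equal. -/
theorem ext_of_pow_apply (hg : g ^ 3 = 1) (h3 : (3 : F) ≠ 0) (hζ : IsPrimitiveRoot ζ 3)
    (hv : v ∈ gradedPart g ζ) (hinj : Function.Injective v) {x y : End F 𝕍}
    (h : ∀ t u, g u = u → x ((v ^ (t + 1)) u) = y ((v ^ (t + 1)) u)) : x = y := by
  have h0 : ζ ≠ 0 := hζ.ne_zero (by norm_num)
  have key : ∀ (t : ℕ) w, g w = ζ ^ t • w → x w = y w := fun t w hw => by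
    obtain ⟨u, hu, rfl⟩ := exists_pow_apply_eq h0 hv hinj (t + 3) w
      (by rw [pow_add, hζ.pow_eq_one, mul_one, hw])
    exact h (t + 2) u hu
  obtain ⟨b, hX, hY, hZ⟩ := exists_basis_sum hg h3 hζ
  refine b.ext ?_
  rintro (i | i | i)
  · exact key 0 _ (by rw [hX, pow_zero])
  · exact key 1 _ (by rw [hY, pow_one])
  · exact key 2 _ (hZ i)

/-- If `v ∈ 𝔤₁` is invertible, and a space of elements of degree `2` commutes with `v` and with some
`R` of degree `0` for which the fixed space of `g` is cyclic, then it embeds into this fixed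
space. -/
theorem finrank_le_of_commute (hg : g ^ 3 = 1) (h3 : (3 : F) ≠ 0) (hζ : IsPrimitiveRoot ζ 3)
    (hv : v ∈ gradedPart g ζ) (hinj : Function.Injective v) {K : Submodule F (End F 𝕍)}
    (hK : ∀ y ∈ K, y ∈ gradedPart g (ζ ^ 2) ∧ v * y = y * v) {R : End F 𝕍} (hvR : v * R = R * v)
    (hKR : ∀ y ∈ K, y * R = R * y) {x : 𝕍} (hx : g x = x)
    (hspan : ∀ u, g u = u → ∃ a b : F, u = a • x + b • R x) : finrank F K ≤ eigenDim g ζ 0 := by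
  let f : K →ₗ[F] 𝕍 := LinearMap.applyₗ (v x) ∘ₗ K.subtype
  have hf : ∀ y, f y = y.1 (v x) := fun y => rfl
  have hfi : Function.Injective f := by
    rw [← LinearMap.ker_eq_bot, LinearMap.ker_eq_bot']
    rintro ⟨y, hy⟩ h
    rw [hf] at h
    have hyv : ∀ u, v (y u) = y (v u) := LinearMap.congr_fun (hK y hy).2
    have hyR : ∀ u, y (R u) = R (y u) := LinearMap.congr_fun (hKR y hy)
    have hR : ∀ u, v (R u) = R (v u) := LinearMap.congr_fun hvR
    have h1 : ∀ u, g u = u → y (v u) = 0 := fun u hu => by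
      obtain ⟨a, b, rfl⟩ := hspan u hu
      rw [map_add, map_smul, map_smul, hR, map_add, map_smul, map_smul, hyR, h, map_zero, smul_zero,
        smul_zero, add_zero]
    refine Subtype.ext (ext_of_pow_apply hg h3 hζ hv hinj fun t u hu => ?_)
    induction t with
    | zero => simpa using h1 u hu
    | succ t ih =>
      rw [pow_succ', Module.End.mul_apply]
      change y _ = 0
      rw [← hyv]
      exact (congrArg v ih).trans (map_zero v)
  rw [← LinearMap.finrank_range_of_inj hfi]
  refine Submodule.finrank_mono ?_
  rintro _ ⟨y, rfl⟩
  have h1 : g (v x) = ζ • v x := by rw [mul_apply_of_mem_gradedPart hv, hx]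
  have h2 := apply_eigenvector_of_mem_gradedPart (hK y.1 y.2).1 h1
  rw [← pow_succ', hζ.pow_eq_one, one_smul] at h2
  rw [End.mem_eigenspace_iff, hf]
  simpa using h2

theorem exists_smul_add_of_linearIndependent {R : End F 𝕍} (h2 : eigenDim g ζ 0 = 2) {x : 𝕍}
    (hx : g x = x) (hRx : g (R x) = R x) (hli : LinearIndependent F ![x, R x]) :
    ∀ u, g u = u → ∃ a b : F, u = a • x + b • R x := by
  intro u hu
  have hle : Submodule.span F {x, R x} ≤ End.eigenspace g (ζ ^ 0) := by
    rw [Submodule.span_le]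
    rintro _ (rfl | rfl) <;> simpa [End.mem_eigenspace_iff]
  have h := Submodule.eq_of_le_of_finrank_eq hle (by
    have := finrank_span_eq_card hli
    rw [Matrix.range_cons, Matrix.range_cons, Matrix.range_empty, Set.union_empty,
      Set.singleton_union] at this
    rw [this, Fintype.card_fin]
    exact h2.symm)
  have hu' : u ∈ Submodule.span F {x, R x} := by
    rw [h, End.mem_eigenspace_iff]
    simpa using hu
  obtain ⟨a, b, hab⟩ := Submodule.mem_span_pair.1 hu'
  exact ⟨a, b, hab.symm⟩

/-- If `v ^ 3` is scalar then elements of the slice kernel in the direction of `v * R`, where `R`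
commutes with `v`, commute with `R`. -/
theorem commute_of_mem_sliceKernel_mul (hg : g ^ 3 = 1) (h3 : (3 : F) ≠ 0) (hζ : ζ ^ 3 = 1)
    (hv : v ∈ gradedPart g ζ) {R : End F 𝕍} (hR : v * R ∈ gradedPart g ζ) (hvR : v * R = R * v)
    {c : F} (hc : c ≠ 0) (hvc : v ^ 3 = c • 1) {y : End F 𝕍} (hy : y ∈ sliceKernel g ζ v (v * R)) :
    y * R = R * y := by
  obtain ⟨y', -, h⟩ := exists_deformation_of_mem_sliceKernel hg h3 hζ hv hR hy
  have hvy := hy.2.1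
  have h1 : v * (y * R - R * y) = v * y' - y' * v := by
    have e1 : y * (v * R) = v * (y * R) := by rw [← mul_assoc, ← hvy, mul_assoc]
    rw [mul_sub, ← e1, ← mul_assoc v R, sub_eq_sub_iff_add_eq_add, h, add_comm]
  have h2 : (y * R - R * y) * v = v * (y * R - R * y) := by
    rw [sub_mul, mul_sub, mul_assoc, ← hvR, ← mul_assoc, ← hvy, mul_assoc, mul_assoc, ← hvy,
      ← mul_assoc R, ← hvR, mul_assoc]
  set C := y * R - R * y with hC
  have h4 : (3 : F) • v ^ 3 * C = 0 := by
    have e1 : v ^ 2 * (v * C) + v * (v * C) * v + v * C * v ^ 2 = (3 : F) • v ^ 3 * C := by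
      have e2 : v * (v * C) * v = v ^ 3 * C := by
        rw [mul_assoc, mul_assoc, h2]; noncomm_ring
      have e3 : v * C * v ^ 2 = v ^ 3 * C := by
        rw [pow_two, mul_assoc, ← mul_assoc C, h2, mul_assoc v C v, h2]; noncomm_ring
      rw [e2, e3, ← mul_assoc, ← pow_succ, smul_mul_assoc, show (3 : F) = 1 + 1 + 1 by norm_num,
        add_smul, add_smul, one_smul]
    have e4 : v ^ 2 * (v * y' - y' * v) + v * (v * y' - y' * v) * v + (v * y' - y' * v) * v ^ 2 =
        v ^ 3 * y' - y' * v ^ 3 := by noncomm_ring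
    rw [← e1, h1, e4, hvc, smul_mul_assoc, mul_smul_comm, one_mul, mul_one, sub_self]
  rw [hvc, smul_smul, smul_mul_assoc, one_mul, smul_eq_zero] at h4
  exact sub_eq_zero.1 (h4.resolve_left (mul_ne_zero h3 hc))

theorem pow_three_mem_gradedPart (hζ : ζ ^ 3 = 1) (hv : v ∈ gradedPart g ζ) :
    v ^ 3 ∈ gradedPart g 1 := by
  rw [← hζ]
  exact pow_mem_gradedPart hv 3

theorem apply_fixed_of_mem_gradedPart_one {R : End F 𝕍} (hR : R ∈ gradedPart g 1) {x : 𝕍}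
    (hx : g x = x) : g (R x) = R x := by
  rw [mul_apply_of_mem_gradedPart hR, one_smul, hx]

/-- If `v ^ 3` is scalar, averaging over the powers of `v` turns an endomorphism of the fixed space
of `g` into an element of degree `0` commuting with `v`. -/
theorem exists_commute_of_pow_three (hζ : IsPrimitiveRoot ζ 3) (hv : v ∈ gradedPart g ζ) {c : F}
    (hvc : v ^ 3 = c • 1) {S : End F 𝕍} (hS : S ∈ gradedPart g 1)
    (hS0 : ∀ (t : ℕ) u, ζ ^ t ≠ 1 → g u = ζ ^ t • u → S u = 0) :
    ∃ R ∈ gradedPart g 1, v * R = R * v ∧ ∀ x, g x = x → R x = c • S x := by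
  refine ⟨v ^ 3 * S + v ^ 2 * S * v + v * S * v ^ 2, ?_, ?_, fun x hx => ?_⟩
  · refine add_mem (add_mem ?_ ?_) ?_
    · rw [← one_mul (1 : F)]
      exact mul_mem_gradedPart (pow_three_mem_gradedPart hζ.pow_eq_one hv) hS
    · rw [← hζ.pow_eq_one, show ζ ^ 3 = ζ ^ 2 * 1 * ζ by ring]
      exact mul_mem_gradedPart (mul_mem_gradedPart (pow_mem_gradedPart hv 2) hS) hv
    · rw [← hζ.pow_eq_one, show ζ ^ 3 = ζ * 1 * ζ ^ 2 by ring]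
      exact mul_mem_gradedPart (mul_mem_gradedPart hv hS) (pow_mem_gradedPart hv 2)
  · have e1 : v * (v * S * v ^ 2) = v ^ 2 * S * v * v := by noncomm_ring
    have e2 : v * (v ^ 2 * S * v) = v ^ 3 * S * v := by noncomm_ring
    have e3 : v * (v ^ 3 * S) = v * S * v ^ 2 * v := by
      rw [mul_assoc (v * S), ← pow_succ, hvc, smul_mul_assoc, one_mul, mul_smul_comm, mul_smul_comm,
        mul_one]
    rw [mul_add, mul_add, e1, e2, e3, add_mul, add_mul]
    abel
  · have h1 : (1 : F) ≠ ζ := (hζ.ne_one (by norm_num)).symm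
    have h3 : ζ ^ 2 ≠ 1 := hζ.pow_ne_one_of_pos_of_lt (by norm_num) (by norm_num)
    have key : ∀ t : ℕ, ζ ^ t ≠ 1 → S ((v ^ t) x) = 0 := fun t ht => by
      refine hS0 t _ ht ?_
      rw [mul_apply_of_mem_gradedPart (pow_mem_gradedPart hv t), hx]
    have k1 := key 1 (by simpa using h1.symm)
    have k2 := key 2 h3
    rw [pow_one] at k1
    simp [Module.End.mul_apply, k1, k2, hvc]

/-- If `v ^ 3` is not scalar on the fixed space of `g`, its slice kernel at `0` is already small.
Otherwise the direction is `v * R`, where `R` commutes with `v` and is not scalar. -/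
theorem exists_finrank_sliceKernel_le_two_of_injective [CharZero F] (hg : g ^ 3 = 1)
    (hζ : IsPrimitiveRoot ζ 3) (hv : v ∈ gradedPart g ζ) (hinj : Function.Injective v)
    (h0 : eigenDim g ζ 0 = 2) :
    ∃ η ∈ gradedPart g ζ, finrank F (sliceKernel g ζ v η) ≤ 2 := by
  have h3 : (3 : F) ≠ 0 := by norm_num
  have hv3 := pow_three_mem_gradedPart hζ.pow_eq_one hv
  by_cases hns : ∃ x, g x = x ∧ LinearIndependent F ![x, (v ^ 3) x]
  · obtain ⟨x, hx, hli⟩ := hns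
    refine ⟨0, zero_mem _, ?_⟩
    rw [← h0]
    refine finrank_le_of_commute hg h3 hζ hv hinj (R := v ^ 3) (fun y hy => ⟨hy.1, hy.2.1⟩)
      (by rw [← pow_succ, ← pow_succ']) (fun y hy => ?_) hx (exists_smul_add_of_linearIndependent h0 hx
        (apply_fixed_of_mem_gradedPart_one hv3 hx) hli)
    exact ((show Commute v y from hy.2.1).pow_left 3).eq.symm
  -- Otherwise `v ^ 3` is scalar.
  push Not at hns
  have hmaps : ∀ x ∈ End.eigenspace g 1, (v ^ 3) x ∈ End.eigenspace g 1 := fun x hx => by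
    rw [End.mem_eigenspace_iff, one_smul] at hx ⊢
    exact apply_fixed_of_mem_gradedPart_one hv3 hx
  obtain ⟨c, hc⟩ := LinearMap.exists_eq_smul_id_of_forall_notLinearIndependent
    (f := (v ^ 3).restrict hmaps) fun x hli => by
      refine hns x.1 (by simpa using End.mem_eigenspace_iff.1 x.2) (LinearIndependent.pair_iff.2
        fun s t hst => LinearIndependent.pair_iff.1 hli s t (Subtype.ext hst))
  have hc' : ∀ x, g x = x → (v ^ 3) x = c • x := fun x hx =>
    congrArg Subtype.val (LinearMap.congr_fun hc ⟨x, by simpa [End.mem_eigenspace_iff] using hx⟩)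
  have hvc : v ^ 3 = c • 1 := by
    refine ext_of_pow_apply hg h3 hζ hv hinj fun t u hu => ?_
    rw [← Module.End.mul_apply, ← pow_add, add_comm, pow_add, Module.End.mul_apply, hc' u hu, map_smul]
    rfl
  obtain ⟨b, hX, hY, hZ⟩ := exists_basis_sum hg h3 hζ
  let i₀ : Fin (eigenDim g ζ 0) := ⟨0, by omega⟩
  let i₁ : Fin (eigenDim g ζ 0) := ⟨1, by omega⟩
  have hi : i₀ ≠ i₁ := by simp [i₀, i₁]
  have hx₀ : g (b (.inl i₀)) = b (.inl i₀) := by rw [hX, one_smul]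
  have hx₁ : g (b (.inl i₁)) = b (.inl i₁) := by rw [hX, one_smul]
  have hcne : c ≠ 0 := by
    rintro rfl
    have h1 : (v ^ 3) (b (.inl i₀)) = 0 := by rw [hvc, zero_smul, LinearMap.zero_apply]
    have h2 : Function.Injective ⇑(v ^ 3) := by
      rw [Module.End.coe_pow]
      exact hinj.iterate 3
    exact b.ne_zero _ (h2 (h1.trans (map_zero _).symm))
  let d : Fin (eigenDim g ζ 0) ⊕ Fin (eigenDim g ζ 1) ⊕ Fin (eigenDim g ζ 2) → F :=
    Sum.elim (fun _ => 1) (Sum.elim (fun _ => ζ) fun _ => ζ ^ 2)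
  have hb : ∀ i, g (b i) = d i • b i := by
    rintro (i | i | i)
    exacts [hX i, hY i, hZ i]
  obtain ⟨R, hR, hvR, hRx⟩ := exists_commute_of_pow_three hζ hv hvc
    (S := (b.coord (.inl i₀)).smulRight (b (.inl i₀)))
    (coord_smulRight_mem_gradedPart b hb (by simp)) fun t u ht hu => by
      rw [LinearMap.smulRight_apply, Basis.coord_apply,
        repr_eq_zero_of_eigenvector b hb hu (j := .inl i₀) fun h1 => ht h1.symm, zero_smul]
  refine ⟨v * R, by simpa using mul_mem_gradedPart hv hR, ?_⟩
  have hx : g (b (.inl i₀) + b (.inl i₁)) = b (.inl i₀) + b (.inl i₁) := by rw [map_add, hx₀, hx₁]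
  have hRx' : R (b (.inl i₀) + b (.inl i₁)) = c • b (.inl i₀) := by
    rw [hRx _ hx]
    simp [Finsupp.single_apply, hi.symm]
  rw [← h0]
  refine finrank_le_of_commute hg h3 hζ hv hinj (R := R) (fun y hy => ⟨hy.1, hy.2.1⟩) hvR
    (fun y hy => commute_of_mem_sliceKernel_mul hg h3 hζ.pow_eq_one hv
      (by simpa using mul_mem_gradedPart hv hR) hvR hcne hvc hy) hx
    (exists_smul_add_of_linearIndependent h0 hx (apply_fixed_of_mem_gradedPart_one hR hx) ?_)
  rw [hRx', LinearIndependent.pair_iff]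
  intro s t hst
  have hst' := fun i => congrArg (fun u => b.repr u (.inl i)) hst
  have e1 := hst' i₁
  have e0 := hst' i₀
  simp [Finsupp.single_apply, hi, hi.symm] at e0 e1
  simp only [e1, zero_add, mul_eq_zero, hcne, or_false] at e0
  exact ⟨e1, e0⟩

end Invertible

/-! ### Rotation of the eigenspaces and the Fitting decomposition -/

section Rotation

variable {F 𝕍 : Type*} [Field F] [AddCommGroup 𝕍] [Module F 𝕍] {g v : End F 𝕍} {ζ : F}

theorem eigenDim_add_three (hζ : ζ ^ 3 = 1) (t : ℕ) : eigenDim g ζ (t + 3) = eigenDim g ζ t := by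
  rw [eigenDim, eigenDim, pow_add, hζ, mul_one]

theorem eigenDim_pow_smul (hζ : ζ ≠ 0) (k t : ℕ) :
    eigenDim (ζ ^ k • g) ζ (t + k) = eigenDim g ζ t := by
  have : End.eigenspace (ζ ^ k • g) (ζ ^ (t + k)) = End.eigenspace g (ζ ^ t) := by
    ext u
    rw [End.mem_eigenspace_iff, End.mem_eigenspace_iff, LinearMap.smul_apply, add_comm, pow_add,
      mul_smul]
    exact (smul_right_injective _ (pow_ne_zero k hζ)).eq_iff
  rw [eigenDim, eigenDim, this]

theorem pow_smul_pow_three (hζ : ζ ^ 3 = 1) (hg : g ^ 3 = 1) (k : ℕ) : (ζ ^ k • g) ^ 3 = 1 := by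
  rw [_root_.smul_pow, hg, ← pow_mul, mul_comm, pow_mul, hζ, one_pow, one_smul]

theorem sliceKernel_pow_smul (hζ : ζ ≠ 0) (k : ℕ) (η : End F 𝕍) :
    sliceKernel (ζ ^ k • g) ζ v η = sliceKernel g ζ v η := by
  ext y
  rw [mem_sliceKernel, mem_sliceKernel, smul_gradedPart _ (pow_ne_zero k hζ),
    smul_gradedPart _ (pow_ne_zero k hζ)]

end Rotation

section Fitting

variable {F 𝕍 : Type*} [Field F] [AddCommGroup 𝕍] [Module F 𝕍] [FiniteDimensional F 𝕍]
  {g v : End F 𝕍} {ζ : F}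

theorem eigenDim_le_succ_of_injective (hv : v ∈ gradedPart g ζ) (hinj : Function.Injective v)
    (t : ℕ) : eigenDim g ζ t ≤ eigenDim g ζ (t + 1) := by
  rw [eigenDim, ← LinearMap.finrank_range_of_inj (f := v ∘ₗ (End.eigenspace g (ζ ^ t)).subtype)
    (hinj.comp Subtype.val_injective)]
  refine Submodule.finrank_mono ?_
  rintro _ ⟨⟨u, hu⟩, rfl⟩
  rw [End.mem_eigenspace_iff] at hu ⊢
  rw [pow_succ]
  exact apply_eigenvector_of_mem_gradedPart hv hu

theorem eigenDim_eq_of_injective (hζ : ζ ^ 3 = 1) (hv : v ∈ gradedPart g ζ)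
    (hinj : Function.Injective v) :
    eigenDim g ζ 1 = eigenDim g ζ 0 ∧ eigenDim g ζ 2 = eigenDim g ζ 0 := by
  have h0 := eigenDim_le_succ_of_injective hv hinj 0
  have h1 := eigenDim_le_succ_of_injective hv hinj 1
  have h2 := eigenDim_le_succ_of_injective hv hinj 2
  have h3 := eigenDim_add_three (g := g) hζ 0
  simp only [zero_add, Nat.reduceAdd] at h0 h1 h2 h3
  omega

theorem eigenDim_add_of_prod {U₁ U₂ : Type*} [AddCommGroup U₁] [Module F U₁] [AddCommGroup U₂]
    [Module F U₂] [FiniteDimensional F U₁] [FiniteDimensional F U₂] (e : (U₁ × U₂) ≃ₗ[F] 𝕍)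
    {g₁ : End F U₁} {g₂ : End F U₂} (hge : ∀ a b, g (e (a, b)) = e (g₁ a, g₂ b)) (t : ℕ) :
    eigenDim g ζ t = eigenDim g₁ ζ t + eigenDim g₂ ζ t := by
  let f := e.toLinearMap ∘ₗ (End.eigenspace g₁ (ζ ^ t)).subtype.prodMap
    (End.eigenspace g₂ (ζ ^ t)).subtype
  have hf : Function.Injective f :=
    e.injective.comp (Subtype.val_injective.prodMap Subtype.val_injective)
  rw [eigenDim, eigenDim, eigenDim, ← finrank_prod, ← LinearMap.finrank_range_of_inj hf]
  suffices h : End.eigenspace g (ζ ^ t) = LinearMap.range f by rw [h]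
  ext u
  obtain ⟨⟨a, b⟩, rfl⟩ := e.surjective u
  rw [End.mem_eigenspace_iff, hge, ← map_smul, e.injective.eq_iff, Prod.smul_mk, Prod.mk.injEq]
  constructor
  · rintro ⟨h1, h2⟩
    exact ⟨(⟨a, End.mem_eigenspace_iff.2 h1⟩, ⟨b, End.mem_eigenspace_iff.2 h2⟩), rfl⟩
  · rintro ⟨⟨⟨a', ha⟩, ⟨b', hb⟩⟩, h⟩
    obtain ⟨rfl, rfl⟩ := Prod.mk.inj (e.injective h)
    exact ⟨End.mem_eigenspace_iff.1 ha, End.mem_eigenspace_iff.1 hb⟩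

/-- The Fitting decomposition of `𝕍` with respect to `v ∈ 𝔤₁` is stable under `g`. -/
theorem exists_fitting (hζ : ζ ≠ 0) (hv : v ∈ gradedPart g ζ) :
    ∃ (N I : Submodule F 𝕍) (e : (N × I) ≃ₗ[F] 𝕍) (g₁ v₁ : End F N) (g₂ v₂ : End F I),
      (∀ a b, g (e (a, b)) = e (g₁ a, g₂ b)) ∧ (∀ a b, v (e (a, b)) = e (v₁ a, v₂ b)) ∧
      IsNilpotent v₁ ∧ Function.Injective v₂ := by
  obtain ⟨n, hn, h1⟩ := ((Filter.eventually_ge_atTop 1).and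
    (LinearMap.eventually_isCompl_ker_pow_range_pow v)).exists
  have hc : ∀ u, g ((v ^ n) u) = ζ ^ n • (v ^ n) (g u) :=
    mul_apply_of_mem_gradedPart (pow_mem_gradedPart hv n)
  have hcv : ∀ u, v ((v ^ n) u) = (v ^ n) (v u) := fun u => by
    rw [← Module.End.mul_apply, ← Module.End.mul_apply, ← pow_succ, ← pow_succ']
  have gN : ∀ a ∈ LinearMap.ker (v ^ n), g a ∈ LinearMap.ker (v ^ n) := fun a ha => by
    have h := hc a
    rw [LinearMap.mem_ker.1 ha, map_zero, eq_comm, smul_eq_zero] at h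
    exact h.resolve_left (pow_ne_zero n hζ)
  have vN : ∀ a ∈ LinearMap.ker (v ^ n), v a ∈ LinearMap.ker (v ^ n) := fun a ha => by
    rw [LinearMap.mem_ker, ← hcv, LinearMap.mem_ker.1 ha, map_zero]
  have gI : ∀ a ∈ LinearMap.range (v ^ n), g a ∈ LinearMap.range (v ^ n) := by
    rintro _ ⟨a, rfl⟩
    exact ⟨ζ ^ n • g a, by rw [hc, map_smul]⟩
  have vI : ∀ a ∈ LinearMap.range (v ^ n), v a ∈ LinearMap.range (v ^ n) := by
    rintro _ ⟨a, rfl⟩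
    exact ⟨v a, by rw [hcv]⟩
  refine ⟨_, _, Submodule.prodEquivOfIsCompl _ _ h1, g.restrict gN, v.restrict vN, g.restrict gI,
    v.restrict vI, fun a b => ?_, fun a b => ?_, ⟨n, ?_⟩, ?_⟩
  · simp
  · simp
  · rw [Module.End.pow_restrict]
    exact LinearMap.ext fun a => Subtype.ext a.2
  · rw [← LinearMap.ker_eq_bot, LinearMap.ker_eq_bot']
    rintro ⟨b, hb⟩ h
    have hb0 : v b = 0 := congrArg Subtype.val h
    refine Subtype.ext (Submodule.disjoint_def.1 h1.disjoint b ?_ hb)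
    obtain ⟨m, rfl⟩ := Nat.exists_eq_add_of_le' hn
    rw [LinearMap.mem_ker, pow_succ, Module.End.mul_apply, hb0, map_zero]

/-- If `v ∈ 𝔤₁` is not nilpotent, and two eigenspaces of `g` have dimension `2`, the slice kernel of
`v` in some direction has dimension at most `2`. -/
theorem exists_finrank_sliceKernel_le_two_of_not_isNilpotent [CharZero F] (hg : g ^ 3 = 1)
    (hζ : IsPrimitiveRoot ζ 3) (h0 : eigenDim g ζ 0 = 2) (h1 : eigenDim g ζ 1 = 2)
    (hv : v ∈ gradedPart g ζ) (hnil : ¬ IsNilpotent v) :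
    ∃ η ∈ gradedPart g ζ, finrank F (sliceKernel g ζ v η) ≤ 2 := by
  have hζ0 : ζ ≠ 0 := hζ.ne_zero (by norm_num)
  obtain ⟨N, I, e, g₁, v₁, g₂, v₂, hge, hve, ⟨n, hn⟩, hinj⟩ := exists_fitting hζ0 hv
  have hpow : ∀ {w : End F 𝕍} {w₁ : End F N} {w₂ : End F I}, (∀ a b, w (e (a, b)) = e (w₁ a, w₂ b)) →
      ∀ (n : ℕ) a b, (w ^ n) (e (a, b)) = e ((w₁ ^ n) a, (w₂ ^ n) b) := fun {w w₁ w₂} h n => by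
    induction n with
    | zero => simp
    | succ n ih => intro a b; simp only [pow_succ, Module.End.mul_apply, h, ih]
  have hg₁ : g₁ ^ 3 = 1 := LinearMap.ext fun a => by
    have := hpow hge 3 a 0
    rw [hg, Module.End.one_apply, e.injective.eq_iff] at this
    exact (congrArg Prod.fst this).symm
  have hg₂ : g₂ ^ 3 = 1 := LinearMap.ext fun a => by
    have := hpow hge 3 0 a
    rw [hg, Module.End.one_apply, e.injective.eq_iff] at this
    exact (congrArg Prod.snd this).symm
  have hv₁ : v₁ ∈ gradedPart g₁ ζ := mem_gradedPart.2 (LinearMap.ext fun a => by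
    have := mul_apply_of_mem_gradedPart hv (e (a, 0))
    rw [hve, hge, hge, hve, ← map_smul, e.injective.eq_iff] at this
    exact congrArg Prod.fst this)
  have hv₂ : v₂ ∈ gradedPart g₂ ζ := mem_gradedPart.2 (LinearMap.ext fun a => by
    have := mul_apply_of_mem_gradedPart hv (e (0, a))
    rw [hve, hge, hge, hve, ← map_smul, e.injective.eq_iff] at this
    exact congrArg Prod.snd this)
  have hd := eigenDim_add_of_prod (ζ := ζ) e hge
  obtain ⟨d1, d2⟩ := eigenDim_eq_of_injective hζ.pow_eq_one hv₂ hinj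
  have hd0 := hd 0
  have hd1 := hd 1
  have hd2 := hd 2
  have hpos : eigenDim g₂ ζ 0 ≠ 0 := fun h => by
    have h3 : (3 : F) ≠ 0 := by norm_num
    obtain ⟨b, -⟩ := exists_basis_sum hg₂ h3 hζ
    rw [h] at d1 d2
    rw [d1, d2, h] at b
    have hsub : ∀ a : I, a = 0 := fun a => b.ext_elem (by rintro (i | i | i) <;> exact i.elim0)
    refine hnil ⟨n, LinearMap.ext fun u => ?_⟩
    obtain ⟨⟨a, a'⟩, rfl⟩ := e.surjective u
    rw [hpow hve, hn, hsub a', map_zero]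
    exact map_zero e
  -- The two summands are treated separately.
  obtain ⟨η₁, hη₁, k1⟩ : ∃ η ∈ gradedPart g₁ ζ,
      finrank F (sliceKernel g₁ ζ v₁ η) ≤ 2 - eigenDim g₂ ζ 0 := by
    have r2 : eigenDim (ζ ^ 1 • g₁) ζ 2 = eigenDim g₁ ζ 1 := eigenDim_pow_smul hζ0 1 1
    have r1 : eigenDim (ζ ^ 1 • g₁) ζ 1 = eigenDim g₁ ζ 0 := eigenDim_pow_smul hζ0 1 0
    have r0 : eigenDim (ζ ^ 1 • g₁) ζ 0 = eigenDim g₁ ζ 2 := by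
      rw [← eigenDim_add_three hζ.pow_eq_one, ← eigenDim_pow_smul hζ0 1 2]
    have hg₁' := pow_smul_pow_three hζ.pow_eq_one hg₁ 1
    have hv₁' : v₁ ∈ gradedPart (ζ ^ 1 • g₁) ζ := by
      rwa [smul_gradedPart _ (pow_ne_zero 1 hζ0)]
    by_cases hz : eigenDim g₁ ζ 1 = 0
    · obtain ⟨η, hη, h⟩ := exists_finrank_sliceKernel_le_zero hg₁' hζ (by rw [r2, hz]) hv₁'
      rw [smul_gradedPart _ (pow_ne_zero 1 hζ0)] at hη
      rw [sliceKernel_pow_smul hζ0] at h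
      exact ⟨η, hη, by omega⟩
    by_cases hz2 : eigenDim g₁ ζ 2 = 0
    · obtain ⟨η, hη, h⟩ := exists_finrank_sliceKernel_le_zero hg₁ hζ hz2 hv₁
      exact ⟨η, hη, by omega⟩
    · obtain ⟨η, hη, h⟩ := exists_finrank_sliceKernel_le_one hg₁' hζ (by rw [r0]; exact hz2)
        (by rw [r1]; omega) (by rw [r2]; omega) hv₁'
      rw [smul_gradedPart _ (pow_ne_zero 1 hζ0)] at hη
      rw [sliceKernel_pow_smul hζ0] at h
      exact ⟨η, hη, by omega⟩
  obtain ⟨η₂, hη₂, k2⟩ : ∃ η ∈ gradedPart g₂ ζ,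
      finrank F (sliceKernel g₂ ζ v₂ η) ≤ eigenDim g₂ ζ 0 := by
    by_cases hk : eigenDim g₂ ζ 0 = 1
    · rw [hk]
      exact exists_finrank_sliceKernel_le_one hg₂ hζ hpos (by omega) (by omega) hv₂
    · have hk2 : eigenDim g₂ ζ 0 = 2 := by omega
      rw [hk2]
      exact exists_finrank_sliceKernel_le_two_of_injective hg₂ hζ hv₂ hinj hk2
  have hηe : ∀ a b, e.conj (η₁.prodMap η₂) (e (a, b)) = e (η₁ a, η₂ b) := fun a b => by
    simp [LinearEquiv.conj_apply]
  have hη : e.conj (η₁.prodMap η₂) ∈ gradedPart g ζ := mem_gradedPart.2 (LinearMap.ext fun u => by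
    obtain ⟨⟨a, b⟩, rfl⟩ := e.surjective u
    rw [Module.End.mul_apply, LinearMap.smul_apply, Module.End.mul_apply, hηe, hge, hge, hηe,
      mul_apply_of_mem_gradedPart hη₁, mul_apply_of_mem_gradedPart hη₂, ← map_smul e]
    rfl)
  refine ⟨_, hη, (finrank_sliceKernel_le_add hg (by norm_num) hζ.pow_eq_one hv hη e hge hve hηe
    (fun y hy => ?_) fun y hy => ?_).trans (by omega : _ + _ ≤ 2)⟩
  · have h : ∀ (n : ℕ) b, (v₁ ^ n) (y b) = y ((v₂ ^ n) b) := fun n => by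
      induction n with
      | zero => simp
      | succ n ih => intro b; simp only [pow_succ, Module.End.mul_apply, hy, ih]
    have hs : Function.Surjective ⇑(v₂ ^ n) := by
      rw [Module.End.coe_pow]
      exact (LinearMap.injective_iff_surjective.1 hinj).iterate n
    refine LinearMap.ext fun b => ?_
    obtain ⟨b, rfl⟩ := hs b
    rw [← h, hn, LinearMap.zero_apply, LinearMap.zero_apply]
  · have h : ∀ (n : ℕ) b, (v₂ ^ n) (y b) = y ((v₁ ^ n) b) := fun n => by
      induction n with
      | zero => simp
      | succ n ih => intro b; simp only [pow_succ, Module.End.mul_apply, hy, ih]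
    have hs : Function.Injective ⇑(v₂ ^ n) := by
      rw [Module.End.coe_pow]
      exact hinj.iterate n
    refine LinearMap.ext fun b => hs ?_
    rw [h, hn, LinearMap.zero_apply, LinearMap.zero_apply, map_zero, map_zero]

end Fitting

/-! ### Homogeneous Jordan bases -/

section JordanBasis

/-- A basis consisting of the Jordan chains of a nilpotent `v ∈ 𝔤₁`: the chain with index `k` starts
with an eigenvector of `g` with eigenvalue `ζ ^ (c k).1` and has length `(c k).2`. -/
structure IsJordanBasis {F 𝕍 ι : Type*} [Field F] [AddCommGroup 𝕍] [Module F 𝕍] (g v : End F 𝕍)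
    (ζ : F) (c : ι → ℕ × ℕ) (b : Basis (Σ k : ι, Fin (c k).2) F 𝕍) : Prop where
  apply_g : ∀ k s, g (b ⟨k, s⟩) = ζ ^ ((c k).1 + s) • b ⟨k, s⟩
  apply_succ : ∀ (k : ι) (s : ℕ) (h : s + 1 < (c k).2),
    v (b ⟨k, ⟨s, (Nat.lt_succ_self s).trans h⟩⟩) = b ⟨k, ⟨s + 1, h⟩⟩
  apply_last : ∀ (k : ι) (s : Fin (c k).2), s + 1 = (c k).2 → v (b ⟨k, s⟩) = 0

variable {F : Type*} [Field F] {ζ : F}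

/-- A square Hankel system with nonzero antidiagonal, and zeros below it, has only the trivial
solution. -/
theorem eq_zero_of_antitriangular {l : ℕ} {m : ℕ → F} (hm : m (l - 1) ≠ 0)
    (hm0 : ∀ s, l ≤ s → m s = 0) {a : Fin l → F}
    (h : ∀ s : Fin l, ∑ t : Fin l, a t * m (s + t) = 0) : a = 0 := by
  have key : ∀ n (hn : n < l), a ⟨n, hn⟩ = 0 := fun n => by
    induction n using Nat.strong_induction_on with
    | _ n ih =>
      intro hn
      have h1 := h ⟨l - 1 - n, by omega⟩
      rw [Finset.sum_eq_single ⟨n, hn⟩] at h1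
      · rw [show l - 1 - n + n = l - 1 by omega] at h1
        exact (mul_eq_zero.1 h1).resolve_right hm
      · rintro ⟨t, ht⟩ - hne
        rcases lt_or_gt_of_ne (fun h => hne (Fin.ext h) : t ≠ n) with h2 | h2
        · rw [ih t h2 ht, zero_mul]
        · rw [hm0 _ (by dsimp only; omega), mul_zero]
      · exact fun h => absurd (Finset.mem_univ _) h
  exact funext fun i => key i i.2

/-- The index type of a Jordan basis with an additional chain. -/
def sigmaOptionEquiv {ι : Type*} (c : ι → ℕ × ℕ) (p : ℕ × ℕ) :
    ((Σ k : ι, Fin (c k).2) ⊕ Fin p.2) ≃ Σ k : Option ι, Fin (k.elim p c).2 where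
  toFun := Sum.elim (fun x => ⟨some x.1, x.2⟩) fun s => ⟨none, s⟩
  invFun x := match x with
    | ⟨some k, s⟩ => .inl ⟨k, s⟩
    | ⟨none, s⟩ => .inr s
  left_inv := by rintro (_ | _) <;> rfl
  right_inv := by rintro ⟨_ | _, _⟩ <;> rfl

/-- Splitting off a longest Jordan chain: a homogeneous functional which does not vanish on its end
defines a complement. -/
theorem exists_chain_complement {𝕍 : Type*} [AddCommGroup 𝕍] [Module F 𝕍] [FiniteDimensional F 𝕍]
    [Nontrivial 𝕍] {g v : End F 𝕍} (hg : g ^ 3 = 1) (h3 : (3 : F) ≠ 0) (hζ : IsPrimitiveRoot ζ 3)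
    (hv : v ∈ gradedPart g ζ) (hnil : IsNilpotent v) :
    ∃ (i l : ℕ) (w : 𝕍) (U : Submodule F 𝕍) (e : (U × (Fin l → F)) ≃ₗ[F] 𝕍), i < 3 ∧ 1 ≤ l ∧
      g w = ζ ^ i • w ∧ (v ^ l) w = 0 ∧ (∀ u a, e (u, a) = u + ∑ s, a s • (v ^ (s : ℕ)) w) ∧
      (∀ u ∈ U, g u ∈ U) ∧ ∀ u ∈ U, v u ∈ U := by
  have hζ0 : ζ ≠ 0 := hζ.ne_zero (by norm_num)
  set l := nilpotencyClass v with hl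
  have hl0 : 0 < l := pos_nilpotencyClass_iff.2 hnil
  have hvl : v ^ l = 0 := pow_nilpotencyClass hnil
  have hvl' : v ^ (l - 1) ≠ 0 := pow_pred_nilpotencyClass hnil
  obtain ⟨b, hX, hY, hZ⟩ := exists_basis_sum hg h3 hζ
  let d : Fin (eigenDim g ζ 0) ⊕ Fin (eigenDim g ζ 1) ⊕ Fin (eigenDim g ζ 2) → Fin 3 :=
    Sum.elim (fun _ => 0) (Sum.elim (fun _ => 1) fun _ => 2)
  have hb : ∀ i, g (b i) = ζ ^ (d i : ℕ) • b i := by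
    rintro (i | i | i)
    · simpa [d] using hX i
    · simpa [d] using hY i
    · simpa [d] using hZ i
  obtain ⟨i₀, hi₀⟩ : ∃ i, (v ^ (l - 1)) (b i) ≠ 0 := by
    by_contra! h
    exact hvl' (b.ext h)
  obtain ⟨j, hj⟩ : ∃ j, b.coord j ((v ^ (l - 1)) (b i₀)) ≠ 0 := by
    by_contra! h
    exact hi₀ (b.ext_elem fun j => by rw [map_zero]; exact h j)
  set w := b i₀
  set f := b.coord j
  have hfg : ∀ u, f (g u) = ζ ^ (d j : ℕ) * f u := fun u => by
    have : f ∘ₗ g = ζ ^ (d j : ℕ) • f := b.ext fun i => by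
      rw [LinearMap.comp_apply, hb, map_smul, LinearMap.smul_apply]
      rcases eq_or_ne i j with rfl | hij
      · rfl
      · simp [f, Finsupp.single_eq_of_ne' hij]
    exact LinearMap.congr_fun this u
  have hgv : ∀ (s : ℕ) u, g ((v ^ s) u) = ζ ^ s • (v ^ s) (g u) := fun s =>
    mul_apply_of_mem_gradedPart (pow_mem_gradedPart hv s)
  let Φ : 𝕍 →ₗ[F] (Fin l → F) := LinearMap.pi fun s => f ∘ₗ v ^ (s : ℕ)
  let Ψ : (Fin l → F) →ₗ[F] 𝕍 := Fintype.linearCombination F fun s : Fin l => (v ^ (s : ℕ)) w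
  have hΦ : ∀ u s, Φ u s = f ((v ^ (s : ℕ)) u) := fun u s => rfl
  have hΨ : ∀ a, Ψ a = ∑ s, a s • (v ^ (s : ℕ)) w := fun a => Fintype.linearCombination_apply ..
  have hΦΨ : Function.Injective (Φ ∘ₗ Ψ) := by
    rw [← LinearMap.ker_eq_bot, LinearMap.ker_eq_bot']
    intro a ha
    refine eq_zero_of_antitriangular (m := fun s => f ((v ^ s) w)) hj (fun s hs => ?_) fun s => ?_
    · obtain ⟨n, rfl⟩ := Nat.exists_eq_add_of_le hs
      rw [pow_add, hvl, zero_mul, LinearMap.zero_apply, map_zero]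
    · have := congrFun ha s
      rw [LinearMap.comp_apply, hΦ, hΨ, map_sum, map_sum] at this
      simpa only [map_smul, smul_eq_mul, ← Module.End.mul_apply, ← pow_add, Pi.zero_apply] using this
  have he : Function.Bijective ((LinearMap.ker Φ).subtype.coprod Ψ) := by
    constructor
    · rw [← LinearMap.ker_eq_bot, LinearMap.ker_eq_bot']
      rintro ⟨⟨u, hu⟩, a⟩ h
      rw [LinearMap.coprod_apply] at h
      have h1 : a = 0 := hΦΨ (by
        have := congrArg Φ h
        rw [map_add, map_zero] at this
        rw [map_zero, ← this, LinearMap.comp_apply]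
        simp [LinearMap.mem_ker.1 hu])
      subst h1
      rw [map_zero, add_zero] at h
      exact Prod.ext (Subtype.ext h) rfl
    · intro u
      obtain ⟨a, ha⟩ := LinearMap.injective_iff_surjective.1 hΦΨ (Φ u)
      rw [LinearMap.comp_apply] at ha
      exact ⟨(⟨u - Ψ a, by rw [LinearMap.mem_ker, map_sub, ha, sub_self]⟩, a), by simp⟩
  refine ⟨d i₀, l, w, LinearMap.ker Φ, LinearEquiv.ofBijective _ he, (d i₀).2, hl0, hb i₀,
    by rw [hvl, LinearMap.zero_apply], fun u a => ?_, fun u hu => ?_, fun u hu => ?_⟩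
  · rw [LinearEquiv.ofBijective_apply, LinearMap.coprod_apply, hΨ]
    rfl
  · refine LinearMap.mem_ker.2 (funext fun s => ?_)
    have h1 := hfg ((v ^ (s : ℕ)) u)
    rw [hgv, map_smul, ← hΦ u, LinearMap.mem_ker.1 hu, Pi.zero_apply, mul_zero, smul_eq_mul] at h1
    exact (mul_eq_zero.1 h1).resolve_left (pow_ne_zero _ hζ0)
  · refine LinearMap.mem_ker.2 (funext fun s => ?_)
    rw [hΦ, ← Module.End.mul_apply, ← pow_succ, Pi.zero_apply]
    by_cases hs : (s : ℕ) + 1 < l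
    · exact congrFun (LinearMap.mem_ker.1 hu) ⟨s + 1, hs⟩
    · rw [show (s : ℕ) + 1 = l by omega, hvl, LinearMap.zero_apply, map_zero]

/-- Every nilpotent element of `𝔤₁` has a Jordan basis consisting of eigenvectors of `g`. -/
theorem exists_isJordanBasis (h3 : (3 : F) ≠ 0) (hζ : IsPrimitiveRoot ζ 3) (n : ℕ) :
    ∀ {𝕍 : Type*} [AddCommGroup 𝕍] [Module F 𝕍] [FiniteDimensional F 𝕍] {g v : End F 𝕍},
      finrank F 𝕍 = n → g ^ 3 = 1 → v ∈ gradedPart g ζ → IsNilpotent v →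
      ∃ (ι : Type) (_ : Fintype ι) (c : ι → ℕ × ℕ) (b : Basis (Σ k : ι, Fin (c k).2) F 𝕍),
        (∀ k, (c k).1 < 3 ∧ 1 ≤ (c k).2) ∧ IsJordanBasis g v ζ c b := by
  induction n using Nat.strong_induction_on with
  | _ n ih =>
    intro 𝕍 _ _ _ g v hn hg hv hnil
    rcases subsingleton_or_nontrivial 𝕍 with hV | hV
    · exact ⟨Empty, inferInstance, fun x => x.elim, Basis.empty 𝕍, fun x => x.elim,
        fun x => x.elim, fun x => x.elim, fun x => x.elim⟩
    obtain ⟨i, l, w, U, e, hi, hl, hgw, hvw, he, hgU, hvU⟩ :=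
      exists_chain_complement hg h3 hζ hv hnil
    have hfin : finrank F U < n := by
      rw [← hn, ← e.finrank_eq, finrank_prod, finrank_fintype_fun_eq_card, Fintype.card_fin]
      omega
    obtain ⟨N, hN⟩ := hnil
    obtain ⟨ι, hι, c, b, hc, hb⟩ := ih _ hfin (g := g.restrict hgU) (v := v.restrict hvU) rfl
      (by
        rw [Module.End.pow_restrict]
        refine LinearMap.ext fun u => Subtype.ext ?_
        change (g ^ 3) u.1 = u.1
        rw [hg]
        rfl)
      (mem_gradedPart.2 (LinearMap.ext fun u => Subtype.ext (mul_apply_of_mem_gradedPart hv u.1)))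
      ⟨N, by
        rw [Module.End.pow_restrict]
        refine LinearMap.ext fun u => Subtype.ext ?_
        change (v ^ N) u.1 = 0
        rw [hN]
        rfl⟩
    let b' : Basis (Σ k : Option ι, Fin (k.elim (i, l) c).2) F 𝕍 :=
      ((b.prod (Pi.basisFun F (Fin l))).map e).reindex (sigmaOptionEquiv c (i, l))
    have hsome : ∀ k s, b' ⟨some k, s⟩ = b ⟨k, s⟩ := fun k s => by
      have h1 : b' (sigmaOptionEquiv c (i, l) (.inl ⟨k, s⟩)) = b ⟨k, s⟩ := by
        rw [Basis.reindex_apply, Equiv.symm_apply_apply, Basis.map_apply, Basis.prod_apply]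
        simp [he]
      exact h1
    have hnone : ∀ s : Fin l, b' ⟨none, s⟩ = (v ^ (s : ℕ)) w := fun s => by
      have h1 : b' (sigmaOptionEquiv c (i, l) (.inr s)) = (v ^ (s : ℕ)) w := by
        rw [Basis.reindex_apply, Equiv.symm_apply_apply, Basis.map_apply, Basis.prod_apply]
        simp [he, Pi.single_apply]
      exact h1
    refine ⟨Option ι, inferInstance, fun k => k.elim (i, l) c, b', ?_, ?_, ?_, ?_⟩
    · rintro (_ | k)
      exacts [⟨hi, hl⟩, hc k]
    · rintro (_ | k) s
      · have h1 := hnone s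
        rw [h1, mul_apply_of_mem_gradedPart (pow_mem_gradedPart hv _), hgw, map_smul, smul_smul,
          ← pow_add, add_comm]
        rfl
      · rw [hsome]
        exact congrArg Subtype.val (hb.apply_g k s)
    · rintro (_ | k) s h
      · have h1 := hnone ⟨s, (Nat.lt_succ_self s).trans h⟩
        have h2 := hnone ⟨s + 1, h⟩
        refine (congrArg v h1).trans (Eq.trans ?_ h2.symm)
        rw [← Module.End.mul_apply, ← pow_succ']
      · rw [hsome k ⟨s + 1, h⟩, hsome]
        exact congrArg Subtype.val (hb.apply_succ k s h)
    · rintro (_ | k) s h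
      · have h1 := hnone s
        rw [h1, ← Module.End.mul_apply, ← pow_succ', h]
        exact hvw
      · rw [hsome]
        exact congrArg Subtype.val (hb.apply_last k s h)

end JordanBasis

/-! ### Slice kernels in the coordinates of a Jordan basis -/

section ChainCoordinates

theorem IsPrimitiveRoot.pow_eq_pow_iff_mod_three {F : Type*} [Field F] {ζ : F}
    (hζ : IsPrimitiveRoot ζ 3) {m n : ℕ} : ζ ^ m = ζ ^ n ↔ m % 3 = n % 3 := by
  rw [pow_eq_pow_mod m hζ.pow_eq_one, pow_eq_pow_mod n hζ.pow_eq_one]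
  exact ⟨fun h => hζ.pow_inj (Nat.mod_lt _ (by norm_num)) (Nat.mod_lt _ (by norm_num)) h,
    fun h => by rw [h]⟩

variable {F 𝕍 ι : Type*} [Field F] [AddCommGroup 𝕍] [Module F 𝕍] {g v : End F 𝕍} {ζ : F}
  {c : ι → ℕ × ℕ}

/-- The vector `v ^ s w` of the Jordan chain with index `k` and first vector `w`. -/
noncomputable def chainVec (b : Basis (Σ k : ι, Fin (c k).2) F 𝕍) (k : ι) (s : ℕ) : 𝕍 :=
  if h : s < (c k).2 then b ⟨k, ⟨s, h⟩⟩ else 0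

/-- The coordinate functional of `chainVec b k s`, zero if `s` exceeds the length of the chain. -/
noncomputable def chainCoord (b : Basis (Σ k : ι, Fin (c k).2) F 𝕍) (k : ι) (s : ℕ) : Dual F 𝕍 :=
  if h : s < (c k).2 then b.coord ⟨k, ⟨s, h⟩⟩ else 0

variable {b : Basis (Σ k : ι, Fin (c k).2) F 𝕍}

theorem basis_eq_chainVec (k : ι) (s : Fin (c k).2) : b ⟨k, s⟩ = chainVec b k s := by
  rw [chainVec, dif_pos s.2]

theorem chainVec_of_le {k : ι} {s : ℕ} (h : (c k).2 ≤ s) : chainVec b k s = 0 :=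
  dif_neg (Nat.not_lt.2 h)

theorem chainCoord_of_le {k : ι} {s : ℕ} (h : (c k).2 ≤ s) : chainCoord b k s = 0 :=
  dif_neg (Nat.not_lt.2 h)

theorem chainCoord_chainVec [DecidableEq ι] (k m : ι) (s t : ℕ) :
    chainCoord b k s (chainVec b m t) = if m = k ∧ t = s ∧ t < (c m).2 then 1 else 0 := by
  by_cases ht : t < (c m).2
  · by_cases hs : s < (c k).2
    · rw [chainCoord, dif_pos hs, chainVec, dif_pos ht, Basis.coord_apply, Basis.repr_self,
        Finsupp.single_apply]
      refine if_congr ⟨fun h => ?_, ?_⟩ rfl rfl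
      · obtain ⟨rfl, h⟩ := Sigma.mk.inj h
        exact ⟨rfl, congrArg Fin.val (eq_of_heq h), ht⟩
      · rintro ⟨rfl, rfl, -⟩
        rfl
    · rw [chainCoord_of_le (Nat.not_lt.1 hs), LinearMap.zero_apply, if_neg]
      rintro ⟨rfl, rfl, h⟩
      exact hs h
  · rw [chainVec_of_le (Nat.not_lt.1 ht), map_zero, if_neg fun h => ht h.2.2]

theorem eq_zero_of_chainCoord {u : 𝕍} (h : ∀ k s, s < (c k).2 → chainCoord b k s u = 0) : u = 0 := by
  refine b.ext_elem ?_
  rintro ⟨k, s⟩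
  have := h k s s.2
  rw [chainCoord, dif_pos s.2] at this
  rw [map_zero]
  exact this

theorem linearMap_eq_of_chainVec {M : Type*} [AddCommGroup M] [Module F M] {x y : 𝕍 →ₗ[F] M}
    (h : ∀ k s, s < (c k).2 → x (chainVec b k s) = y (chainVec b k s)) : x = y := by
  refine b.ext ?_
  rintro ⟨k, s⟩
  rw [basis_eq_chainVec]
  exact h k s s.2

namespace IsJordanBasis

variable (hb : IsJordanBasis g v ζ c b)
include hb

theorem apply_chainVec (k : ι) (s : ℕ) : v (chainVec b k s) = chainVec b k (s + 1) := by
  rcases lt_trichotomy (s + 1) (c k).2 with h | h | h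
  · rw [chainVec, dif_pos ((Nat.lt_succ_self s).trans h), chainVec, dif_pos h, hb.apply_succ k s h]
  · rw [chainVec_of_le h.ge, chainVec, dif_pos (by omega), hb.apply_last _ _ h]
  · rw [chainVec_of_le h.le, chainVec_of_le (by omega), map_zero]

theorem pow_apply_chainVec (k : ι) (s n : ℕ) : (v ^ n) (chainVec b k s) = chainVec b k (s + n) := by
  induction n with
  | zero => simp
  | succ n ih => rw [pow_succ', Module.End.mul_apply, ih, hb.apply_chainVec, add_assoc]

theorem g_chainVec (k : ι) (s : ℕ) : g (chainVec b k s) = ζ ^ ((c k).1 + s) • chainVec b k s := by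
  by_cases h : s < (c k).2
  · rw [chainVec, dif_pos h, hb.apply_g]
  · rw [chainVec_of_le (Nat.not_lt.1 h), map_zero, smul_zero]

theorem chainCoord_zero_apply (k : ι) (u : 𝕍) : chainCoord b k 0 (v u) = 0 := by
  classical
  have : chainCoord b k 0 ∘ₗ v = 0 := linearMap_eq_of_chainVec (b := b) fun m t _ => by
    rw [LinearMap.comp_apply, hb.apply_chainVec, chainCoord_chainVec, if_neg (by simp)]
    rfl
  exact LinearMap.congr_fun this u

theorem chainCoord_succ_apply {k : ι} {s : ℕ} (h : s + 1 < (c k).2) (u : 𝕍) :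
    chainCoord b k (s + 1) (v u) = chainCoord b k s u := by
  classical
  have : chainCoord b k (s + 1) ∘ₗ v = chainCoord b k s :=
    linearMap_eq_of_chainVec (b := b) fun m t _ => by
      rw [LinearMap.comp_apply, hb.apply_chainVec, chainCoord_chainVec, chainCoord_chainVec]
      refine if_congr ⟨?_, ?_⟩ rfl rfl
      · rintro ⟨rfl, h1, h2⟩
        exact ⟨rfl, by omega, by omega⟩
      · rintro ⟨rfl, rfl, h2⟩
        exact ⟨rfl, rfl, h⟩
  exact LinearMap.congr_fun this u

theorem chainCoord_pow_apply {k : ι} {s : ℕ} (h : s < (c k).2) (n : ℕ) (u : 𝕍) :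
    chainCoord b k s ((v ^ n) u) = if n ≤ s then chainCoord b k (s - n) u else 0 := by
  induction n generalizing s with
  | zero => simp
  | succ n ih =>
    rw [pow_succ', Module.End.mul_apply]
    rcases s with _ | s
    · rw [hb.chainCoord_zero_apply, if_neg (by omega)]
    · rw [hb.chainCoord_succ_apply h, ih (by omega), Nat.add_sub_add_right]
      simp only [Nat.add_le_add_iff_right]

theorem chainCoord_eq_zero_of_eigenvector (hζ : IsPrimitiveRoot ζ 3) {k : ι} {s d : ℕ} {u : 𝕍}
    (hu : g u = ζ ^ d • u) (h : ((c k).1 + s) % 3 ≠ d % 3) : chainCoord b k s u = 0 := by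
  by_cases hs : s < (c k).2
  · rw [chainCoord, dif_pos hs]
    refine repr_eq_zero_of_eigenvector b (d := fun x => ζ ^ ((c x.1).1 + x.2)) (fun x => hb.apply_g _ _)
      hu fun h' => h ?_
    exact hζ.pow_eq_pow_iff_mod_three.1 h'
  · rw [chainCoord_of_le (Nat.not_lt.1 hs), LinearMap.zero_apply]

end IsJordanBasis

/-- The direction `η ∈ 𝔤₁` which maps the last vector of the chain with index `k` to the `w k`-fold of
the vector in place `t k` of the chain with index `m k`. -/
noncomputable def linkMap [Fintype ι] (b : Basis (Σ k : ι, Fin (c k).2) F 𝕍) (m : ι → ι)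
    (t w : ι → ℕ) : End F 𝕍 :=
  ∑ k, (chainCoord b k ((c k).2 - 1)).smulRight ((w k : F) • chainVec b (m k) (t k))

variable [Fintype ι] {m : ι → ι} {t w : ι → ℕ}

theorem linkMap_apply (u : 𝕍) : linkMap b m t w u =
    ∑ k, chainCoord b k ((c k).2 - 1) u • (w k : F) • chainVec b (m k) (t k) := by
  simp [linkMap]

theorem linkMap_chainVec [DecidableEq ι] (hc : ∀ k, 1 ≤ (c k).2) (k : ι) (s : ℕ) :
    linkMap b m t w (chainVec b k s) =
      if s + 1 = (c k).2 then (w k : F) • chainVec b (m k) (t k) else 0 := by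
  rw [linkMap_apply, Finset.sum_eq_single k]
  · have := hc k
    rw [chainCoord_chainVec]
    split_ifs with h1 h2 h2
    · rw [one_smul]
    · exact absurd (by omega) h2
    · exact absurd ⟨rfl, by omega, by omega⟩ h1
    · rw [zero_smul]
  · intro j _ hj
    rw [chainCoord_chainVec, if_neg fun h => hj h.1.symm, zero_smul]
  · exact fun h => absurd (Finset.mem_univ _) h

theorem linkMap_mem_gradedPart (hζ : ζ ^ 3 = 1) (hb : IsJordanBasis g v ζ c b)
    (hc : ∀ k, 1 ≤ (c k).2)
    (hw : ∀ k, w k ≠ 0 → ((c (m k)).1 + t k) % 3 = ((c k).1 + (c k).2) % 3) :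
    linkMap b m t w ∈ gradedPart g ζ := by
  classical
  refine mem_gradedPart.2 (linearMap_eq_of_chainVec (b := b) fun k s hs => ?_)
  rw [Module.End.mul_apply, LinearMap.smul_apply, Module.End.mul_apply, hb.g_chainVec, map_smul,
    linkMap_chainVec hc]
  split_ifs with h
  · by_cases hk : w k = 0
    · simp [hk]
    · rw [map_smul, hb.g_chainVec, smul_smul ζ, ← pow_succ', smul_comm, add_assoc, h]
      congr 1
      rw [pow_eq_pow_mod _ hζ, hw k hk, ← pow_eq_pow_mod _ hζ]
  · simp

variable {y : End F 𝕍}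

/-- The relations satisfied by the coordinates of an element `y` of the slice kernel at `linkMap`. -/
theorem sum_chainCoord_eq [DecidableEq ι] (hb : IsJordanBasis g v ζ c b) (hc : ∀ k, 1 ≤ (c k).2)
    (hyv : v * y = y * v) {y' : End F 𝕍}
    (hy : y * linkMap b m t w + y' * v = linkMap b m t w * y + v * y') (j n : ι) {s : ℕ}
    (hj : s < (c j).2) (hn : s < (c n).2) :
    (if t j ≤ s then (w j : F) * chainCoord b n (s - t j) (y (chainVec b (m j) 0)) else 0) =
      ∑ k, if m k = n ∧ t k ≤ s ∧ (c j).2 + t k ≤ (c k).2 + s then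
        (w k : F) * chainCoord b k ((c k).2 + s - (c j).2 - t k) (y (chainVec b j 0)) else 0 := by
  have hyp : ∀ (n : ℕ) (u : 𝕍), y ((v ^ n) u) = (v ^ n) (y u) := fun n u => by
    have : Commute (v ^ n) y := Commute.pow_left hyv n
    rw [← Module.End.mul_apply, ← this.eq, Module.End.mul_apply]
  have hychain : ∀ k s, y (chainVec b k s) = (v ^ s) (y (chainVec b k 0)) := fun k s => by
    rw [← hyp, hb.pow_apply_chainVec, zero_add]
  -- The contributions of `y'` telescope along the chain.
  let f : ℕ → F := fun a =>
    if a ≤ s then chainCoord b n (s - a) (y' (chainVec b j ((c j).2 - a))) else 0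
  have hf : ∀ a ∈ Finset.range (s + 1),
      chainCoord b n (s - a) (y (linkMap b m t w (chainVec b j ((c j).2 - 1 - a)))) -
        chainCoord b n (s - a) (linkMap b m t w (y (chainVec b j ((c j).2 - 1 - a)))) =
        f (a + 1) - f a := fun a ha => by
    have ha : a ≤ s := Nat.lt_succ_iff.1 (Finset.mem_range.1 ha)
    have h1 := congrArg (chainCoord b n (s - a)) (LinearMap.congr_fun hy (chainVec b j ((c j).2 - 1 - a)))
    simp only [LinearMap.add_apply, Module.End.mul_apply, map_add] at h1
    rw [hb.apply_chainVec, show (c j).2 - 1 - a + 1 = (c j).2 - a by omega] at h1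
    have h2 : chainCoord b n (s - a) (v (y' (chainVec b j ((c j).2 - 1 - a)))) = f (a + 1) := by
      have := hb.chainCoord_pow_apply (k := n) (s := s - a) (by omega) 1
        (y' (chainVec b j ((c j).2 - 1 - a)))
      rw [pow_one] at this
      rw [this]
      simp only [f, Nat.sub_sub, Nat.add_comm 1 a]
      exact if_congr (by omega) rfl rfl
    have h3 : f a = chainCoord b n (s - a) (y' (chainVec b j ((c j).2 - a))) := if_pos ha
    rw [h2, ← h3] at h1
    linear_combination h1
  have hsum := Finset.sum_congr rfl hf
  have hf0 : f 0 = 0 := by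
    simp only [f, Nat.sub_zero, chainVec_of_le le_rfl, map_zero, ite_self]
  have hfs : f (s + 1) = 0 := if_neg (by omega)
  rw [Finset.sum_range_sub, hf0, hfs, sub_zero, Finset.sum_sub_distrib, sub_eq_zero,
    Finset.sum_eq_single 0] at hsum
  · rw [Nat.sub_zero, Nat.sub_zero, linkMap_chainVec hc, if_pos (by have := hc j; omega), map_smul,
      map_smul, hychain, hb.chainCoord_pow_apply hn, smul_eq_mul, mul_ite, mul_zero] at hsum
    rw [hsum]
    simp_rw [linkMap_apply, map_sum]
    rw [Finset.sum_comm]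
    refine Finset.sum_congr rfl fun k _ => ?_
    simp_rw [map_smul, smul_eq_mul]
    by_cases hk : t k ≤ s
    · rw [Finset.sum_eq_single (s - t k)]
      · rw [hychain, hb.chainCoord_pow_apply (by have := hc k; omega), chainCoord_chainVec]
        have h1 := hc k
        by_cases h2 : m k = n
        · by_cases h3 : (c j).2 + t k ≤ (c k).2 + s
          · rw [if_pos (by omega), if_pos ⟨h2, by omega, by rw [h2]; omega⟩, if_pos ⟨h2, hk, h3⟩,
              mul_one, mul_comm]
            congr 3
            omega
          · rw [if_neg (by omega), zero_mul, if_neg fun h => h3 h.2.2]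
        · simp only [h2, false_and, if_false, mul_zero]
      · intro a ha hne
        rw [Finset.mem_range] at ha
        rw [chainCoord_chainVec, if_neg fun h => hne (by omega), mul_zero, mul_zero]
      · exact fun h => absurd (Finset.mem_range.2 (by omega)) h
    · rw [if_neg fun h => hk h.2.1]
      refine Finset.sum_eq_zero fun a ha => ?_
      rw [chainCoord_chainVec, if_neg fun h => hk (by omega), mul_zero, mul_zero]
  · intro a ha hne
    rw [Finset.mem_range] at ha
    rw [linkMap_chainVec hc, if_neg (by omega), map_zero, map_zero]
  · exact fun h => absurd (Finset.mem_range.2 (by omega)) h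

/-- The coordinates in which an element of degree `2` commuting with `v` can be nonzero. -/
theorem chainCoord_eq_zero_of_not_valid (hζ : IsPrimitiveRoot ζ 3) (hb : IsJordanBasis g v ζ c b)
    (hyv : v * y = y * v) (hyg : y ∈ gradedPart g (ζ ^ 2)) {j k : ι} {r : ℕ}
    (h : (c k).2 ≤ r ∨ r + (c j).2 < (c k).2 ∨ ((c k).1 + r) % 3 ≠ ((c j).1 + 2) % 3) :
    chainCoord b k r (y (chainVec b j 0)) = 0 := by
  by_cases hr : (c k).2 ≤ r
  · rw [chainCoord_of_le hr, LinearMap.zero_apply]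
  rcases (h.resolve_left hr) with h | h
  · have h1 := hb.chainCoord_pow_apply (k := k) (s := r + (c j).2) h (c j).2 (y (chainVec b j 0))
    rw [if_pos (Nat.le_add_left _ _), Nat.add_sub_cancel] at h1
    have hc : Commute (v ^ (c j).2) y := Commute.pow_left hyv _
    rw [← h1, ← Module.End.mul_apply, hc.eq, Module.End.mul_apply, hb.pow_apply_chainVec,
      chainVec_of_le (Nat.le_add_left _ _), map_zero, map_zero]
  · refine hb.chainCoord_eq_zero_of_eigenvector hζ (d := (c j).1 + 2) ?_ h
    rw [apply_eigenvector_of_mem_gradedPart hyg (hb.g_chainVec j 0), add_zero, ← pow_add]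

theorem eq_zero_of_forall_chainCoord (hb : IsJordanBasis g v ζ c b) (hyv : v * y = y * v)
    (h : ∀ j k r, chainCoord b k r (y (chainVec b j 0)) = 0) : y = 0 := by
  refine linearMap_eq_of_chainVec (b := b) fun j s _ => ?_
  have hc : Commute (v ^ s) y := Commute.pow_left hyv _
  rw [← zero_add s, ← hb.pow_apply_chainVec, ← Module.End.mul_apply, ← hc.eq, Module.End.mul_apply,
    eq_zero_of_chainCoord (b := b) fun k r _ => h j k r, map_zero]
  rfl

end ChainCoordinates

/-! ### Linking data for Jordan chains -/

/-- Linking data for a list of Jordan chains. The entry `((i, l), m, t, w)` describes a chain of length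
`l` whose first vector has colour `i`, and whose last vector is sent by the direction `η` to the
`w`-fold of the vector in place `t` of the `m`-th chain. All indices beyond the list stand for chains
of length `1` and colour `2`, killed by `η`. -/
abbrev LinkData := List ((ℕ × ℕ) × ℕ × ℕ × ℕ)

namespace LinkData

variable (R : LinkData)

/-- The colour and length of the `k`-th chain. -/
def chain (k : ℕ) : ℕ × ℕ := (R.getD k ((2, 1), 0, 0, 0)).1

/-- The chain to which the `k`-th chain is linked. -/
def target (k : ℕ) : ℕ := (R.getD k ((2, 1), 0, 0, 0)).2.1

/-- The place in the chain to which the `k`-th chain is linked. -/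
def shift (k : ℕ) : ℕ := (R.getD k ((2, 1), 0, 0, 0)).2.2.1

/-- The coefficient of the link starting at the `k`-th chain, zero if there is no link. -/
def weight (k : ℕ) : ℕ := (R.getD k ((2, 1), 0, 0, 0)).2.2.2

/-- The chain which is linked to the `m`-th one. -/
def source (m : ℕ) : ℕ :=
  R.findIdx fun x => x.2.1 == m && x.2.2.2 != 0

/-- Whether an endomorphism of degree `2` commuting with `v` can have a nonzero `r`-th coordinate in
the `k`-th chain at the first vector of the `j`-th chain. -/
def Admissible (j k r : ℕ) : Prop :=
  r < (R.chain k).2 ∧ (R.chain k).2 ≤ r + (R.chain j).2 ∧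
    ((R.chain k).1 + r) % 3 = ((R.chain j).1 + 2) % 3

instance (j k r : ℕ) : Decidable (R.Admissible j k r) := by unfold Admissible; infer_instance

/-- A numbering of the admissible coordinates; all others are numbered `0`. -/
def code (j k r : ℕ) : ℕ := if R.Admissible j k r then 64 * j + 8 * k + r + 1 else 0

/-- Two coordinates of a slice kernel element which vanish simultaneously. -/
def relation (j n s : ℕ) : ℕ × ℕ :=
  let k := R.source n
  let a := if R.weight j ≠ 0 ∧ R.shift j ≤ s then R.code (R.target j) n (s - R.shift j) else 0
  let b := if R.weight k ≠ 0 ∧ R.target k = n ∧ R.shift k ≤ s ∧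
      (R.chain j).2 + R.shift k ≤ (R.chain k).2 + s then
    R.code j k ((R.chain k).2 + s - (R.chain j).2 - R.shift k) else 0
  if a = b ∧ R.weight j ≠ R.weight k then (a, 0) else (a, b)

/-- All nontrivial relations. -/
def relations : List (ℕ × ℕ) :=
  ((List.range R.length).flatMap fun j => (List.range R.length).flatMap fun n =>
    (List.range (min (R.chain j).2 (R.chain n).2)).map (R.relation j n)).filter fun p => p.1 != p.2

/-- The codes of all coordinates. -/
def codes : List ℕ :=
  (List.range R.length).flatMap fun j => (List.range R.length).flatMap fun k =>
    (List.range (R.chain k).2).map (R.code j k)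

end LinkData

/-- One round of propagating the vanishing of coordinates along the relations; the set of coordinates
known to vanish is encoded by the binary digits of `M`. -/
def propagate (l : List (ℕ × ℕ)) (M : ℕ) : ℕ :=
  l.foldl (fun M p => if M.testBit p.1 || M.testBit p.2 then M ||| (1 <<< p.1) ||| (1 <<< p.2) else M) M

namespace LinkData

variable (R : LinkData)

/-- The first coordinate not known to vanish. -/
def pivot (M : ℕ) : ℕ := (R.codes.find? fun x => !M.testBit x).getD 0

/-- Two rounds of propagation after adding the first coordinate not known to vanish. -/
def extend (M : ℕ) : ℕ :=
  propagate R.relations (propagate R.relations (M ||| (1 <<< R.pivot M)))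

/-- The coordinates which vanish unconditionally. -/
def start : ℕ := propagate R.relations (propagate R.relations 1)

/-- The links are homogeneous and injective. Moreover a chain whose last vector has colour `1` (so that
`v` would lead to colour `2`) is linked to the first vector of a chain, and every chain starting with
colour `0` is reached in this way; this makes all coordinates vanish which involve chains beyond the
list. The bounds on the number and the lengths of the chains make the numbering injective. -/
def IsHomogeneous : Prop :=
  R ≠ [] ∧ R.length ≤ 8 ∧ ∀ k < R.length, 1 ≤ (R.chain k).2 ∧ (R.chain k).2 ≤ 8 ∧
    R.target k < R.length ∧
    (R.weight k ≠ 0 → ((R.chain (R.target k)).1 + R.shift k) % 3 =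
      ((R.chain k).1 + (R.chain k).2) % 3 ∧ R.source (R.target k) = k) ∧
    (((R.chain k).1 + (R.chain k).2) % 3 = 2 → R.weight k ≠ 0 ∧ R.shift k = 0) ∧
    ((R.chain k).1 % 3 = 0 → R.source k < R.length ∧ R.weight (R.source k) ≠ 0 ∧
      R.target (R.source k) = k ∧ R.shift (R.source k) = 0)

instance : Decidable R.IsHomogeneous := by unfold IsHomogeneous; infer_instance

/-- The links are homogeneous, and two suitable coordinates determine all others. -/
def IsGood : Prop :=
  R.IsHomogeneous ∧ ∀ x ∈ R.codes, (R.extend (R.extend R.start)).testBit x = true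

instance : Decidable R.IsGood := by unfold IsGood; infer_instance

end LinkData

/-- Linking data for all configurations of Jordan chains with two basis vectors of colour `0`, two of
colour `1` and at least two of colour `2`, up to additional chains of length `1` and colour `2`. -/
def linkTable : List LinkData := [
  [((0, 2), 3, 0, 1), ((0, 2), 2, 0, 1), ((2, 1), 0, 0, 1), ((2, 1), 1, 0, 1)],
  [((0, 1), 2, 0, 1), ((0, 2), 3, 0, 1), ((1, 1), 4, 0, 1), ((2, 1), 0, 0, 1), ((2, 1), 1, 0, 1)],
  [((0, 1), 2, 0, 1), ((0, 1), 3, 0, 1), ((1, 1), 5, 0, 1), ((1, 1), 4, 0, 1), ((2, 1), 0, 0, 1), ((2, 1), 1, 0, 1)],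
  [((0, 5), 1, 0, 1), ((2, 1), 0, 0, 1)],
  [((0, 2), 1, 0, 1), ((2, 1), 0, 0, 1), ((2, 3), 2, 0, 1)],
  [((0, 2), 2, 0, 1), ((1, 3), 1, 0, 1), ((2, 1), 0, 0, 1)],
  [((0, 2), 2, 0, 1), ((0, 3), 0, 0, 1), ((2, 1), 1, 0, 1)],
  [((0, 4), 1, 0, 1), ((1, 1), 2, 0, 1), ((2, 1), 0, 0, 1)],
  [((0, 2), 3, 0, 1), ((1, 1), 2, 0, 1), ((2, 1), 0, 0, 1), ((2, 2), 1, 0, 1)],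
  [((0, 1), 1, 0, 1), ((1, 4), 2, 0, 1), ((2, 1), 0, 0, 1)],
  [((0, 1), 2, 0, 1), ((0, 2), 3, 0, 1), ((1, 2), 1, 0, 1), ((2, 1), 0, 0, 1)],
  [((0, 1), 1, 0, 1), ((1, 1), 2, 0, 1), ((2, 1), 0, 0, 1), ((2, 3), 3, 0, 1)],
  [((0, 1), 1, 0, 1), ((1, 1), 3, 0, 1), ((1, 3), 2, 0, 1), ((2, 1), 0, 0, 1)],
  [((0, 1), 2, 0, 1), ((0, 3), 0, 0, 1), ((1, 1), 3, 0, 1), ((2, 1), 1, 0, 1)],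
  [((0, 1), 1, 0, 1), ((1, 1), 4, 0, 1), ((1, 1), 3, 0, 1), ((2, 1), 0, 0, 1), ((2, 2), 2, 0, 1)],
  [((0, 1), 2, 0, 1), ((0, 1), 3, 0, 1), ((1, 1), 4, 0, 1), ((1, 2), 0, 0, 1), ((2, 1), 1, 0, 1)],
  [((2, 6), 0, 0, 1)],
  [((1, 6), 0, 0, 1)],
  [((0, 6), 0, 0, 1)],
  [((2, 3), 1, 0, 1), ((2, 3), 0, 0, 1)],
  [((1, 3), 0, 0, 1), ((2, 3), 1, 0, 2)],
  [((1, 3), 1, 0, 1), ((1, 3), 0, 0, 1)],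
  [((0, 3), 0, 0, 1), ((2, 3), 1, 0, 2)],
  [((0, 3), 0, 0, 1), ((1, 3), 1, 0, 2)],
  [((0, 3), 1, 0, 1), ((0, 3), 0, 0, 1)],
  [((1, 4), 1, 0, 1), ((2, 2), 0, 0, 1)],
  [((0, 4), 1, 0, 1), ((1, 2), 0, 0, 1)],
  [((0, 2), 1, 0, 1), ((2, 4), 0, 0, 1)],
  [((0, 2), 2, 0, 1), ((1, 2), 0, 0, 1), ((2, 2), 1, 0, 1)],
  [((1, 1), 1, 0, 1), ((2, 5), 0, 0, 1)],
  [((1, 1), 1, 0, 1), ((2, 2), 0, 0, 1), ((2, 3), 2, 0, 1)],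
  [((1, 1), 2, 0, 1), ((1, 3), 0, 0, 1), ((2, 2), 1, 0, 1)],
  [((0, 3), 0, 0, 1), ((1, 1), 2, 0, 1), ((2, 2), 1, 0, 1)],
  [((1, 1), 3, 0, 1), ((1, 1), 2, 0, 1), ((2, 2), 0, 0, 1), ((2, 2), 1, 0, 1)],
  [((0, 1), 1, 0, 1), ((1, 5), 0, 0, 1)],
  [((0, 1), 1, 0, 1), ((1, 2), 0, 0, 1), ((2, 3), 2, 0, 1)],
  [((0, 1), 1, 0, 1), ((1, 2), 0, 0, 1), ((1, 3), 2, 0, 1)],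
  [((0, 1), 2, 0, 1), ((0, 3), 0, 0, 1), ((1, 2), 1, 0, 1)],
  [((0, 1), 1, 0, 1), ((1, 1), 2, 0, 1), ((2, 4), 0, 0, 1)],
  [((0, 1), 1, 0, 1), ((1, 1), 3, 0, 1), ((1, 2), 0, 0, 1), ((2, 2), 2, 0, 1)],
  [((0, 1), 3, 0, 1), ((0, 1), 2, 0, 1), ((1, 2), 0, 0, 1), ((1, 2), 1, 0, 1)],
  [((2, 7), 0, 0, 0)],
  [((2, 3), 1, 0, 1), ((2, 4), 0, 0, 0)],
  [((1, 3), 0, 0, 1), ((2, 4), 0, 0, 0)],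
  [((0, 3), 0, 0, 0), ((2, 4), 0, 0, 1)],
  [((1, 5), 0, 0, 0), ((2, 2), 0, 0, 1)],
  [((1, 2), 0, 0, 0), ((2, 5), 0, 0, 1)],
  [((1, 2), 0, 0, 0), ((2, 2), 0, 0, 1), ((2, 3), 1, 0, 1)],
  [((1, 2), 0, 0, 0), ((1, 3), 0, 0, 1), ((2, 2), 1, 0, 1)],
  [((0, 3), 0, 0, 0), ((1, 2), 0, 0, 1), ((2, 2), 1, 0, 1)],
  [((1, 1), 2, 0, 1), ((2, 2), 0, 0, 1), ((2, 4), 0, 0, 0)],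
  [((1, 1), 3, 0, 1), ((1, 2), 0, 0, 0), ((2, 2), 0, 0, 1), ((2, 2), 1, 0, 1)],
  [((0, 1), 1, 0, 1), ((1, 2), 0, 0, 0), ((2, 4), 0, 0, 1)],
  [((0, 1), 2, 0, 1), ((1, 2), 0, 0, 1), ((1, 2), 0, 0, 0), ((2, 2), 1, 0, 1)],
  [((2, 4), 0, 0, 0), ((2, 4), 0, 1, 1)],
  [((1, 2), 0, 0, 0), ((2, 2), 0, 0, 1), ((2, 4), 1, 1, 1)],
  [((1, 2), 0, 0, 0), ((1, 2), 2, 1, 1), ((2, 2), 0, 0, 1), ((2, 2), 1, 0, 1)]]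

/-- The verification of the table is a finite computation. -/
theorem isGood_of_mem_linkTable : ∀ R ∈ linkTable, R.IsGood := by
  decide +kernel

/-! ### Solutions of the relations between coordinates -/

theorem of_testBit_insert {P : ℕ → Prop} {M a : ℕ} (hM : ∀ x, M.testBit x = true → P x) (ha : P a) :
    ∀ x, (M ||| (1 <<< a)).testBit x = true → P x := fun x hx => by
  rw [Nat.testBit_or, Bool.or_eq_true, Nat.one_shiftLeft, Nat.testBit_two_pow] at hx
  rcases hx with hx | hx
  · exact hM x hx
  · exact of_decide_eq_true hx ▸ ha

theorem of_testBit_propagate {P : ℕ → Prop} {l : List (ℕ × ℕ)} (hl : ∀ p ∈ l, (P p.1 ↔ P p.2))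
    {M : ℕ} (hM : ∀ x, M.testBit x = true → P x) : ∀ x, (propagate l M).testBit x = true → P x := by
  induction l generalizing M with
  | nil => exact hM
  | cons p l ih =>
    refine ih (fun q hq => hl q (List.mem_cons_of_mem _ hq)) ?_
    dsimp only
    split_ifs with h
    · have hp := hl p List.mem_cons_self
      have h1 : P p.1 := by
        rcases Bool.or_eq_true _ _ ▸ h with h | h
        exacts [hM _ h, hp.2 (hM _ h)]
      exact of_testBit_insert (of_testBit_insert hM h1) (hp.1 h1)
    · exact hM

namespace LinkData

variable {R : LinkData}

theorem chain_of_le {k : ℕ} (h : R.length ≤ k) : R.chain k = (2, 1) := by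
  rw [chain, List.getD_eq_default _ _ h]

theorem target_of_le {k : ℕ} (h : R.length ≤ k) : R.target k = 0 := by
  rw [target, List.getD_eq_default _ _ h]

theorem weight_of_le {k : ℕ} (h : R.length ≤ k) : R.weight k = 0 := by
  rw [weight, List.getD_eq_default _ _ h]

/-- The coordinate with number `x`. -/
def decode (x : ℕ) : ℕ × ℕ × ℕ := ((x - 1) / 64, (x - 1) / 8 % 8, (x - 1) % 8)

/-- The family of coordinates `C` satisfies the relations which hold in a slice kernel. -/
structure IsSolution {F : Type*} [Field F] (R : LinkData) (N : ℕ) (C : ℕ → ℕ → ℕ → F) : Prop where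
  eq_zero : ∀ {j k r}, j < N → k < N → ¬ R.Admissible j k r → C j k r = 0
  eq_sum : ∀ {j n s}, j < N → n < N → s < (R.chain j).2 → s < (R.chain n).2 →
    (if R.shift j ≤ s then (R.weight j : F) * C (R.target j) n (s - R.shift j) else 0) =
      ∑ k ∈ Finset.range N, if R.target k = n ∧ R.shift k ≤ s ∧
        (R.chain j).2 + R.shift k ≤ (R.chain k).2 + s then
        (R.weight k : F) * C j k ((R.chain k).2 + s - (R.chain j).2 - R.shift k) else 0

variable {F : Type*} [Field F] {N : ℕ} {C : ℕ → ℕ → ℕ → F}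

/-- At most one chain is linked to a given one, so the right-hand side of a relation is a single term. -/
theorem IsSolution.eq_source (hC : IsSolution R N C) (hR : R.IsHomogeneous) (hN : R.length ≤ N)
    {j n s : ℕ} (hj : j < N) (hn : n < N) (hsj : s < (R.chain j).2) (hsn : s < (R.chain n).2) :
    (if R.shift j ≤ s then (R.weight j : F) * C (R.target j) n (s - R.shift j) else 0) =
      if R.target (R.source n) = n ∧ R.shift (R.source n) ≤ s ∧
        (R.chain j).2 + R.shift (R.source n) ≤ (R.chain (R.source n)).2 + s then
        (R.weight (R.source n) : F) * C j (R.source n)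
          ((R.chain (R.source n)).2 + s - (R.chain j).2 - R.shift (R.source n)) else 0 := by
  rw [hC.eq_sum hj hn hsj hsn, Finset.sum_eq_single (R.source n)]
  · intro k _ hk
    refine ite_eq_right_iff.2 fun h => ?_
    by_cases hw : R.weight k = 0
    · rw [hw, Nat.cast_zero, zero_mul]
    · have hkR : k < R.length := by
        by_contra h'
        exact hw (weight_of_le (Nat.not_lt.1 h'))
      exact absurd ((hR.2.2 k hkR).2.2.2.1 hw).2.symm (h.1 ▸ hk)
  · intro h
    refine ite_eq_right_iff.2 fun _ => ?_
    rw [weight_of_le (hN.trans (Nat.not_lt.1 fun h' => h (Finset.mem_range.2 h'))), Nat.cast_zero,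
      zero_mul]

/-- The coordinate with number `x` vanishes. -/
def Vanishes (C : ℕ → ℕ → ℕ → F) (x : ℕ) : Prop :=
  x = 0 ∨ C (decode x).1 (decode x).2.1 (decode x).2.2 = 0

theorem IsSolution.vanishes_code (hC : IsSolution R N C) (hR : R.IsHomogeneous) (hN : R.length ≤ N)
    {j k r : ℕ} (hj : j < N) (hk : k < R.length) : Vanishes C (R.code j k r) ↔ C j k r = 0 := by
  unfold code
  split_ifs with h
  · have h1 := hR.2.1
    have h2 := (hR.2.2 k hk).2.1
    have h3 := h.1
    have : decode (64 * j + 8 * k + r + 1) = (j, k, r) := by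
      unfold decode
      refine Prod.ext ?_ (Prod.ext ?_ ?_) <;> dsimp only <;> omega
    rw [Vanishes, this]
    exact or_iff_right (Nat.succ_ne_zero _)
  · exact iff_of_true (Or.inl rfl) (hC.eq_zero hj (hk.trans_le hN) h)

/-- Both sides of a relation are multiples of a single coordinate; if it is the same coordinate with
different coefficients, it vanishes. -/
theorem IsSolution.vanishes_relation [CharZero F] (hC : IsSolution R N C) (hR : R.IsHomogeneous)
    (hN : R.length ≤ N) {j n s : ℕ} (hj : j < R.length) (hn : n < R.length)
    (hsj : s < (R.chain j).2) (hsn : s < (R.chain n).2) :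
    Vanishes C (R.relation j n s).1 ↔ Vanishes C (R.relation j n s).2 := by
  have h := hC.eq_source hR hN (hj.trans_le hN) (hn.trans_le hN) hsj hsn
  have htj : R.target j < N := (hR.2.2 j hj).2.2.1.trans_le hN
  have hσ : R.weight (R.source n) ≠ 0 → R.source n < R.length := fun h0 => by
    by_contra h1
    exact h0 (weight_of_le (Nat.not_lt.1 h1))
  have hz : Vanishes C 0 := Or.inl rfl
  unfold relation
  simp only
  generalize hk : R.source n = k at h hσ ⊢
  by_cases h1 : R.weight j ≠ 0 ∧ R.shift j ≤ s
  · rw [if_pos h1]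
    rw [if_pos h1.2] at h
    have hwj : (R.weight j : F) ≠ 0 := Nat.cast_ne_zero.2 h1.1
    by_cases h2 : R.weight k ≠ 0 ∧ R.target k = n ∧ R.shift k ≤ s ∧
      (R.chain j).2 + R.shift k ≤ (R.chain k).2 + s
    · rw [if_pos h2]
      rw [if_pos h2.2] at h
      have hwk : (R.weight k : F) ≠ 0 := Nat.cast_ne_zero.2 h2.1
      have e1 := hC.vanishes_code hR hN (r := s - R.shift j) htj hn
      have e2 := hC.vanishes_code hR hN
        (r := (R.chain k).2 + s - (R.chain j).2 - R.shift k) (hj.trans_le hN) (hσ h2.1)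
      split_ifs with h3
      · refine iff_of_true ?_ hz
        rw [Vanishes]
        by_cases h4 : R.code (R.target j) n (s - R.shift j) = 0
        · exact Or.inl h4
        have h5 : R.Admissible (R.target j) n (s - R.shift j) := by
          by_contra h5
          exact h4 (if_neg h5)
        have h6 : R.Admissible j k ((R.chain k).2 + s - (R.chain j).2 - R.shift k) := by
          by_contra h6
          exact h4 (h3.1.trans (if_neg h6))
        have h7 := h3.1
        have b1 := hR.2.1
        have b2 := (hR.2.2 n hn).2.1
        have b3 := (hR.2.2 k (hσ h2.1)).2.1
        have b4 := hσ h2.1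
        rw [code, code, if_pos h5, if_pos h6] at h7
        have h8 := h5.1
        have h9 := h6.1
        have h10 : s - R.shift j = (R.chain k).2 + s - (R.chain j).2 - R.shift k := by omega
        have h11 : n = k := by omega
        have h12 : R.target j = j := by omega
        rw [h12, h10, h11] at h
        have h13 : ((R.weight j : F) - R.weight k) *
            C j k ((R.chain k).2 + s - (R.chain j).2 - R.shift k) = 0 := by
          linear_combination h
        have h14 := (mul_eq_zero.1 h13).resolve_left
          (sub_ne_zero.2 (Nat.cast_injective.ne h3.2))
        rw [h3.1]
        exact e2.2 h14
      · rw [e1, e2]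
        constructor
        · intro h0
          rw [h0, mul_zero] at h
          exact (mul_eq_zero.1 h.symm).resolve_left hwk
        · intro h0
          rw [h0, mul_zero] at h
          exact (mul_eq_zero.1 h).resolve_left hwj
    · rw [if_neg h2]
      have h3 : C (R.target j) n (s - R.shift j) = 0 := by
        refine (mul_eq_zero.1 (h.trans (ite_eq_right_iff.2 fun h4 => ?_))).resolve_left hwj
        rw [not_and'.1 h2 h4 |> not_not.1, Nat.cast_zero, zero_mul]
      have h4 := (hC.vanishes_code hR hN htj hn).2 h3
      split_ifs
      exacts [iff_of_true h4 hz, iff_of_true h4 hz]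
  · rw [if_neg h1]
    have h0 : (if R.shift j ≤ s then (R.weight j : F) * C (R.target j) n (s - R.shift j) else 0) =
        0 := ite_eq_right_iff.2 fun h4 => by
      rw [not_and'.1 h1 h4 |> not_not.1, Nat.cast_zero, zero_mul]
    rw [h0] at h
    by_cases h2 : R.weight k ≠ 0 ∧ R.target k = n ∧ R.shift k ≤ s ∧
      (R.chain j).2 + R.shift k ≤ (R.chain k).2 + s
    · rw [if_pos h2.2] at h
      have := (hC.vanishes_code hR hN (hj.trans_le hN) (hσ h2.1)).2
        ((mul_eq_zero.1 h.symm).resolve_left (Nat.cast_ne_zero.2 h2.1))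
      rw [if_pos h2]
      split_ifs
      exacts [Iff.rfl, iff_of_true hz this]
    · rw [if_neg h2, ite_self]

theorem IsSolution.of_mem_relations [CharZero F] (hC : IsSolution R N C) (hR : R.IsHomogeneous)
    (hN : R.length ≤ N) : ∀ p ∈ R.relations, (Vanishes C p.1 ↔ Vanishes C p.2) := fun p hp => by
  have := List.mem_of_mem_filter hp
  simp only [List.mem_flatMap, List.mem_map, List.mem_range, lt_min_iff] at this
  obtain ⟨j, hj, n, hn, s, ⟨h1, h2⟩, rfl⟩ := this
  exact hC.vanishes_relation hR hN hj hn h1 h2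

/-- For good linking data a solution is determined by two of its coordinates. -/
theorem IsSolution.eq_zero_of_pivots [CharZero F] (hC : IsSolution R N C) (hR : R.IsGood)
    (hN : R.length ≤ N)
    (h1 : C (decode (R.pivot R.start)).1 (decode (R.pivot R.start)).2.1
      (decode (R.pivot R.start)).2.2 = 0)
    (h2 : C (decode (R.pivot (R.extend R.start))).1 (decode (R.pivot (R.extend R.start))).2.1
      (decode (R.pivot (R.extend R.start))).2.2 = 0)
    {j k : ℕ} (r : ℕ) (hj : j < N) (hk : k < N) : C j k r = 0 := by
  have hrel := hC.of_mem_relations hR.1 hN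
  have hz : ∀ x, Nat.testBit 1 x = true → Vanishes C x := fun x hx =>
    Or.inl (Nat.testBit_one_eq_true_iff_self_eq_zero.1 hx)
  have hfin : ∀ x, (R.extend (R.extend R.start)).testBit x = true → Vanishes C x :=
    of_testBit_propagate hrel (of_testBit_propagate hrel (of_testBit_insert
      (of_testBit_propagate hrel (of_testBit_propagate hrel (of_testBit_insert
        (of_testBit_propagate hrel (of_testBit_propagate hrel hz)) (Or.inr h1)))) (Or.inr h2)))
  by_cases hadm : R.Admissible j k r
  swap
  · exact hC.eq_zero hj hk hadm
  by_cases hjR : j < R.length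
  · by_cases hkR : k < R.length
    · refine (hC.vanishes_code hR.1 hN hj hkR).1 (hfin _ (hR.2 _ ?_))
      simp only [codes, List.mem_flatMap, List.mem_map, List.mem_range]
      exact ⟨j, hjR, k, hkR, r, hadm.1, rfl⟩
    · -- The `j`-th chain starts in colour `0`, and no chain is linked to the `k`-th one.
      have hck := chain_of_le (Nat.not_lt.1 hkR)
      have a1 := hadm.1
      have a3 := hadm.2.2
      rw [hck] at a1 a3
      obtain rfl : r = 0 := by simpa using a1
      obtain ⟨b1, b2, b3, b4⟩ := (hR.1.2.2 j hjR).2.2.2.2.2 (by dsimp only at a3; omega)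
      have h := hC.eq_source hR.1 hN (j := R.source j) (n := k) (s := 0) (b1.trans_le hN) hk
        (hR.1.2.2 _ b1).1 (by rw [hck]; exact Nat.one_pos)
      rw [if_pos (by omega), b3, b4, if_neg] at h
      · exact (mul_eq_zero.1 h).resolve_left (Nat.cast_ne_zero.2 b2)
      · intro h'
        have : R.source k < R.length ∨ R.length ≤ R.source k := lt_or_ge _ _
        rcases this with h3 | h3
        · have := (hR.1.2.2 _ h3).2.2.1
          omega
        · have := target_of_le h3
          have := List.length_pos_iff.2 hR.1.1
          omega
  · -- The last vector of the `k`-th chain has colour `1`, and the `j`-th one is not linked to any chain.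
    have hcj := chain_of_le (Nat.not_lt.1 hjR)
    have a1 := hadm.1
    have a2 := hadm.2.1
    have a3 := hadm.2.2
    rw [hcj] at a2 a3
    dsimp only at a2 a3
    have hkR : k < R.length := by
      by_contra hkR
      rw [chain_of_le (Nat.not_lt.1 hkR)] at a1 a2 a3
      dsimp only at a1 a2 a3
      omega
    obtain ⟨b1, b2⟩ := (hR.1.2.2 k hkR).2.2.2.2.1 (by omega)
    have b3 := (hR.1.2.2 k hkR).2.2.2.1 b1
    have b4 := (hR.1.2.2 k hkR).2.2.1
    have h := hC.eq_source hR.1 hN (j := j) (n := R.target k) (s := 0) hj (b4.trans_le hN)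
      (by rw [hcj]; exact Nat.one_pos) (hR.1.2.2 _ b4).1
    rw [weight_of_le (Nat.not_lt.1 hjR), Nat.cast_zero, zero_mul, ite_self, b3.2, if_pos] at h
    · have h3 := (mul_eq_zero.1 h.symm).resolve_left (Nat.cast_ne_zero.2 b1)
      rw [hcj, b2] at h3
      rwa [show r = (R.chain k).2 + 0 - 1 - 0 by omega]
    · rw [hcj, b2]
      dsimp only
      have := (hR.1.2.2 k hkR).1
      exact ⟨rfl, le_rfl, by omega⟩

end LinkData

/-! ### Directions defined by linking data -/

section LinkedDirection

variable {F 𝕍 : Type*} [Field F] [AddCommGroup 𝕍] [Module F 𝕍] {g v : End F 𝕍} {ζ : F} {N : ℕ}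
  {c : Fin N → ℕ × ℕ}

/-- The `r`-th coordinate in the `k`-th chain of the image of the first vector of the `j`-th chain. -/
noncomputable def entryFunctional (b : Basis (Σ k : Fin N, Fin (c k).2) F 𝕍) (j k r : ℕ) :
    End F 𝕍 →ₗ[F] F :=
  if h : j < N ∧ k < N then
    chainCoord b ⟨k, h.2⟩ r ∘ₗ LinearMap.applyₗ (chainVec b ⟨j, h.1⟩ 0) else 0

theorem entryFunctional_apply (b : Basis (Σ k : Fin N, Fin (c k).2) F 𝕍) (j k : Fin N) (r : ℕ)
    (y : End F 𝕍) : entryFunctional b j k r y = chainCoord b k r (y (chainVec b j 0)) := by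
  rw [entryFunctional, dif_pos ⟨j.2, k.2⟩]
  rfl

theorem entryFunctional_isSolution (hζ : IsPrimitiveRoot ζ 3)
    {b : Basis (Σ k : Fin N, Fin (c k).2) F 𝕍} (hb : IsJordanBasis g v ζ c b)
    {R : LinkData} (hpos : ∀ k, 1 ≤ (c k).2) (hc : ∀ k : Fin N, c k = R.chain k)
    {m : Fin N → Fin N} (hm : ∀ k : Fin N, (m k : ℕ) = R.target k) {y y' : End F 𝕍}
    (hyg : y ∈ gradedPart g (ζ ^ 2)) (hyv : v * y = y * v)
    (hy : y * linkMap b m (fun k => R.shift k) (fun k => R.weight k) + y' * v =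
      linkMap b m (fun k => R.shift k) (fun k => R.weight k) * y + v * y') :
    R.IsSolution N fun j k r => entryFunctional b j k r y where
  eq_zero {j k r} hj hk h := by
    have h1 := entryFunctional_apply b ⟨j, hj⟩ ⟨k, hk⟩ r y
    dsimp only at h1 ⊢
    rw [h1]
    refine chainCoord_eq_zero_of_not_valid hζ hb hyv hyg ?_
    rw [hc, hc]
    unfold LinkData.Admissible at h
    dsimp only
    omega
  eq_sum {j n s} hj hn hsj hsn := by
    have h := sum_chainCoord_eq hb hpos hyv hy ⟨j, hj⟩ ⟨n, hn⟩ (s := s) (by rwa [hc]) (by rwa [hc])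
    have e1 : ((m ⟨j, hj⟩ : Fin N) : ℕ) = R.target j := hm _
    have e2 := entryFunctional_apply b (m ⟨j, hj⟩) ⟨n, hn⟩ (s - R.shift j) y
    rw [e1] at e2
    dsimp only at e2 h ⊢
    rw [e2, h, Finset.sum_range]
    refine Finset.sum_congr rfl fun k _ => ?_
    have e3 : (⟨j, hj⟩ : Fin N).val = j := rfl
    rw [hc, hc, e3]
    refine if_congr (and_congr_left' ?_) ?_ rfl
    · rw [Fin.ext_iff, hm]
    · rw [← entryFunctional_apply]

/-- Good linking data produce a direction with a slice kernel of dimension at most two. -/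
theorem exists_finrank_sliceKernel_le_two_of_isGood [CharZero F] [FiniteDimensional F 𝕍]
    (hg : g ^ 3 = 1) (hζ : IsPrimitiveRoot ζ 3) (hv : v ∈ gradedPart g ζ)
    {b : Basis (Σ k : Fin N, Fin (c k).2) F 𝕍} (hb : IsJordanBasis g v ζ c b)
    {R : LinkData} (hR : R.IsGood) (hN : R.length ≤ N) (hc : ∀ k : Fin N, c k = R.chain k) :
    ∃ η ∈ gradedPart g ζ, finrank F (sliceKernel g ζ v η) ≤ 2 := by
  have hpos : ∀ k, 1 ≤ (c k).2 := fun k => by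
    rw [hc]
    by_cases hk : (k : ℕ) < R.length
    · exact (hR.1.2.2 k hk).1
    · rw [LinkData.chain_of_le (Nat.not_lt.1 hk)]
  have hlt : ∀ k : Fin N, R.target k < N := fun k => by
    by_cases hk : (k : ℕ) < R.length
    · exact (hR.1.2.2 k hk).2.2.1.trans_le hN
    · rw [LinkData.target_of_le (Nat.not_lt.1 hk)]
      exact k.pos
  set m : Fin N → Fin N := fun k => ⟨R.target k, hlt k⟩ with hm
  set η := linkMap b m (fun k => R.shift k) (fun k => R.weight k) with hη
  have hηg : η ∈ gradedPart g ζ := by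
    refine linkMap_mem_gradedPart hζ.pow_eq_one hb hpos fun k hk => ?_
    have hkR : (k : ℕ) < R.length := by
      by_contra h
      exact hk (LinkData.weight_of_le (Nat.not_lt.1 h))
    rw [hc, hc]
    exact ((hR.1.2.2 k hkR).2.2.2.1 hk).1
  refine ⟨η, hηg, ?_⟩
  let p := LinkData.decode (R.pivot R.start)
  let q := LinkData.decode (R.pivot (R.extend R.start))
  let f : End F 𝕍 →ₗ[F] F × F :=
    (entryFunctional b p.1 p.2.1 p.2.2).prod (entryFunctional b q.1 q.2.1 q.2.2)
  have hf : Function.Injective (f ∘ₗ (sliceKernel g ζ v η).subtype) := by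
    refine (injective_iff_map_eq_zero _).2 fun y hy => Subtype.ext ?_
    obtain ⟨y, hyD⟩ := y
    have h1 : entryFunctional b p.1 p.2.1 p.2.2 y = 0 := congrArg Prod.fst hy
    have h2 : entryFunctional b q.1 q.2.1 q.2.2 y = 0 := congrArg Prod.snd hy
    obtain ⟨y', -, hy'⟩ := exists_deformation_of_mem_sliceKernel hg (by norm_num) hζ.pow_eq_one
      hv hηg hyD
    obtain ⟨hyg, hyv, -⟩ := mem_sliceKernel.1 hyD
    have hsol := entryFunctional_isSolution hζ hb hpos hc (fun _ => rfl) hyg hyv hy'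
    refine eq_zero_of_forall_chainCoord hb hyv fun j k r => ?_
    rw [← entryFunctional_apply]
    exact hsol.eq_zero_of_pivots hR hN h1 h2 r j.2 k.2
  have := LinearMap.finrank_le_finrank_of_injective hf
  rwa [Module.finrank_prod, Module.finrank_self] at this

end LinkedDirection

/-! ### Classification of the configurations of Jordan chains -/

section ChainTypes

/-- The number of vectors of colour `t` in a chain of length `p.2` starting with colour `p.1`; the
formula counts `s < p.2` with `p.1 + s ≡ t` modulo `3` if `p.1, t < 3`. -/
def colourCount (t : ℕ) (p : ℕ × ℕ) : ℕ := (p.2 + 2 - (t + 3 - p.1) % 3) / 3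

theorem card_filter_colour {p : ℕ × ℕ} {t : ℕ} (hp : p.1 < 3) (ht : t < 3) :
    (Finset.univ.filter fun s : Fin p.2 => (p.1 + s) % 3 = t).card = colourCount t p := by
  obtain ⟨i, l⟩ := p
  dsimp only at hp ⊢
  rw [Finset.card_filter, Fin.sum_univ_eq_sum_range (fun s => if (i + s) % 3 = t then 1 else 0)]
  unfold colourCount
  dsimp only
  induction l with
  | zero =>
    rw [Finset.sum_range_zero]
    omega
  | succ l ih =>
    rw [Finset.sum_range_succ, ih]
    split_ifs with h <;> omega

/-- The chain types of length at most `7`, except for the one consisting of a vector of colour `2`. -/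
def chainTypes : List (ℕ × ℕ) :=
  ((List.range 3).flatMap fun i => (List.range 7).map fun l => (i, l + 1)).filter fun p => p != (2, 1)

/-- All lists of at most `n` chain types with `x` vectors of colour `0` and `y` of colour `1`. -/
def chainLists : ℕ → ℕ → ℕ → List (List (ℕ × ℕ))
  | 0, x, y => if x = 0 ∧ y = 0 then [[]] else []
  | n + 1, x, y => (if x = 0 ∧ y = 0 then [[]] else []) ++ chainTypes.flatMap fun p =>
      if colourCount 0 p ≤ x ∧ colourCount 1 p ≤ y then
        (chainLists n (x - colourCount 0 p) (y - colourCount 1 p)).map (p :: ·) else []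

/-- Every chain type in the list contributes a vector of colour `0` or `1`, which bounds the length of
the list, and colour `2` occurs at most once more than each of the others, which bounds the lengths of
the chains. -/
theorem mem_chainLists {l : List (ℕ × ℕ)} (hl : ∀ p ∈ l, p.1 < 3 ∧ 1 ≤ p.2 ∧ p ≠ (2, 1)) {n x y : ℕ}
    (hx : x ≤ 2) (hy : y ≤ 2) (hn : x + y ≤ n) (h0 : (l.map (colourCount 0)).sum = x)
    (h1 : (l.map (colourCount 1)).sum = y) : l ∈ chainLists n x y := by
  induction l generalizing n x y with
  | nil =>
    subst h0 h1
    cases n <;> simp [chainLists]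
  | cons p l ih =>
    rw [List.map_cons, List.sum_cons] at h0 h1
    obtain ⟨hp1, hp2, hp3⟩ := hl p List.mem_cons_self
    obtain ⟨i, d⟩ := p
    rw [Ne, Prod.mk.injEq] at hp3
    have hpos : 1 ≤ colourCount 0 (i, d) + colourCount 1 (i, d) := by
      unfold colourCount
      dsimp only at hp1 hp2 ⊢
      omega
    obtain ⟨n, rfl⟩ : ∃ n', n = n' + 1 := ⟨n - 1, by omega⟩
    refine List.mem_append_right _ (List.mem_flatMap.2 ⟨(i, d), ?_, ?_⟩)
    · have hd : d ≤ 7 := by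
        unfold colourCount at h0 h1
        dsimp only at hp1 h0 h1
        omega
      refine List.mem_filter.2 ⟨List.mem_flatMap.2 ⟨i, List.mem_range.2 hp1, List.mem_map.2
        ⟨d - 1, List.mem_range.2 ?_, ?_⟩⟩, ?_⟩
      · dsimp only at hp2
        omega
      · rw [Nat.sub_add_cancel hp2]
      · simpa using hp3
    · rw [if_pos ⟨by omega, by omega⟩]
      exact List.mem_map_of_mem (ih (fun q hq => hl q (List.mem_cons_of_mem _ hq)) (by omega)
        (by omega) (by omega) (by omega) (by omega))

/-- The table of linking data is exhaustive. -/
theorem exists_mem_linkTable : ∀ l ∈ chainLists 4 2 2, ∃ R ∈ linkTable,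
    (l ++ List.replicate (2 - (l.map (colourCount 2)).sum) (2, 1)).Perm (R.map Prod.fst) := by
  decide +kernel

theorem exists_linkData_perm {l : List (ℕ × ℕ)} (hl : ∀ p ∈ l, p.1 < 3 ∧ 1 ≤ p.2)
    (h0 : (l.map (colourCount 0)).sum = 2) (h1 : (l.map (colourCount 1)).sum = 2)
    (h2 : 2 ≤ (l.map (colourCount 2)).sum) :
    ∃ R ∈ linkTable, ∃ z, l.Perm (R.map Prod.fst ++ List.replicate z (2, 1)) := by
  set l' := l.filter fun p => p != (2, 1) with hl'
  set z := l.count (2, 1) with hz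
  have hperm : l.Perm (l' ++ List.replicate z (2, 1)) := by
    have h := (List.filter_append_perm (fun p => p != (2, 1)) l).symm
    have e : (l.filter fun p => !(p != (2, 1))) = List.replicate z (2, 1) := by
      rw [hz, ← List.filter_beq]
      congr 1
      funext p
      simp [bne]
    rwa [e] at h
  have hsum : ∀ t, (l.map (colourCount t)).sum =
      (l'.map (colourCount t)).sum + z * colourCount t (2, 1) := fun t => by
    rw [(hperm.map (colourCount t)).sum_eq, List.map_append, List.sum_append, List.map_replicate,
      List.sum_replicate, smul_eq_mul]
  have e0 := hsum 0
  have e1 := hsum 1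
  have e2 := hsum 2
  rw [show colourCount 0 (2, 1) = 0 from rfl, h0] at e0
  rw [show colourCount 1 (2, 1) = 0 from rfl, h1] at e1
  rw [show colourCount 2 (2, 1) = 1 from rfl] at e2
  obtain ⟨R, hR, hp⟩ := exists_mem_linkTable l' (mem_chainLists (fun p hp => by
    obtain ⟨hp1, hp2⟩ := List.mem_filter.1 hp
    exact ⟨(hl p hp1).1, (hl p hp1).2, by simpa using hp2⟩) le_rfl le_rfl le_rfl (by omega)
    (by omega))
  refine ⟨R, hR, z - (2 - (l'.map (colourCount 2)).sum), hperm.trans ?_⟩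
  refine List.Perm.trans ?_ (hp.append_right _)
  rw [List.append_assoc, ← List.replicate_add]
  exact (List.Perm.of_eq (by congr 2; omega))

end ChainTypes

section Nilpotent

variable {F 𝕍 : Type*} [Field F] [AddCommGroup 𝕍] [Module F 𝕍] {g v : End F 𝕍} {ζ : F}

theorem finrank_eigenspace_of_basis {κ : Type*} [Fintype κ] (b : Basis κ F 𝕍) {d : κ → F}
    (hb : ∀ j, g (b j) = d j • b j) (a : F) [DecidablePred fun j => d j = a] :
    finrank F (End.eigenspace g a) = (Finset.univ.filter fun j => d j = a).card := by
  have hspan : End.eigenspace g a = Submodule.span F (Set.range fun j : {j // d j = a} => b j) := by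
    refine le_antisymm (fun u hu => ?_) (Submodule.span_le.2 ?_)
    · rw [← b.sum_repr u]
      refine Submodule.sum_mem _ fun j _ => ?_
      by_cases hj : d j = a
      · exact Submodule.smul_mem _ _ (Submodule.subset_span ⟨⟨j, hj⟩, rfl⟩)
      · rw [repr_eq_zero_of_eigenvector b hb (End.mem_eigenspace_iff.1 hu) hj, zero_smul]
        exact zero_mem _
    · rintro _ ⟨⟨j, rfl⟩, rfl⟩
      exact End.mem_eigenspace_iff.2 (hb j)
  rw [hspan, finrank_span_eq_card (b := fun j : {j // d j = a} => b j)
    (b.linearIndependent.comp _ Subtype.val_injective), Fintype.card_subtype]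

theorem IsJordanBasis.eigenDim_eq {ι : Type*} [Fintype ι] {c : ι → ℕ × ℕ}
    {b : Basis (Σ k : ι, Fin (c k).2) F 𝕍} (hb : IsJordanBasis g v ζ c b)
    (hζ : IsPrimitiveRoot ζ 3) (hc : ∀ k, (c k).1 < 3) {t : ℕ} (ht : t < 3) :
    eigenDim g ζ t = ∑ k, colourCount t (c k) := by
  classical
  rw [eigenDim, finrank_eigenspace_of_basis b (d := fun x => ζ ^ ((c x.1).1 + x.2))
    (fun x => hb.apply_g x.1 x.2)]
  simp_rw [hζ.pow_eq_pow_iff_mod_three, Nat.mod_eq_of_lt ht]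
  rw [Finset.card_filter, Fintype.sum_sigma]
  refine Finset.sum_congr rfl fun k _ => ?_
  rw [← card_filter_colour (hc k) ht, Finset.card_filter]

theorem IsJordanBasis.reindex {ι κ : Type*} {c : ι → ℕ × ℕ}
    {b : Basis (Σ k : ι, Fin (c k).2) F 𝕍} (hb : IsJordanBasis g v ζ c b) (e : κ ≃ ι) :
    ∃ b' : Basis (Σ k : κ, Fin (c (e k)).2) F 𝕍, IsJordanBasis g v ζ (fun k => c (e k)) b' := by
  refine ⟨b.reindex (Equiv.sigmaCongrLeft (β := fun k => Fin (c k).2) e).symm, ?_, ?_, ?_⟩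
  · intro k s
    rw [Basis.reindex_apply, Equiv.symm_symm]
    exact hb.apply_g (e k) s
  · intro k s h
    rw [Basis.reindex_apply, Basis.reindex_apply, Equiv.symm_symm]
    exact hb.apply_succ (e k) s h
  · intro k s h
    rw [Basis.reindex_apply, Equiv.symm_symm]
    exact hb.apply_last (e k) s h

/-- The nilpotent points for eigenspace dimensions `(2, 2, a)` with `a ≥ 2`. -/
theorem exists_finrank_sliceKernel_le_two_of_isNilpotent [CharZero F] [FiniteDimensional F 𝕍]
    (hg : g ^ 3 = 1) (hζ : IsPrimitiveRoot ζ 3) (h0 : eigenDim g ζ 0 = 2)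
    (h1 : eigenDim g ζ 1 = 2) (h2 : 2 ≤ eigenDim g ζ 2) (hv : v ∈ gradedPart g ζ)
    (hnil : IsNilpotent v) : ∃ η ∈ gradedPart g ζ, finrank F (sliceKernel g ζ v η) ≤ 2 := by
  classical
  obtain ⟨ι, _, c, b, hc, hb⟩ := exists_isJordanBasis (by norm_num) hζ _ rfl hg hv hnil
  have hsum : ∀ t < 3, ((Finset.univ.toList.map c).map (colourCount t)).sum = eigenDim g ζ t :=
    fun t ht => by
      rw [hb.eigenDim_eq hζ (fun k => (hc k).1) ht, List.map_map, Finset.sum_map_toList]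
      rfl
  obtain ⟨R, hR, z, hperm⟩ := exists_linkData_perm (l := Finset.univ.toList.map c)
    (by
      intro p hp
      obtain ⟨k, -, rfl⟩ := List.mem_map.1 hp
      exact hc k)
    ((hsum 0 (by norm_num)).trans h0) ((hsum 1 (by norm_num)).trans h1)
    (h2.trans_eq (hsum 2 (by norm_num)).symm)
  -- Reorder the chains such that their types appear in the order of the table.
  obtain ⟨I, hI, hIperm⟩ := List.perm_comp_forall₂ (r := fun (p : ℕ × ℕ) (k : ι) => p = c k) hperm.symm
    (List.forall₂_map_left_iff.2 (List.forall₂_same.2 fun _ _ => rfl))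
  have hnodup : I.Nodup := hIperm.nodup_iff.2 (Finset.nodup_toList _)
  have hmem : ∀ k, k ∈ I := fun k => hIperm.mem_iff.2 (Finset.mem_toList.2 (Finset.mem_univ k))
  obtain ⟨b', hb'⟩ := hb.reindex (hnodup.getEquivOfForallMemList _ hmem)
  have hlen : R.length + z = I.length := by
    rw [← hI.length_eq, List.length_append, List.length_map, List.length_replicate]
  refine exists_finrank_sliceKernel_le_two_of_isGood hg hζ hv hb' (isGood_of_mem_linkTable R hR)
    (by omega) fun k => ?_
  have hk := (List.forall₂_iff_get.1 hI).2 k (by rw [hI.length_eq]; exact k.2) k.2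
  refine hk.symm.trans ?_
  rw [List.get_eq_getElem, LinkData.chain]
  by_cases hkR : (k : ℕ) < R.length
  · rw [List.getElem_append_left (by rwa [List.length_map]), List.getElem_map,
      List.getD_eq_getElem _ _ hkR]
  · rw [List.getElem_append_right (by rw [List.length_map]; exact Nat.not_lt.1 hkR), List.getElem_replicate,
      List.getD_eq_default _ _ (Nat.not_lt.1 hkR)]

end Nilpotent

/-! ### The criterion for good index behaviour -/

section Criterion

variable {F 𝕍 : Type*} [Field F] [AddCommGroup 𝕍] [Module F 𝕍]

/-- The scalar multiple of an invertible endomorphism by a unit of the field. -/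
def scaleUnit (a : Fˣ) (g : (End F 𝕍)ˣ) : (End F 𝕍)ˣ :=
  Units.map (algebraMap F (End F 𝕍)).toMonoidHom a * g

theorem coe_scaleUnit (a : Fˣ) (g : (End F 𝕍)ˣ) :
    (scaleUnit a g : End F 𝕍) = (a : F) • (g : End F 𝕍) := by
  rw [scaleUnit, Units.val_mul, Algebra.smul_def]
  rfl

theorem IsConjBy.scaleUnit {θ : End F 𝕍 ≃ₗ⁅F⁆ End F 𝕍} {g : (End F 𝕍)ˣ} (h : IsConjBy θ g) (a : Fˣ) :
    IsConjBy θ (scaleUnit a g) := fun x => by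
  rw [h x, Units.eq_mul_inv_iff_mul_eq, coe_scaleUnit, mul_smul_comm, smul_mul_assoc, mul_assoc,
    Units.inv_mul, mul_one]

/-- Multiplying `g` by `ζ ^ (2 * k)` rotates the eigenspaces. -/
theorem exists_rotation {ζ : F} (hζ : ζ ^ 3 = 1) {θ : End F 𝕍 ≃ₗ⁅F⁆ End F 𝕍} {g : (End F 𝕍)ˣ}
    (hθ : IsConjBy θ g) (hg : (g : End F 𝕍) ^ 3 = 1) (k : ℕ) :
    ∃ g' : (End F 𝕍)ˣ, IsConjBy θ g' ∧ (g' : End F 𝕍) ^ 3 = 1 ∧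
      (∀ c, gradedPart (g' : End F 𝕍) c = gradedPart (g : End F 𝕍) c) ∧
      ∀ t, eigenDim (g' : End F 𝕍) ζ t = eigenDim (g : End F 𝕍) ζ (t + k) := by
  have hζ0 : ζ ≠ 0 := fun h => by simp [h] at hζ
  induction k with
  | zero => exact ⟨g, hθ, hg, fun _ => rfl, fun _ => rfl⟩
  | succ k ih =>
    obtain ⟨g', h1, h2, h3, h4⟩ := ih
    have e : (scaleUnit (Units.mk0 ζ hζ0 ^ 2) g' : End F 𝕍) = ζ ^ 2 • (g' : End F 𝕍) := by
      rw [coe_scaleUnit]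
      simp
    refine ⟨scaleUnit (Units.mk0 ζ hζ0 ^ 2) g', h1.scaleUnit _, ?_, fun c => ?_, fun t => ?_⟩
    · rw [e, pow_smul_pow_three hζ h2]
    · rw [e, smul_gradedPart _ (pow_ne_zero _ hζ0), h3]
    · rw [e, ← eigenDim_add_three hζ, ← add_assoc, add_right_comm, ← h4 (t + 1),
        ← eigenDim_pow_smul hζ0 2 (t + 1)]

variable [FiniteDimensional F 𝕍] [CharZero F] {ζ : F} {θ : End F 𝕍 ≃ₗ⁅F⁆ End F 𝕍} {g : (End F 𝕍)ˣ}

theorem eigenDim_le_finrank_sliceKernel (hθ : IsConjBy θ g) (hg : (g : End F 𝕍) ^ 3 = 1)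
    (hζ : IsPrimitiveRoot ζ 3) (h02 : eigenDim (g : End F 𝕍) ζ 2 ≤ eigenDim (g : End F 𝕍) ζ 0)
    (h12 : eigenDim (g : End F 𝕍) ζ 2 ≤ eigenDim (g : End F 𝕍) ζ 1) {v : End F 𝕍}
    (hv : v ∈ gradedPart (g : End F 𝕍) ζ) :
    eigenDim (g : End F 𝕍) ζ 2 ≤ finrank F (sliceKernel (g : End F 𝕍) ζ v 0) := by
  obtain ⟨u, hu, -, hli⟩ := exists_generic hg hζ h02 h12
  exact le_finrank_sliceKernel_zero hθ hg hζ.pow_eq_one hu hli hv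

theorem thetaRepHasGIB_of_eigenDim_eq_zero (hθ : IsConjBy θ g) (hg : (g : End F 𝕍) ^ 3 = 1)
    (hζ : IsPrimitiveRoot ζ 3) (h2 : eigenDim (g : End F 𝕍) ζ 2 = 0) : ThetaRepHasGIB θ ζ :=
  thetaRepHasGIB_of_sliceKernel hθ hg hζ.pow_eq_one (fun _ _ => Nat.zero_le _) fun _ hv =>
    exists_finrank_sliceKernel_le_zero hg hζ h2 hv

theorem thetaRepHasGIB_of_eigenDim_le_one (hθ : IsConjBy θ g) (hg : (g : End F 𝕍) ^ 3 = 1)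
    (hζ : IsPrimitiveRoot ζ 3) (h2 : eigenDim (g : End F 𝕍) ζ 2 ≤ 1) : ThetaRepHasGIB θ ζ := by
  by_cases h : eigenDim (g : End F 𝕍) ζ 2 = 0
  · exact thetaRepHasGIB_of_eigenDim_eq_zero hθ hg hζ h
  by_cases h0 : eigenDim (g : End F 𝕍) ζ 0 = 0
  · obtain ⟨g', h1', h2', -, h4'⟩ := exists_rotation hζ.pow_eq_one hθ hg 1
    exact thetaRepHasGIB_of_eigenDim_eq_zero h1' h2' hζ
      ((h4' 2).trans ((eigenDim_add_three hζ.pow_eq_one 0).trans h0))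
  by_cases h1 : eigenDim (g : End F 𝕍) ζ 1 = 0
  · obtain ⟨g', h1', h2', -, h4'⟩ := exists_rotation hζ.pow_eq_one hθ hg 2
    exact thetaRepHasGIB_of_eigenDim_eq_zero h1' h2' hζ
      ((h4' 2).trans ((eigenDim_add_three hζ.pow_eq_one 1).trans h1))
  have h2 : eigenDim (g : End F 𝕍) ζ 2 = 1 := by omega
  exact thetaRepHasGIB_of_sliceKernel hθ hg hζ.pow_eq_one (fun v hv => h2 ▸
    eigenDim_le_finrank_sliceKernel hθ hg hζ (by omega) (by omega) hv) fun v hv =>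
      exists_finrank_sliceKernel_le_one hg hζ h0 h1 h2 hv

theorem thetaRepHasGIB_of_eigenDim_eq_two (hθ : IsConjBy θ g) (hg : (g : End F 𝕍) ^ 3 = 1)
    (hζ : IsPrimitiveRoot ζ 3) (h0 : eigenDim (g : End F 𝕍) ζ 0 = 2)
    (h1 : eigenDim (g : End F 𝕍) ζ 1 = 2) (h2 : 2 ≤ eigenDim (g : End F 𝕍) ζ 2) :
    ThetaRepHasGIB θ ζ := by
  refine thetaRepHasGIB_of_sliceKernel hθ hg hζ.pow_eq_one (m := 2) (fun v hv => ?_) fun v hv => ?_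
  · -- The minimal eigenspace dimension is attained at colour `1`.
    obtain ⟨g', h1', h2', h3', h4'⟩ := exists_rotation hζ.pow_eq_one hθ hg 2
    have e0 : eigenDim (g' : End F 𝕍) ζ 0 = eigenDim (g : End F 𝕍) ζ 2 := h4' 0
    have e1 : eigenDim (g' : End F 𝕍) ζ 1 = 2 :=
      (h4' 1).trans ((eigenDim_add_three hζ.pow_eq_one 0).trans h0)
    have e2 : eigenDim (g' : End F 𝕍) ζ 2 = 2 :=
      (h4' 2).trans ((eigenDim_add_three hζ.pow_eq_one 1).trans h1)
    obtain ⟨u, hu, -, hli⟩ := exists_generic h2' hζ (e2.le.trans (h2.trans e0.ge)) (e2.trans e1.symm).le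
    rw [e2] at hli
    exact le_finrank_sliceKernel_zero hθ hg hζ.pow_eq_one (h3' ζ ▸ hu) hli hv
  · by_cases hnil : IsNilpotent v
    · exact exists_finrank_sliceKernel_le_two_of_isNilpotent hg hζ h0 h1 h2 hv hnil
    · exact exists_finrank_sliceKernel_le_two_of_not_isNilpotent hg hζ h0 h1 hv hnil

theorem not_thetaRepHasGIB_of_eigenDim (hθ : IsConjBy θ g) (hg : (g : End F 𝕍) ^ 3 = 1)
    (hζ : IsPrimitiveRoot ζ 3) (h0 : 3 ≤ eigenDim (g : End F 𝕍) ζ 0)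
    (h1 : 3 ≤ eigenDim (g : End F 𝕍) ζ 1) (h2 : 2 ≤ eigenDim (g : End F 𝕍) ζ 2)
    (h02 : eigenDim (g : End F 𝕍) ζ 2 ≤ eigenDim (g : End F 𝕍) ζ 0)
    (h12 : eigenDim (g : End F 𝕍) ζ 2 ≤ eigenDim (g : End F 𝕍) ζ 1) : ¬ ThetaRepHasGIB θ ζ := by
  obtain ⟨v₀, hv₀, hup, -⟩ := exists_generic hg hζ h02 h12
  obtain ⟨v, hv, hlow⟩ := exists_large_sliceKernel hg hζ h0 h1 h2 h02 h12
  exact not_thetaRepHasGIB_of_sliceKernel hθ hg hζ.pow_eq_one hv₀ hup hv fun η _ => hlow η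

/-- Good index behaviour holds if and only if some eigenspace has dimension at most `1` or two of them
have dimension `2`. -/
theorem thetaRepHasGIB_iff (hθ : IsConjBy θ g) (hg : (g : End F 𝕍) ^ 3 = 1)
    (hζ : IsPrimitiveRoot ζ 3) {a b c : ℕ} (ha : eigenDim (g : End F 𝕍) ζ 0 = a)
    (hb : eigenDim (g : End F 𝕍) ζ 1 = b) (hc : eigenDim (g : End F 𝕍) ζ 2 = c) :
    ThetaRepHasGIB θ ζ ↔ (a ≤ 1 ∨ b ≤ 1 ∨ c ≤ 1) ∨
      (a = 2 ∧ b = 2) ∨ (b = 2 ∧ c = 2) ∨ (c = 2 ∧ a = 2) := by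
  have h3 := fun t => eigenDim_add_three (g := (g : End F 𝕍)) hζ.pow_eq_one t
  obtain ⟨g', p1, p2, -, p4⟩ := exists_rotation hζ.pow_eq_one hθ hg 1
  obtain ⟨g'', q1, q2, -, q4⟩ := exists_rotation hζ.pow_eq_one hθ hg 2
  have p0 := (p4 0).trans hb
  have p1' := (p4 1).trans hc
  have p2' := (p4 2).trans ((h3 0).trans ha)
  have q0 := (q4 0).trans hc
  have q1' := (q4 1).trans ((h3 0).trans ha)
  have q2' := (q4 2).trans ((h3 1).trans hb)
  constructor
  · contrapose!
    rintro ⟨⟨a1, b1, c1⟩, ab, bc, ca⟩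
    rcases le_total c a with h | h
    · rcases le_total c b with h' | h'
      · exact not_thetaRepHasGIB_of_eigenDim hθ hg hζ (by omega) (by omega) (by omega) (by omega)
          (by omega)
      · exact not_thetaRepHasGIB_of_eigenDim q1 q2 hζ (by omega) (by omega) (by omega) (by omega)
          (by omega)
    · rcases le_total a b with h' | h'
      · exact not_thetaRepHasGIB_of_eigenDim p1 p2 hζ (by omega) (by omega) (by omega) (by omega)
          (by omega)
      · exact not_thetaRepHasGIB_of_eigenDim q1 q2 hζ (by omega) (by omega) (by omega) (by omega)
          (by omega)
  · intro h
    by_cases a1 : a ≤ 1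
    · exact thetaRepHasGIB_of_eigenDim_le_one p1 p2 hζ (p2'.trans_le a1)
    by_cases b1 : b ≤ 1
    · exact thetaRepHasGIB_of_eigenDim_le_one q1 q2 hζ (q2'.trans_le b1)
    by_cases c1 : c ≤ 1
    · exact thetaRepHasGIB_of_eigenDim_le_one hθ hg hζ (hc.trans_le c1)
    rcases h.resolve_left (by omega) with ⟨h, h'⟩ | ⟨h, h'⟩ | ⟨h, h'⟩
    · exact thetaRepHasGIB_of_eigenDim_eq_two hθ hg hζ (by omega) (by omega) (by omega)
    · exact thetaRepHasGIB_of_eigenDim_eq_two p1 p2 hζ (by omega) (by omega) (by omega)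
    · exact thetaRepHasGIB_of_eigenDim_eq_two q1 q2 hζ (by omega) (by omega) (by omega)

/-- As `θ ^ 3 = 1`, the element `g ^ 3` is central, hence scalar, and `g` can be divided by a cube root
of this scalar. -/
theorem exists_isConjBy_pow_three [IsAlgClosed F] (hθ : IsConjBy θ g)
    (h3 : θ.toLinearEquiv ^ 3 = 1) : ∃ g' : (End F 𝕍)ˣ, IsConjBy θ g' ∧ g' ^ 3 = 1 := by
  rcases subsingleton_or_nontrivial 𝕍 with _ | _
  · exact ⟨g, hθ, Units.ext (Subsingleton.elim _ _)⟩
  have hcomm : ∀ x : End F 𝕍, (g : End F 𝕍) ^ 3 * x = x * (g : End F 𝕍) ^ 3 := fun x => by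
    have h : θ (θ (θ x)) = x := LinearEquiv.congr_fun h3 x
    rw [hθ, hθ, hθ] at h
    have h' : x * (g : End F 𝕍) = g * (g * (g * x * ↑g⁻¹) * ↑g⁻¹) :=
      (Units.eq_mul_inv_iff_mul_eq _).1 h.symm
    rw [pow_succ', pow_two, mul_assoc, mul_assoc, ← mul_assoc x, ← mul_assoc, h']
    simp only [mul_assoc, Units.inv_mul_cancel_left, Units.inv_mul, mul_one]
  obtain ⟨a, ha⟩ : ∃ a : F, (g : End F 𝕍) ^ 3 = a • (1 : End F 𝕍) := by
    obtain ⟨a, ha, h⟩ := Module.End.mem_center_iff.1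
      (Semigroup.mem_center_iff.2 fun x => (hcomm x).symm)
    exact ⟨a, h.trans (LinearMap.ext fun _ => rfl)⟩
  have ha0 : a ≠ 0 := by
    rintro rfl
    rw [zero_smul] at ha
    exact (g ^ 3).ne_zero (by rw [Units.val_pow_eq_pow_val, ha])
  obtain ⟨μ, hμ⟩ := IsAlgClosed.exists_pow_nat_eq a (n := 3) (by norm_num)
  have hμ0 : μ ≠ 0 := by
    rintro rfl
    exact ha0 (by rw [← hμ]; norm_num)
  refine ⟨scaleUnit (Units.mk0 μ hμ0)⁻¹ g, hθ.scaleUnit _, Units.ext ?_⟩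
  rw [Units.val_pow_eq_pow_val, coe_scaleUnit, _root_.smul_pow, ha, smul_smul, Units.val_inv_eq_inv_val,
    Units.val_mk0, ← hμ, ← mul_pow, inv_mul_cancel₀ hμ0, one_pow, one_smul]
  rfl

end Criterion

theorem cyclicallyEqual_iff (r : Fin 3 → ℕ) (x y z : ℕ) : CyclicallyEqual r ![x, y, z] ↔
    (r 0 = x ∧ r 1 = y ∧ r 2 = z) ∨ (r 1 = x ∧ r 2 = y ∧ r 0 = z) ∨
      (r 2 = x ∧ r 0 = y ∧ r 1 = z) := by
  simp [CyclicallyEqual, Fin.exists_fin_succ, Fin.forall_fin_succ]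

theorem mainTheorem2 {F : Type*} [Field F] [IsAlgClosed F] [CharZero F]
    {𝕍 : Type*} [AddCommGroup 𝕍] [Module F 𝕍] [FiniteDimensional F 𝕍]
    (ζ : F) (hζ : IsPrimitiveRoot ζ 3)
    (θ : Module.End F 𝕍 ≃ₗ⁅F⁆ Module.End F 𝕍)
    (hinner : ∃ g : (Module.End F 𝕍)ˣ, IsConjBy θ g)
    (horder : orderOf θ.toLinearEquiv = 3) :
    (∃ g : (Module.End F 𝕍)ˣ, IsConjBy θ g ∧ g ^ 3 = 1) ∧
    ∀ g : (Module.End F 𝕍)ˣ, IsConjBy θ g → g ^ 3 = 1 →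
      (ThetaRepHasGIB θ ζ ↔
        ∃ a b : ℕ, CyclicallyEqual (eigenDimVector 3 ζ g) ![a, b, 0] ∨
          CyclicallyEqual (eigenDimVector 3 ζ g) ![a, b, 1] ∨
          CyclicallyEqual (eigenDimVector 3 ζ g) ![2, 2, a]) := by
  obtain ⟨g₀, hg₀⟩ := hinner
  refine ⟨exists_isConjBy_pow_three hg₀ (horder ▸ pow_orderOf_eq_one _), fun g hθ hg => ?_⟩
  have hg' : (g : End F 𝕍) ^ 3 = 1 := by rw [← Units.val_pow_eq_pow_val, hg, Units.val_one]
  rw [thetaRepHasGIB_iff hθ hg' hζ (a := eigenDimVector 3 ζ g 0) (b := eigenDimVector 3 ζ g 1)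
    (c := eigenDimVector 3 ζ g 2) rfl rfl rfl]
  simp only [cyclicallyEqual_iff]
  generalize eigenDimVector 3 ζ g 0 = a
  generalize eigenDimVector 3 ζ g 1 = b
  generalize eigenDimVector 3 ζ g 2 = c
  constructor
  · rintro ((h | h | h) | ⟨rfl, rfl⟩ | ⟨rfl, rfl⟩ | ⟨rfl, rfl⟩)
    · obtain rfl | rfl := Nat.le_one_iff_eq_zero_or_eq_one.1 h <;> exact ⟨b, c, by simp⟩
    · obtain rfl | rfl := Nat.le_one_iff_eq_zero_or_eq_one.1 h <;> exact ⟨c, a, by simp⟩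
    · obtain rfl | rfl := Nat.le_one_iff_eq_zero_or_eq_one.1 h <;> exact ⟨a, b, by simp⟩
    · exact ⟨c, 0, by simp⟩
    · exact ⟨a, 0, by simp⟩
    · exact ⟨b, 0, by simp⟩
  · rintro ⟨x, y, (h | h | h) | (h | h | h) | h | h | h⟩ <;> omega
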